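/- Let $n\ge 1$, $\theta\in(0,\pi/2)$, let $E_{n+1}$ be the last coordinate vector of $\mathbb R^{n+1}$, $e=-E_{n+1}$, and $\mathcal C_\theta=\{\xi\in\overline{\mathbb R^{n+1}_+}:|\xi-\cos\theta\,e|=1\}$ with surface measure $\sigma$; put $\ell(\xi)=\sin^2\theta+\cos\theta\langle\xi,e\rangle$. A strictly convex capillary hypersurface is a smooth, compact, connected hypersurface $\Sigma$ with non-empty boundary, properly embedded in $\overline{\mathbb R^{n+1}_+}$ (so that it meets the hyperplane $\partial\mathbb R^{n+1}_+$ exactly in $\partial\Sigma$), such that the region $\widehat\Sigma$ enclosed by $\Sigma$ and $\partial\mathbb R^{n+1}_+$ is convex, the second fundamental form with respect to the outward unit normal $\nu$ is positive definite, and $\langle\nu,e\rangle=-\cos\theta$ on $\partial\Sigma$. Let $\widehat{\partial\Sigma}=\widehat\Sigma\cap\partial\mathbb R^{n+1}_+$ be its flat part. For $z\in\partial\mathbb R^{n+1}_+$ the capillary support function with respect to $z$ is $$u_z(\xi)=\ell(\xi)^{-1}\max_{Y\in\Sigma}\langle\xi-\cos\theta\,e,\,Y-z\rangle,\qquad \xi\in\mathcal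 C_\theta .$$ The capillary entropy is $$\mathcal E_\theta(\widehat\Sigma)=\sup_{z\in\mathrm{int}(\widehat{\partial\Sigma})}\frac1{\omega_\theta}\int_{\mathcal C_\theta}(\log u_z)\,\ell\,d\sigma,\qquad \omega_\theta=|\mathcal C_\theta|-\cos\theta\,|\widehat{\partial\mathcal C_\theta}|,$$ the interior being taken relative to $\partial\mathbb R^{n+1}_+$. Let $M$ be a compact connected smooth $n$-manifold with non-empty boundary, and let $X:M\times[0,\infty)\to\overline{\mathbb R^{n+1}_+}$ be a solution of the normalized capillary Gauss curvature flow $$\partial_tX=X-K\,(\nu+\cos\theta\,e)$$ by embeddings $X(\cdot,t)$ onto strictly convex capillary hypersurfaces $\Sigma_t$. Here $K$ is the Gauss curvature and $\nu$ the outward unit normal; $X$ is smooth on $M\times(0,\infty)$, and $X$ and $\partial_tX$ are continuous on $M\times[0,\infty)$. Assume $\mathrm{Vol}(\widehat\Sigma_0)=\mathrm{Vol}(\widehat{\mathcal C_\theta})$. Write $K(\xi,t)$ for the Gauss curvature of $\Sigma_t$ at its point where $\nu+\cos\theta\,e=\xi$, and $u(\cdot,t)$ for the capillary support function of $\Sigma_t$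 with respect to the origin. Then: 1. $t\mapsto\mathcal E_\theta(\widehat\Sigma_t)$ is non-increasing on $[0,\infty)$. 2. For every $t_0\ge0$ the supremum defining $\mathcal E_\theta(\widehat\Sigma_{t_0})$ is attained at a unique point $e(t_0)\in\mathrm{int}(\widehat{\partial\Sigma}_{t_0})$. The function $U(\xi,t)=u(\xi,t)-e^{t-t_0}\langle e(t_0),\xi\rangle/\ell(\xi)$ is positive on $\mathcal C_\theta$ for all $t\ge0$ close to $t_0$, and for these $t$ $$\frac{d}{dt}\int_{\mathcal C_\theta}(\log U(\xi,t))\,\ell\,d\sigma=-\int_{\mathcal C_\theta}\Big(\sqrt{U/K}-\sqrt{K/U}\Big)^2\ell\,d\sigma .$$ 3. The entropy is differentiable in $t$ (from the right at $t=0$), and for every $t_0\ge 0$, with $U(\cdot,t_0)=u_{e(t_0)}$, $$\frac{d}{dt}\Big|_{t=t_0}\mathcal E_\theta(\widehat\Sigma_t)=-\frac1{\omega_\theta}\int_{\mathcal C_\theta}\Big(\sqrt{U/K}-\sqrt{K/U}\Big)^2\ell\,d\sigma\Big|_{t=t_0}.$$ This vanishes if and only if $\Sigma_{t_0}-e(t_0)$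 is a soliton, that is, $K=\langle X-e(t_0),\nu\rangle/(1+\cos\theta\langle\nu,e\rangle)$ on $\Sigma_{t_0}$. -/

import Mathlib

open scoped Manifold ContDiff

noncomputable section

namespace CapillaryFlow

/-- The ambient space `ℝⁿ⁺¹`; the closed half-space is `{x | 0 ≤ x (Fin.last n)}`. -/
abbrev Amb (n : ℕ) : Type := EuclideanSpace ℝ (Fin (n + 1))

/-- The closed upper half-space. -/
def halfSpace (n : ℕ) : Set (Amb n) := {x | 0 ≤ x (Fin.last n)}

/-- The vector `e = -E_{n+1}`, the unit normal of the half-space that points out of it. -/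
def eVec (n : ℕ) : Amb n := -EuclideanSpace.single (Fin.last n) (1 : ℝ)

/-- The inclusion `y ↦ (y, 0)` of `ℝⁿ` as the boundary hyperplane of the half-space. -/
def incl {n : ℕ} (y : EuclideanSpace ℝ (Fin n)) : Amb n :=
  WithLp.toLp 2 (Fin.snoc (α := fun _ => ℝ) (fun i => y i) 0)

/-- The unit spherical cap `C_θ = {ξ ∈ half-space : |ξ - cos θ e| = 1}`. -/
def cap (n : ℕ) (θ : ℝ) : Set (Amb n) :=
  {ξ | ξ ∈ halfSpace n ∧ ‖ξ - Real.cos θ • eVec n‖ = 1}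

/-- The surface measure `σ` of `C_θ`: the spherical surface measure of the unit sphere,
translated to the sphere with centre `cos θ e` and restricted to `C_θ`. -/
def capMeasure (n : ℕ) (θ : ℝ) : MeasureTheory.Measure (Amb n) :=
  ((MeasureTheory.volume : MeasureTheory.Measure (Amb n)).toSphere.map
    (fun η : Metric.sphere (0 : Amb n) 1 => (η : Amb n) + Real.cos θ • eVec n)).restrict (cap n θ)

/-- `ℓ(ξ) = sin² θ + cos θ ⟨ξ, e⟩`. -/
def ell (n : ℕ) (θ : ℝ) (ξ : Amb n) : ℝ :=
  Real.sin θ ^ 2 + Real.cos θ * inner ℝ ξ (eVec n)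

/-- The region enclosed by `S` and the boundary hyperplane: `S`, and the points of the half-space
whose component in the complement of `S` in the half-space is bounded. -/
def body {n : ℕ} (S : Set (Amb n)) : Set (Amb n) :=
  S ∪ {x | x ∈ halfSpace n \ S ∧ Bornology.IsBounded (connectedComponentIn (halfSpace n \ S) x)}

/-- The flat part of the boundary of the body `B`, as a subset of `ℝⁿ`. -/
def flatPart {n : ℕ} (B : Set (Amb n)) : Set (EuclideanSpace ℝ (Fin n)) :=
  {y | incl y ∈ B}

/-- The capillary area `ω_θ` of `C_θ`: its area minus `cos θ` times the area of the flat part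
of the region that it encloses. -/
def omega (n : ℕ) (θ : ℝ) : ℝ :=
  (capMeasure n θ).real Set.univ -
    Real.cos θ * MeasureTheory.volume.real (flatPart (body (cap n θ)))

/-- The support function `h_z(ξ) = max_{Y ∈ S} ⟨ξ - cos θ e, Y - z⟩` of `S` with respect to `z`. -/
def supportFn {n : ℕ} (θ : ℝ) (S : Set (Amb n)) (z ξ : Amb n) : ℝ :=
  sSup ((fun Y => inner ℝ (ξ - Real.cos θ • eVec n) (Y - z)) '' S)

/-- The capillary support function `u_z = h_z / ℓ`. -/
def capSupportFn {n : ℕ} (θ : ℝ) (S : Set (Amb n)) (z ξ : Amb n) : ℝ :=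
  supportFn θ S z ξ / ell n θ ξ

/-- The entropy with respect to the point `z` of the boundary hyperplane. -/
def entropyAt {n : ℕ} (θ : ℝ) (S : Set (Amb n)) (z : EuclideanSpace ℝ (Fin n)) : ℝ :=
  (1 / omega n θ) *
    ∫ ξ, Real.log (capSupportFn θ S (incl z) ξ) * ell n θ ξ ∂(capMeasure n θ)

/-- The capillary entropy of the body enclosed by `S`: the supremum of the pointed entropies over
the interior of the flat part. -/
def entropy {n : ℕ} (θ : ℝ) (S : Set (Amb n)) : ℝ :=
  sSup (entropyAt θ S '' interior (flatPart (body S)))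

/-- `z` is a capillary entropy point: it is interior to the flat part, and the entropy with
respect to `z` is a maximum, equal to the capillary entropy. -/
def IsEntropyPoint {n : ℕ} (θ : ℝ) (S : Set (Amb n)) (z : EuclideanSpace ℝ (Fin n)) : Prop :=
  z ∈ interior (flatPart (body S)) ∧
    IsGreatest (entropyAt θ S '' interior (flatPart (body S))) (entropyAt θ S z) ∧
    entropyAt θ S z = entropy θ S

/-- `∫ (√(U/K) - √(K/U))² ℓ dσ` over the cap. -/
def dissipation {n : ℕ} (θ : ℝ) (U K : Amb n → ℝ) : ℝ :=
  ∫ ξ, (Real.sqrt (U ξ / K ξ) - Real.sqrt (K ξ / U ξ)) ^ 2 * ell n θ ξ ∂(capMeasure n θ)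

section Hypersurface

variable {n : ℕ} [NeZero n] {M : Type*} [TopologicalSpace M]
  [ChartedSpace (EuclideanHalfSpace n) M]

/-- The differential of a map from the manifold with boundary `M` to `ℝⁿ⁺¹`, with the tangent
space written as `ℝⁿ` (in the preferred chart at the point). -/
def tangentMapAt (F : M → Amb n) (x : M) : EuclideanSpace ℝ (Fin n) →L[ℝ] Amb n :=
  mfderiv (𝓡∂ n) 𝓘(ℝ, Amb n) F x

/-- The Gauss curvature of the immersion `F` with unit normal `N`: the determinant of the second
fundamental form `⟨dN v, dF w⟩` divided by that of the first one `⟨dF v, dF w⟩`. -/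
def gaussCurvature (F N : M → Amb n) (x : M) : ℝ :=
  (Matrix.of fun i j : Fin n =>
      inner ℝ (tangentMapAt N x (EuclideanSpace.single i 1))
        (tangentMapAt F x (EuclideanSpace.single j 1))).det /
    (Matrix.of fun i j : Fin n =>
      inner ℝ (tangentMapAt F x (EuclideanSpace.single i 1))
        (tangentMapAt F x (EuclideanSpace.single j 1))).det

/-- The capillary Gauss map `ν + cos θ e`. -/
def capGaussMap (θ : ℝ) (N : M → Amb n) (x : M) : Amb n := N x + Real.cos θ • eVec n

/-- The Gauss curvature as a function on `C_θ`, through the inverse of the capillary Gauss map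
(which is a bijection onto `C_θ` for strictly convex capillary hypersurfaces). -/
def capGaussCurvature [Nonempty M] (θ : ℝ) (F N : M → Amb n) (ξ : Amb n) : ℝ :=
  gaussCurvature F N (Function.invFun (capGaussMap θ N) ξ)

/-- `F` is a smooth, properly embedded, strictly convex capillary hypersurface with contact angle
`θ` in the half-space, and `N` is its outward unit normal. -/
structure IsStrictlyConvexCapillary (θ : ℝ) (F N : M → Amb n) : Prop where
  smooth : ContMDiff (𝓡∂ n) 𝓘(ℝ, Amb n) ∞ F
  injective : Function.Injective F
  immersion : ∀ x, Function.Injective (tangentMapAt F x)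
  mem_halfSpace : ∀ x, F x ∈ halfSpace n
  boundary_iff : ∀ x, F x (Fin.last n) = 0 ↔ x ∈ (𝓡∂ n).boundary M
  convex_body : Convex ℝ (body (Set.range F))
  normal_unit : ∀ x, ‖N x‖ = 1
  normal_orthogonal : ∀ x v, inner ℝ (N x) (tangentMapAt F x v) = 0
  normal_outward : ∀ x, ∀ Y ∈ body (Set.range F), inner ℝ (N x) (Y - F x) ≤ 0
  contact_angle : ∀ x ∈ (𝓡∂ n).boundary M, inner ℝ (N x) (eVec n) = -Real.cos θ
  curvature_pos : ∀ x v, v ≠ 0 → 0 < inner ℝ (tangentMapAt N x v) (tangentMapAt F x v)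

/-- `X`, with outward unit normal `ν`, is a classical solution on `[0, ∞)` of the normalized
capillary Gauss curvature flow `∂ₜ X = X - K (ν + cos θ e)` by strictly convex capillary
hypersurfaces. Each hypersurface is smooth, `X` is jointly smooth for positive times, and `X` and
its velocity are continuous up to `t = 0`; joint smoothness at `t = 0`, which would force further
compatibility conditions on the initial hypersurface, is not required. -/
structure IsNormalizedFlow (θ : ℝ) (X ν : ℝ → M → Amb n) : Prop where
  capillary : ∀ t, 0 ≤ t → IsStrictlyConvexCapillary θ (X t) (ν t)
  smooth : ContMDiffOn (𝓘(ℝ, ℝ).prod (𝓡∂ n)) 𝓘(ℝ, Amb n) ∞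
    (fun p : ℝ × M => X p.1 p.2) (Set.Ioi 0 ×ˢ Set.univ)
  continuous : ContinuousOn (fun p : ℝ × M => X p.1 p.2) (Set.Ici 0 ×ˢ Set.univ)
  continuous_speed : ContinuousOn
    (fun p : ℝ × M => gaussCurvature (X p.1) (ν p.1) p.2 • capGaussMap θ (ν p.1) p.2)
    (Set.Ici 0 ×ˢ Set.univ)
  evolution : ∀ t, 0 ≤ t → ∀ x, HasDerivWithinAt (fun s => X s x)
    (X t x - gaussCurvature (X t) (ν t) x • capGaussMap θ (ν t) x) (Set.Ici 0) t

/-- The translate `F - z` is a soliton: `K = ⟨F - z, N⟩ / (1 + cos θ ⟨N, e⟩)` everywhere.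
(The boundary condition is part of `IsStrictlyConvexCapillary`.) -/
def IsSolitonAbout (θ : ℝ) (F N : M → Amb n) (z : Amb n) : Prop :=
  ∀ x, gaussCurvature F N x =
    inner ℝ (F x - z) (N x) / (1 + Real.cos θ * inner ℝ (N x) (eVec n))

end Hypersurface

/-- `U(ξ, t) = u(ξ, t) - exp (t - t₀) ⟨z, ξ⟩ / ℓ(ξ)`, where `u(·, t)` is the capillary support
function of the hypersurface `S t` with respect to the origin. -/
def movingSupportFn {n : ℕ} (θ : ℝ) (S : ℝ → Set (Amb n)) (t₀ : ℝ)
    (z : EuclideanSpace ℝ (Fin n)) (t : ℝ) (ξ : Amb n) : ℝ :=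
  capSupportFn θ (S t) 0 ξ - Real.exp (t - t₀) * inner ℝ (incl z) ξ / ell n θ ξ

end CapillaryFlow

end

/-! ### The region enclosed by a closed set and the boundary hyperplane. -/

noncomputable section
namespace CapillaryFlow

section Body

variable {n : ℕ} {S : Set (Amb n)}

/-! Write `h` for the support function on the cap, so that `u = h / ℓ`. The normal component of `ξ =
ν + cos θ e` is `ℓ(ξ)`, hence the flow gives `∂ₜh = h - K ℓ`. The base point `exp (t - t₀) z` moves
by the linear part of this equation, so the support function `U` about it satisfies `∂ₜU = U - K`,
and the time derivative of `∫ (log U) ℓ` is `∫ ℓ - ∫ (K / U) ℓ`. Since `(√(U/K) - √(K/U))² = U/K +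
K/U - 2`, this is minus the dissipation as soon as `∫ (U / K) ℓ = ∫ ℓ`. The left side is `∫ h / K`,
that is `n + 1` times the volume of the body (`volume_body_eq`), and the right side is `n + 1` times
the volume enclosed by the cap (`integral_ell`). The identity is therefore conservation of volume.

Conservation of volume (`volume_body_eq_cap`) is proved without differentiating the volume in time.
The bodies `exp (-t) Σ̂_t` shrink, and `sweep` sends the cone over the cap onto the region that they
sweep out, with Jacobian exactly `ℓ` (`exists_hasFDerivAt_sweep`). The lost volume is thus the same
as for the cap.

Only the position and the velocity are continuous at time zero. The curvature and the normal are
recovered continuously from the velocity `K ξ`, because `ξ` lies on the cap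
(`continuousOn_gaussCurvature`), and `∂ₜh` comes from an envelope theorem for the maximum over `M`
(`hasDerivWithinAt_max`), valid from the right at zero.

The entropy point is unique because `u_z` is affine in `z` and `log` is strictly concave
(`strictConcaveOn_logIntegral`). It exists because the supremum is not approached only at the rim of
the flat part. Near a rim point, a step along the inner conormal raises the integral by a definite
amount: pair each `ξ` with its reflection in the vertical hyperplane orthogonal to the conormal, and
the product of the two values of `u_z` increases (`exists_mul_le_supportFn_sub`,
`exists_logIntegral_lt`).

The entropy is then locally a maximum over a fixed compact ball of moving base points, with a unique
maximizer at `t₀`, so the envelope theorem gives its derivative (`hasDerivWithinAt_entropy`). The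
integrand of the dissipation is continuous and nonnegative, so it integrates to zero only if `U = K`
on the whole cap, which is the soliton equation. -/

theorem mem_halfSpace_iff {y : Amb n} : y ∈ halfSpace n ↔ 0 ≤ y (Fin.last n) := Iff.rfl

theorem isClosed_halfSpace (n : ℕ) : IsClosed (halfSpace n) :=
  isClosed_le continuous_const (by fun_prop)

theorem convex_halfSpace (n : ℕ) : Convex ℝ (halfSpace n) := by
  intro x hx y hy a b ha hb _
  simp only [halfSpace, Set.mem_ofPred_eq, PiLp.add_apply, PiLp.smul_apply, smul_eq_mul] at *
  positivity

theorem subset_body (S : Set (Amb n)) : S ⊆ body S := Set.subset_union_left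

theorem body_subset_halfSpace (hS : S ⊆ halfSpace n) : body S ⊆ halfSpace n := by
  rintro x (hx | hx)
  exacts [hS hx, hx.1.1]

/-- A connected set that avoids `S` stays in one component of the complement, so membership in the
body propagates along it. Every later membership argument moves along such a set, mostly a segment.
-/
theorem mem_body_of_isPreconnected {c : Set (Amb n)} (hc : IsPreconnected c)
    (hcH : c ⊆ halfSpace n) (hcS : Disjoint c S) {a b : Amb n} (ha : a ∈ c) (hb : b ∈ c)
    (haB : a ∈ body S) : b ∈ body S := by
  have hsub : c ⊆ halfSpace n \ S := fun x hx => ⟨hcH hx, Set.disjoint_left.mp hcS hx⟩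
  rcases haB with h | h
  · exact absurd h (hsub ha).2
  · refine Or.inr ⟨hsub hb, ?_⟩
    rw [← connectedComponentIn_eq (hc.subset_connectedComponentIn ha hsub hb)]
    exact h.2

theorem mem_body_of_segment {a b : Amb n} (haB : a ∈ body S) (haH : a ∈ halfSpace n)
    (hb : b ∈ halfSpace n) (h : Disjoint (segment ℝ a b) S) : b ∈ body S :=
  mem_body_of_isPreconnected (convex_segment a b).isPreconnected
    ((convex_halfSpace n).segment_subset haH hb) h (left_mem_segment ℝ a b)
    (right_mem_segment ℝ a b) haB

theorem exists_ball_disjoint (hS : IsClosed S) {y : Amb n} (hy : y ∉ S) :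
    ∃ r > 0, Disjoint (Metric.ball y r) S := by
  obtain ⟨r, hr, h⟩ := Metric.isOpen_iff.mp hS.isOpen_compl y hy
  exact ⟨r, hr, Set.disjoint_left.mpr fun x hx => h hx⟩

theorem ball_inter_halfSpace_subset_body (hS : IsClosed S) (hSH : S ⊆ halfSpace n) {y : Amb n}
    (hy : y ∉ S) (hyB : y ∈ body S) :
    ∃ r > 0, Metric.ball y r ∩ halfSpace n ⊆ body S := by
  obtain ⟨r, hr, h⟩ := exists_ball_disjoint hS hy
  refine ⟨r, hr, fun b hb => ?_⟩
  refine mem_body_of_segment hyB (body_subset_halfSpace hSH hyB) hb.2 (h.mono_left ?_)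
  exact (convex_ball y r).segment_subset (Metric.mem_ball_self hr) hb.1

theorem isClosed_body (hS : IsClosed S) (hSH : S ⊆ halfSpace n) : IsClosed (body S) := by
  refine isClosed_of_closure_subset fun y hy => ?_
  have hyH : y ∈ halfSpace n :=
    closure_minimal (body_subset_halfSpace hSH) (isClosed_halfSpace n) hy
  by_cases hyS : y ∈ S
  · exact Or.inl hyS
  obtain ⟨r, hr, h⟩ := exists_ball_disjoint hS hyS
  obtain ⟨a, haB, ha⟩ := Metric.mem_closure_iff.mp hy r hr
  have har : a ∈ Metric.ball y r := by rwa [Metric.mem_ball, dist_comm]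
  exact mem_body_of_segment haB (body_subset_halfSpace hSH haB) hyH
    (h.mono_left ((convex_ball y r).segment_subset har (Metric.mem_ball_self hr)))

theorem not_isBounded_ray (a d : Amb n) (hd : d ≠ 0) :
    ¬ Bornology.IsBounded ((fun t : ℝ => a + t • d) '' Set.Ici 0) := by
  intro h
  obtain ⟨C, hC⟩ := h.exists_norm_le
  have hd' : 0 < ‖d‖ := norm_pos_iff.mpr hd
  have h0 : 0 ≤ (|C| + ‖a‖ + 1) / ‖d‖ := by positivity
  have h1 := hC _ ⟨(|C| + ‖a‖ + 1) / ‖d‖, h0, rfl⟩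
  have h2 : ‖((|C| + ‖a‖ + 1) / ‖d‖) • d‖ = |C| + ‖a‖ + 1 := by
    rw [norm_smul, Real.norm_of_nonneg h0]; field_simp
  have h3 := norm_sub_norm_le (((|C| + ‖a‖ + 1) / ‖d‖) • d) (-a)
  rw [sub_neg_eq_add, norm_neg, add_comm _ a, h2] at h3
  linarith [le_abs_self C]

/-- A point from which a ray escapes to infinity without meeting `S` is not enclosed by `S`. -/
theorem notMem_body_of_ray {a d : Amb n} (hd : d ≠ 0)
    (h : ∀ t : ℝ, 0 ≤ t → a + t • d ∈ halfSpace n \ S) : a ∉ body S := by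
  rintro (haS | ⟨-, hb⟩)
  · have := (h 0 le_rfl).2
    simp only [zero_smul, add_zero] at this
    exact this haS
  · refine not_isBounded_ray a d hd (hb.subset ?_)
    have hc : IsPreconnected ((fun t : ℝ => a + t • d) '' Set.Ici 0) :=
      (convex_Ici 0).isPreconnected.image _ (by fun_prop)
    refine hc.subset_connectedComponentIn ⟨0, by simp⟩ ?_
    rintro _ ⟨t, ht, rfl⟩
    exact h t ht

/-- Outside a ball that contains `S`, a point escapes along its own radial ray, which stays in the
half-space. -/
theorem isBounded_body (hS : Bornology.IsBounded S) (hSH : S ⊆ halfSpace n) :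
    Bornology.IsBounded (body S) := by
  obtain ⟨C, hC⟩ := hS.exists_norm_le
  refine (Metric.isBounded_closedBall (x := (0 : Amb n)) (r := |C|)).subset fun y hy => ?_
  rw [mem_closedBall_zero_iff]
  by_contra hlt
  push Not at hlt
  have hyH := body_subset_halfSpace hSH hy
  refine notMem_body_of_ray (S := S) (d := y) (a := y) ?_ (fun t ht => ⟨?_, fun hmem => ?_⟩) hy
  · rintro rfl; simp at hlt; linarith [abs_nonneg C]
  · simp only [halfSpace, Set.mem_ofPred_eq, PiLp.add_apply, PiLp.smul_apply, smul_eq_mul] at *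
    positivity
  · have h1 := hC _ hmem
    have h2 : y + t • y = (1 + t) • y := by module
    rw [h2, norm_smul, Real.norm_of_nonneg (by linarith)] at h1
    nlinarith [le_abs_self C, norm_nonneg y]

theorem isCompact_body (hS : IsCompact S) (hSH : S ⊆ halfSpace n) : IsCompact (body S) :=
  Metric.isCompact_of_isClosed_isBounded (isClosed_body hS.isClosed hSH)
    (isBounded_body hS.isBounded hSH)

/-- Points of the body that are not on `S` and have positive height are interior. -/
theorem mem_interior_body (hS : IsClosed S) (hSH : S ⊆ halfSpace n) {y : Amb n}
    (hy : y ∉ S) (hyB : y ∈ body S) (hpos : 0 < y (Fin.last n)) : y ∈ interior (body S) := by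
  obtain ⟨r, hr, h⟩ := ball_inter_halfSpace_subset_body hS hSH hy hyB
  have ho : IsOpen {x : Amb n | 0 < x (Fin.last n)} :=
    isOpen_lt continuous_const (by fun_prop)
  rw [mem_interior]
  exact ⟨Metric.ball y r ∩ {x : Amb n | 0 < x (Fin.last n)},
    fun x hx => h ⟨hx.1, mem_halfSpace_iff.mpr (le_of_lt hx.2)⟩, Metric.isOpen_ball.inter ho,
    Metric.mem_ball_self hr, hpos⟩

/-- The exit point of a segment that leaves the body inside the half-space lies on `S`. -/
theorem exists_mem_segment_inter {a b : Amb n} (hSH : S ⊆ halfSpace n) (ha : a ∈ body S)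
    (hb : b ∈ halfSpace n) (hbB : b ∉ body S) :
    ∃ s ∈ Set.Ico (0 : ℝ) 1, a + s • (b - a) ∈ S := by
  by_contra hcon
  push Not at hcon
  refine hbB (mem_body_of_segment ha (body_subset_halfSpace hSH ha) hb ?_)
  rw [segment_eq_image', Set.disjoint_left]
  rintro _ ⟨s, hs, rfl⟩ hmem
  rcases hs.2.eq_or_lt with h1 | h1
  · subst h1
    simp only [one_smul, add_sub_cancel] at hmem
    exact hbB (Or.inl hmem)
  · exact hcon s ⟨hs.1, h1⟩ hmem

theorem incl_last (z : EuclideanSpace ℝ (Fin n)) : incl z (Fin.last n) = 0 := by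
  simp [incl]

theorem incl_castSucc (z : EuclideanSpace ℝ (Fin n)) (i : Fin n) : incl z i.castSucc = z i := by
  simp [incl]

theorem inner_eVec (y : Amb n) : inner ℝ y (eVec n) = -y (Fin.last n) := by
  simp [eVec, inner_neg_right, EuclideanSpace.inner_single_right]

theorem norm_eVec (n : ℕ) : ‖eVec n‖ = 1 := by simp [eVec]

theorem eVec_last (n : ℕ) : eVec n (Fin.last n) = -1 := by simp [eVec]

theorem abs_last_le_norm (y : Amb n) : |y (Fin.last n)| ≤ ‖y‖ := by
  rw [← abs_neg, ← inner_eVec]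
  simpa [norm_eVec] using abs_real_inner_le_norm y (eVec n)

/-- The inclusion of the boundary hyperplane as a linear isometry. -/
def inclₗ (n : ℕ) : EuclideanSpace ℝ (Fin n) →ₗᵢ[ℝ] Amb n where
  toFun := incl
  map_add' x y := by
    ext i
    refine Fin.lastCases ?_ (fun i => ?_) i <;> simp [incl_last, incl_castSucc]
  map_smul' c x := by
    ext i
    refine Fin.lastCases ?_ (fun i => ?_) i <;> simp [incl_last, incl_castSucc]
  norm_map' x := by
    simp [EuclideanSpace.norm_eq, Fin.sum_univ_castSucc, incl_last, incl_castSucc]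

theorem incl_add (x y : EuclideanSpace ℝ (Fin n)) : incl (x + y) = incl x + incl y :=
  (inclₗ n).map_add x y

theorem incl_sub (x y : EuclideanSpace ℝ (Fin n)) : incl (x - y) = incl x - incl y :=
  (inclₗ n).map_sub x y

theorem incl_smul (c : ℝ) (x : EuclideanSpace ℝ (Fin n)) : incl (c • x) = c • incl x :=
  (inclₗ n).map_smul c x

theorem norm_incl (x : EuclideanSpace ℝ (Fin n)) : ‖incl x‖ = ‖x‖ := (inclₗ n).norm_map x

theorem continuous_incl : Continuous (incl : EuclideanSpace ℝ (Fin n) → Amb n) :=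
  (inclₗ n).continuous

theorem incl_mem_halfSpace (z : EuclideanSpace ℝ (Fin n)) : incl z ∈ halfSpace n :=
  (incl_last z).ge

/-- The horizontal part of a vector. -/
def proj (y : Amb n) : EuclideanSpace ℝ (Fin n) := WithLp.toLp 2 fun i => y i.castSucc

theorem proj_apply (y : Amb n) (i : Fin n) : proj y i = y i.castSucc := rfl

theorem incl_proj (y : Amb n) : incl (proj y) = y + y (Fin.last n) • eVec n := by
  ext i
  refine Fin.lastCases ?_ (fun i => ?_) i
  · simp [incl_last, eVec]
  · simp [incl_castSucc, proj_apply, eVec]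

theorem incl_proj_of_last_eq_zero {y : Amb n} (h : y (Fin.last n) = 0) : incl (proj y) = y := by
  rw [incl_proj, h, zero_smul, add_zero]

end Body

end CapillaryFlow

end

/-! ### First-order expansions in charts, including boundary points. -/

noncomputable section
namespace CapillaryFlow

open Filter Topology Asymptotics

theorem exists_pos_le_norm_of_injective {V W : Type*} [NormedAddCommGroup V] [NormedSpace ℝ V]
    [FiniteDimensional ℝ V] [NormedAddCommGroup W] [NormedSpace ℝ W] (L : V →L[ℝ] W)
    (hL : Function.Injective L) : ∃ c > 0, ∀ v, c * ‖v‖ ≤ ‖L v‖ := by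
  obtain ⟨K, hK, h⟩ := (LinearMap.injective_iff_antilipschitz (f := (L : V →ₗ[ℝ] W))).mp hL
  refine ⟨(K : ℝ)⁻¹, by positivity, fun v => ?_⟩
  have h1 := h.le_mul_dist v 0
  simp only [dist_zero_right, map_zero] at h1
  rw [inv_mul_le_iff₀ (by positivity)]
  exact h1

theorem exists_pos_le_of_posDef {V W : Type*} [NormedAddCommGroup V] [NormedSpace ℝ V]
    [FiniteDimensional ℝ V] [Nontrivial V] [NormedAddCommGroup W] [InnerProductSpace ℝ W]
    (A L : V →L[ℝ] W) (h : ∀ v, v ≠ 0 → 0 < inner ℝ (A v) (L v)) :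
    ∃ c > 0, ∀ v, c * ‖v‖ ^ 2 ≤ inner ℝ (A v) (L v) := by
  obtain ⟨v₀, hv₀, hmin⟩ := (isCompact_sphere (0 : V) 1).exists_isMinOn
    (NormedSpace.sphere_nonempty.mpr zero_le_one)
    (f := fun v => inner ℝ (A v) (L v)) (by fun_prop)
  have hv₀' : v₀ ≠ 0 := by
    rintro rfl
    simp at hv₀
  refine ⟨_, h v₀ hv₀', fun v => ?_⟩
  rcases eq_or_ne v 0 with rfl | hv
  · simp
  have hn : 0 < ‖v‖ := norm_pos_iff.mpr hv
  have h1 := hmin (a := ‖v‖⁻¹ • v) (by simp [norm_smul, hn.ne'])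
  simp only [Set.mem_ofPred_eq, map_smul, inner_smul_left, inner_smul_right] at h1
  simp only [conj_trivial] at h1
  have h2 : ‖v‖⁻¹ * (‖v‖⁻¹ * inner ℝ (A v) (L v)) * ‖v‖ ^ 2 = inner ℝ (A v) (L v) := by
    field_simp
  rw [← h2]
  gcongr

section Chart

variable {n : ℕ} [NeZero n] {M : Type*} [TopologicalSpace M]
  [ChartedSpace (EuclideanHalfSpace n) M] {G : M → Amb n} {x₀ : M}

/-- The expansion is stated on `M` itself, through the preferred chart, so that it also holds at
boundary points, where the derivative is only taken within the range of the model. -/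
theorem isLittleO_tangentMapAt (h : MDifferentiableAt (𝓡∂ n) 𝓘(ℝ, Amb n) G x₀) :
    (fun x => G x - G x₀ - tangentMapAt G x₀
      (extChartAt (𝓡∂ n) x₀ x - extChartAt (𝓡∂ n) x₀ x₀)) =o[𝓝 x₀]
      fun x => extChartAt (𝓡∂ n) x₀ x - extChartAt (𝓡∂ n) x₀ x₀ := by
  have h1 := h.hasMFDerivAt.2.isLittleO
  have h2 : Tendsto (extChartAt (𝓡∂ n) x₀) (𝓝 x₀)
      (𝓝[Set.range (𝓡∂ n)] (extChartAt (𝓡∂ n) x₀ x₀)) :=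
    tendsto_nhdsWithin_iff.mpr ⟨continuousAt_extChartAt x₀,
      Eventually.of_forall fun x => ⟨_, rfl⟩⟩
  have h3 := h1.comp_tendsto h2
  refine h3.congr' ?_ EventuallyEq.rfl
  filter_upwards [extChartAt_source_mem_nhds (I := 𝓡∂ n) x₀] with x hx
  simp only [Function.comp, writtenInExtChartAt, extChartAt_to_inv, (extChartAt (𝓡∂ n) x₀).left_inv hx]
  rfl

theorem extChartAt_ne_of_ne {x : M} (hx : x ∈ (extChartAt (𝓡∂ n) x₀).source) (h : x ≠ x₀) :
    0 < ‖extChartAt (𝓡∂ n) x₀ x - extChartAt (𝓡∂ n) x₀ x₀‖ := by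
  rw [norm_pos_iff, sub_ne_zero]
  exact fun h' => h ((extChartAt (𝓡∂ n) x₀).injOn hx (mem_extChartAt_source x₀) h')

/-- At an interior point of the manifold, a real function that has a local minimum and is an
inner product with a fixed vector has a vanishing differential. -/
theorem inner_tangentMapAt_eq_zero_of_isLocalMin
    (h : MDifferentiableAt (𝓡∂ n) 𝓘(ℝ, Amb n) G x₀) (hint : (𝓡∂ n).IsInteriorPoint x₀)
    (c : Amb n) (hmin : ∀ x, inner ℝ c (G x₀) ≤ inner ℝ c (G x)) (v : EuclideanSpace ℝ (Fin n)) :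
    inner ℝ c (tangentMapAt G x₀ v) = 0 := by
  have h1 : HasFDerivAt (writtenInExtChartAt (𝓡∂ n) 𝓘(ℝ, Amb n) x₀ G) (tangentMapAt G x₀)
      (extChartAt (𝓡∂ n) x₀ x₀) :=
    h.hasMFDerivAt.2.hasFDerivAt (mem_interior_iff_mem_nhds.mp hint)
  have h2 := (innerSL ℝ c).hasFDerivAt.comp (extChartAt (𝓡∂ n) x₀ x₀) h1
  have h3 : IsLocalMin ((innerSL ℝ c) ∘ writtenInExtChartAt (𝓡∂ n) 𝓘(ℝ, Amb n) x₀ G)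
      (extChartAt (𝓡∂ n) x₀ x₀) := by
    refine Eventually.of_forall fun y => ?_
    simp only [Function.comp, writtenInExtChartAt, innerSL_apply_apply, extChartAt_to_inv]
    exact hmin _
  have h4 := h3.hasFDerivAt_eq_zero h2
  simpa using DFunLike.congr_fun h4 v

end Chart

end CapillaryFlow

end

/-! ### Tangent hyperplanes and convexity of the enclosed body. -/

noncomputable section
set_option linter.unusedSectionVars false
namespace CapillaryFlow

open Filter Topology Asymptotics

section Codim

variable {n : ℕ} {L : EuclideanSpace ℝ (Fin n) →L[ℝ] Amb n} {u : Amb n}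

theorem range_eq_orthogonal (hL : Function.Injective L) (hu : u ≠ 0)
    (h : ∀ v, inner ℝ u (L v) = 0) :
    LinearMap.range (L : EuclideanSpace ℝ (Fin n) →ₗ[ℝ] Amb n) = (ℝ ∙ u)ᗮ := by
  refine Submodule.eq_of_le_of_finrank_eq ?_ ?_
  · rintro _ ⟨v, rfl⟩
    exact Submodule.mem_orthogonal_singleton_iff_inner_right.mpr (h v)
  · rw [LinearMap.finrank_range_of_inj hL]
    have : Fact (Module.finrank ℝ (Amb n) = n + 1) := ⟨by simp⟩
    rw [Submodule.finrank_orthogonal_span_singleton (n := n) hu]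
    simp

theorem exists_smul_of_inner_eq_zero (hL : Function.Injective L) (hu : u ≠ 0)
    (h : ∀ v, inner ℝ u (L v) = 0) {y : Amb n} (hy : ∀ v, inner ℝ y (L v) = 0) :
    ∃ a : ℝ, y = a • u := by
  have : y ∈ (ℝ ∙ u)ᗮᗮ := by
    rw [← range_eq_orthogonal hL hu h, Submodule.mem_orthogonal]
    rintro _ ⟨v, rfl⟩
    rw [real_inner_comm]
    exact hy v
  rw [Submodule.orthogonal_orthogonal, Submodule.mem_span_singleton] at this
  obtain ⟨a, ha⟩ := this
  exact ⟨a, ha.symm⟩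

theorem tangentMapAt_of_comp_const [NeZero n] {M : Type*} [TopologicalSpace M]
    [ChartedSpace (EuclideanHalfSpace n) M] {G : M → Amb n} {x₀ : M}
    (h : MDifferentiableAt (𝓡∂ n) 𝓘(ℝ, Amb n) G x₀) {g : Amb n → ℝ} {g' : Amb n →L[ℝ] ℝ}
    (hg : HasFDerivAt g g' (G x₀)) {a : ℝ} (hconst : ∀ x, g (G x) = a)
    (v : EuclideanSpace ℝ (Fin n)) : g' (tangentMapAt G x₀ v) = 0 := by
  have h1 := hg.hasMFDerivAt.comp x₀ h.hasMFDerivAt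
  have h2 : g ∘ G = fun _ => a := funext hconst
  rw [h2] at h1
  have h3 := hasMFDerivAt_unique h1 (hasMFDerivAt_const a x₀)
  exact DFunLike.congr_fun h3 v

end Codim

namespace IsStrictlyConvexCapillary

variable {n : ℕ} [NeZero n] {M : Type*} [TopologicalSpace M] [CompactSpace M] [ConnectedSpace M]
  [ChartedSpace (EuclideanHalfSpace n) M] {θ : ℝ} {F N : M → Amb n}


theorem mdifferentiableAt (hc : IsStrictlyConvexCapillary θ F N) (x : M) :
    MDifferentiableAt (𝓡∂ n) 𝓘(ℝ, Amb n) F x :=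
  (hc.smooth x).mdifferentiableAt (by simp)

/-- Differentiability of the normal is not among the hypotheses. Where it fails, `mfderiv` takes the
default value zero, which contradicts the positive second fundamental form; a nonzero tangent vector
exists because `n` is nonzero. -/
theorem mdifferentiableAt_normal (hc : IsStrictlyConvexCapillary θ F N) (x : M) :
    MDifferentiableAt (𝓡∂ n) 𝓘(ℝ, Amb n) N x := by
  by_contra h
  have h1 := hc.curvature_pos x (EuclideanSpace.single 0 1) (by simp)
  have h2 : tangentMapAt N x = 0 := mfderiv_zero_of_not_mdifferentiableAt h
  rw [h2, zero_apply, inner_zero_left] at h1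
  exact lt_irrefl _ h1

theorem continuous (hc : IsStrictlyConvexCapillary θ F N) : Continuous F :=
  continuous_iff_continuousAt.mpr fun x => (hc.mdifferentiableAt x).continuousAt

theorem continuous_normal (hc : IsStrictlyConvexCapillary θ F N) : Continuous N :=
  continuous_iff_continuousAt.mpr fun x => (hc.mdifferentiableAt_normal x).continuousAt

theorem t2Space (hc : IsStrictlyConvexCapillary θ F N) : T2Space M :=
  T2Space.of_injective_continuous hc.injective hc.continuous

theorem range_subset (hc : IsStrictlyConvexCapillary θ F N) : Set.range F ⊆ halfSpace n := by
  rintro _ ⟨x, rfl⟩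
  exact hc.mem_halfSpace x

theorem mem_body (_hc : IsStrictlyConvexCapillary θ F N) (x : M) : F x ∈ body (Set.range F) :=
  subset_body _ ⟨x, rfl⟩

theorem normal_ne_zero (hc : IsStrictlyConvexCapillary θ F N) (x : M) : N x ≠ 0 := by
  rw [← norm_ne_zero_iff, hc.normal_unit]
  exact one_ne_zero

theorem inner_normal_tangentMapAt_normal (hc : IsStrictlyConvexCapillary θ F N) (x : M)
    (v : EuclideanSpace ℝ (Fin n)) : inner ℝ (N x) (tangentMapAt N x v) = 0 := by
  have h := tangentMapAt_of_comp_const (hc.mdifferentiableAt_normal x)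
    (hasStrictFDerivAt_norm_sq (N x)).hasFDerivAt (a := 1)
    (fun y => by simp [hc.normal_unit]) v
  simpa using h

/-- The normal is strictly monotone along the hypersurface near each of its points. -/
theorem eventually_inner_sub_pos (hc : IsStrictlyConvexCapillary θ F N) (x₀ : M) :
    ∀ᶠ x in 𝓝 x₀, x ≠ x₀ → 0 < inner ℝ (N x - N x₀) (F x - F x₀) := by
  have : Nontrivial (EuclideanSpace ℝ (Fin n)) :=
    ⟨EuclideanSpace.single 0 1, 0, by simp⟩
  obtain ⟨c, hc0, hQ⟩ := exists_pos_le_of_posDef _ _ (hc.curvature_pos x₀)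
  set A := tangentMapAt N x₀
  set L := tangentMapAt F x₀
  set ψ : M → EuclideanSpace ℝ (Fin n) :=
    fun x => extChartAt (𝓡∂ n) x₀ x - extChartAt (𝓡∂ n) x₀ x₀
  -- The errors in the expanded product add up to at most `η * K * ‖ψ x‖ ^ 2`, the summand `1` of
  -- `K` covering the product of the two remainders as `η ≤ 1`. The bound `η * K ≤ c / 2` leaves
  -- half of the quadratic form.
  set K := ‖A‖ + ‖L‖ + 1
  have hK : 0 < K := by positivity
  obtain ⟨η, hη, hη1, hηK⟩ : ∃ η > 0, η ≤ 1 ∧ η * K ≤ c / 2 := by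
    refine ⟨min 1 (c / 2 / K), by positivity, min_le_left _ _, ?_⟩
    calc min 1 (c / 2 / K) * K ≤ c / 2 / K * K := by gcongr; exact min_le_right _ _
      _ = c / 2 := by field_simp
  filter_upwards [(isLittleO_tangentMapAt (hc.mdifferentiableAt x₀)).def hη,
    (isLittleO_tangentMapAt (hc.mdifferentiableAt_normal x₀)).def hη,
    extChartAt_source_mem_nhds (I := 𝓡∂ n) x₀] with x h1 h2 hx hne
  have hψ : 0 < ‖ψ x‖ := extChartAt_ne_of_ne hx hne
  change ‖F x - F x₀ - L (ψ x)‖ ≤ η * ‖ψ x‖ at h1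
  change ‖N x - N x₀ - A (ψ x)‖ ≤ η * ‖ψ x‖ at h2
  set r := F x - F x₀ - L (ψ x)
  set s := N x - N x₀ - A (ψ x)
  have e1 : F x - F x₀ = L (ψ x) + r := by simp [r]
  have e2 : N x - N x₀ = A (ψ x) + s := by simp [s]
  have b1 : -(‖A (ψ x)‖ * ‖r‖) ≤ inner ℝ (A (ψ x)) r :=
    (abs_le.mp (abs_real_inner_le_norm _ _)).1
  have b2 : -(‖s‖ * ‖L (ψ x)‖) ≤ inner ℝ s (L (ψ x)) :=
    (abs_le.mp (abs_real_inner_le_norm _ _)).1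
  have b3 : -(‖s‖ * ‖r‖) ≤ inner ℝ s r := (abs_le.mp (abs_real_inner_le_norm _ _)).1
  have b4 : ‖A (ψ x)‖ * ‖r‖ ≤ ‖A‖ * ‖ψ x‖ * (η * ‖ψ x‖) := by
    gcongr
    exact A.le_opNorm _
  have b5 : ‖s‖ * ‖L (ψ x)‖ ≤ η * ‖ψ x‖ * (‖L‖ * ‖ψ x‖) := by
    gcongr
    exact L.le_opNorm _
  have b6 : ‖s‖ * ‖r‖ ≤ η * ‖ψ x‖ * (1 * ‖ψ x‖) := by
    gcongr
    exact h1.trans (by gcongr)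
  rw [e1, e2, inner_add_left, inner_add_right, inner_add_right]
  have b7 : η * K * ‖ψ x‖ ^ 2 ≤ c / 2 * ‖ψ x‖ ^ 2 := by gcongr
  have b8 : η * K * ‖ψ x‖ ^ 2 = ‖A‖ * ‖ψ x‖ * (η * ‖ψ x‖) + η * ‖ψ x‖ * (‖L‖ * ‖ψ x‖)
      + η * ‖ψ x‖ * (1 * ‖ψ x‖) := by simp only [K]; ring
  have b9 : 0 < c / 2 * ‖ψ x‖ ^ 2 := by positivity
  have := hQ (ψ x)
  linarith



theorem isCompact_range (hc : IsStrictlyConvexCapillary θ F N) : IsCompact (Set.range F) :=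
  _root_.isCompact_range hc.continuous

theorem isCompact_body (hc : IsStrictlyConvexCapillary θ F N) : IsCompact (body (Set.range F)) :=
  CapillaryFlow.isCompact_body hc.isCompact_range hc.range_subset

/-- The hypersurface is tangent to the hyperplane orthogonal to its normal. -/
theorem eventually_abs_inner_le (hc : IsStrictlyConvexCapillary θ F N) (x₀ : M) {η : ℝ}
    (hη : 0 < η) : ∀ᶠ y in 𝓝 (F x₀), y ∈ Set.range F →
      |inner ℝ (N x₀) (y - F x₀)| ≤ η * ‖y - F x₀‖ := by
  have := hc.t2Space
  have hemb := (hc.continuous.isClosedEmbedding hc.injective).isEmbedding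
  -- Since `F` is an embedding, points of the hypersurface near `F x₀` come from points of `M` near
  -- `x₀`; no other sheet comes close.
  suffices h : ∀ᶠ x in 𝓝 x₀, |inner ℝ (N x₀) (F x - F x₀)| ≤ η * ‖F x - F x₀‖ by
    rw [hemb.isInducing.nhds_eq_comap, eventually_comap] at h
    filter_upwards [h] with y hy
    rintro ⟨x, rfl⟩
    exact hy x rfl
  obtain ⟨c, hc0, hL⟩ := exists_pos_le_norm_of_injective _ (hc.immersion x₀)
  set L := tangentMapAt F x₀
  set ψ : M → EuclideanSpace ℝ (Fin n) :=
    fun x => extChartAt (𝓡∂ n) x₀ x - extChartAt (𝓡∂ n) x₀ x₀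
  -- The first bound keeps `‖F x - F x₀‖` above `c / 2 * ‖ψ x‖`; the second turns the remainder into
  -- `η` times that quantity.
  set δ := min (c / 2) (η * c / 2)
  have hδ : 0 < δ := by positivity
  filter_upwards [(isLittleO_tangentMapAt (hc.mdifferentiableAt x₀)).def hδ] with x h1
  change ‖F x - F x₀ - L (ψ x)‖ ≤ δ * ‖ψ x‖ at h1
  have h2 : inner ℝ (N x₀) (F x - F x₀) = inner ℝ (N x₀) (F x - F x₀ - L (ψ x)) := by
    rw [inner_sub_right _ _ (L (ψ x)), hc.normal_orthogonal, sub_zero]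
  have h3 : |inner ℝ (N x₀) (F x - F x₀)| ≤ δ * ‖ψ x‖ := by
    rw [h2]
    refine (abs_real_inner_le_norm _ _).trans ?_
    rwa [hc.normal_unit, one_mul]
  have h4 : c / 2 * ‖ψ x‖ ≤ ‖F x - F x₀‖ := by
    have e : L (ψ x) = (F x - F x₀) - (F x - F x₀ - L (ψ x)) := by abel
    have := norm_sub_le (F x - F x₀) (F x - F x₀ - L (ψ x))
    rw [← e] at this
    have h5 : δ * ‖ψ x‖ ≤ c / 2 * ‖ψ x‖ := by gcongr; exact min_le_left _ _
    linarith [hL (ψ x)]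
  calc _ ≤ δ * ‖ψ x‖ := h3
    _ ≤ η * c / 2 * ‖ψ x‖ := by gcongr; exact min_le_right _ _
    _ = η * (c / 2 * ‖ψ x‖) := by ring
    _ ≤ _ := by gcongr



/-- Otherwise the convex body lies in a hyperplane with normal `c`. Every tangent space is then
orthogonal to `c`, so `N` is everywhere a multiple of `c`. Hence the inner product of `N` with one
fixed tangent vector vanishes identically, and its derivative contradicts the positive second
fundamental form. -/
theorem interior_body_nonempty (hc : IsStrictlyConvexCapillary θ F N) :
    (interior (body (Set.range F))).Nonempty := by
  rw [hc.convex_body.interior_nonempty_iff_affineSpan_eq_top]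
  by_contra hne
  obtain ⟨x₀⟩ : Nonempty M := inferInstance
  have hx₀ : F x₀ ∈ affineSpan ℝ (body (Set.range F)) :=
    subset_affineSpan ℝ _ (hc.mem_body x₀)
  have hdir : (affineSpan ℝ (body (Set.range F))).direction ≠ ⊤ := fun h =>
    hne ((AffineSubspace.direction_eq_top_iff_of_nonempty ⟨_, hx₀⟩).mp h)
  obtain ⟨c, hcmem, hc0⟩ := Submodule.exists_mem_ne_zero_of_ne_bot
    (fun h => hdir ((Submodule.orthogonal_eq_bot_iff).mp h))
  have hconst : ∀ x, innerSL ℝ c (F x) = inner ℝ c (F x₀) := fun x => by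
    have h1 : F x -ᵥ F x₀ ∈ (affineSpan ℝ (body (Set.range F))).direction :=
      AffineSubspace.vsub_mem_direction (subset_affineSpan ℝ _ (hc.mem_body x)) hx₀
    have h2 := Submodule.inner_left_of_mem_orthogonal h1 hcmem
    rw [vsub_eq_sub, inner_sub_right, sub_eq_zero] at h2
    exact h2
  have hcF : ∀ x v, inner ℝ c (tangentMapAt F x v) = 0 := fun x v =>
    tangentMapAt_of_comp_const (hc.mdifferentiableAt x) (innerSL ℝ c).hasFDerivAt hconst v
  have hN : ∀ x, ∃ a : ℝ, N x = a • c := fun x =>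
    exists_smul_of_inner_eq_zero (hc.immersion x) hc0 (hcF x) (hc.normal_orthogonal x)
  set v : EuclideanSpace ℝ (Fin n) := EuclideanSpace.single 0 1
  have hpos := hc.curvature_pos x₀ v (by simp [v])
  have hzero := tangentMapAt_of_comp_const (hc.mdifferentiableAt_normal x₀)
    (innerSL ℝ (tangentMapAt F x₀ v)).hasFDerivAt (a := 0) (fun x => by
      obtain ⟨a, ha⟩ := hN x
      rw [ha, innerSL_apply_apply, inner_smul_right, real_inner_comm, hcF, mul_zero]) v
  rw [innerSL_apply_apply, real_inner_comm] at hzero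
  exact hpos.ne' hzero

theorem inner_neg_of_mem_interior (hc : IsStrictlyConvexCapillary θ F N) {p : Amb n}
    (hp : p ∈ interior (body (Set.range F))) (x : M) : inner ℝ (N x) (p - F x) < 0 := by
  obtain ⟨r, hr, hsub⟩ := Metric.mem_nhds_iff.mp (mem_interior_iff_mem_nhds.mp hp)
  have h1 : p + (r / 2) • N x ∈ Metric.ball p r := by
    rw [mem_ball_iff_norm, add_sub_cancel_left, norm_smul, hc.normal_unit,
      Real.norm_of_nonneg (by positivity)]
    linarith
  have h2 := hc.normal_outward x _ (hsub h1)
  have e : p + (r / 2) • N x - F x = (p - F x) + (r / 2) • N x := by abel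
  rw [e, inner_add_right, inner_smul_right, real_inner_self_eq_norm_sq, hc.normal_unit] at h2
  linarith


/-- Directions that point strictly inward, and stay in the half-space, enter the body. -/
theorem eventually_mem_body (hc : IsStrictlyConvexCapillary θ F N) (x₀ : M) {m : Amb n}
    (hm : inner ℝ (N x₀) m < 0) (hH : ∀ᶠ ε : ℝ in 𝓝[>] 0, F x₀ + ε • m ∈ halfSpace n) :
    ∀ᶠ ε : ℝ in 𝓝[>] 0, F x₀ + ε • m ∈ body (Set.range F) \ Set.range F := by
  obtain ⟨p, hp⟩ := hc.interior_body_nonempty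
  have hpN := hc.inner_neg_of_mem_interior hp x₀
  set d := p - F x₀
  set c := min (-inner ℝ (N x₀) m) (-inner ℝ (N x₀) d)
  have hc0 : 0 < c := lt_min (by linarith) (by linarith)
  set R := ‖m‖ + ‖d‖ + 1
  have hR : 0 < R := by positivity
  obtain ⟨ρ, hρ, hη⟩ := Metric.eventually_nhds_iff.mp
    (hc.eventually_abs_inner_le x₀ (η := c / (2 * R)) (by positivity))
  -- By convexity `F x₀ + ε • d` lies in the body, so it suffices that the segment from there to `F
  -- x₀ + ε • m` misses the hypersurface. Its directions `k` satisfy `⟨N x₀, k⟩ ≤ -c` and `‖k‖ ≤ R`,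
  -- whereas nearby points of the hypersurface deviate from the tangent hyperplane by at most `c /
  -- 2` per unit of `ε`.
  have key : ∀ ε : ℝ, 0 < ε → ε * R < ρ → ∀ s ∈ Set.Icc (0 : ℝ) 1,
      F x₀ + ε • (d + s • (m - d)) ∉ Set.range F := by
    intro ε hε hεR s hs hmem
    set k := d + s • (m - d)
    have hk : ‖k‖ ≤ R := by
      have e : k = (1 - s) • d + s • m := by simp only [k]; module
      rw [e]
      refine (norm_add_le _ _).trans ?_
      rw [norm_smul, norm_smul, Real.norm_of_nonneg hs.1, Real.norm_of_nonneg (by linarith [hs.2])]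
      nlinarith [norm_nonneg d, norm_nonneg m, hs.1, hs.2]
    have hNk : inner ℝ (N x₀) k ≤ -c := by
      have e : k = (1 - s) • d + s • m := by simp only [k]; module
      rw [e, inner_add_right, inner_smul_right, inner_smul_right]
      have h1 : c ≤ -inner ℝ (N x₀) m := min_le_left _ _
      have h2 : c ≤ -inner ℝ (N x₀) d := min_le_right _ _
      nlinarith [hs.1, hs.2]
    have hdist : dist (F x₀ + ε • k) (F x₀) < ρ := by
      rw [dist_eq_norm, add_sub_cancel_left, norm_smul, Real.norm_of_nonneg hε.le]
      exact lt_of_le_of_lt (by gcongr) hεR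
    have h3 := hη hdist hmem
    rw [add_sub_cancel_left, inner_smul_right, norm_smul, Real.norm_of_nonneg hε.le, abs_mul,
      abs_of_pos hε] at h3
    have h4 : c / (2 * R) * (ε * ‖k‖) ≤ ε * (c / 2) := by
      calc c / (2 * R) * (ε * ‖k‖) ≤ c / (2 * R) * (ε * R) := by gcongr
        _ = ε * (c / 2) := by field_simp
    have h5 := le_of_mul_le_mul_left (h3.trans h4) hε
    have h6 := neg_abs_le (inner ℝ (N x₀) k)
    linarith
  have hev : ∀ᶠ ε : ℝ in 𝓝[>] 0, ε * R < ρ := by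
    have : Tendsto (fun ε : ℝ => ε * R) (𝓝[>] 0) (𝓝 0) := by
      have h : Continuous fun ε : ℝ => ε * R := by fun_prop
      exact (by simpa using h.tendsto 0 : Tendsto (fun ε : ℝ => ε * R) (𝓝 0) (𝓝 0)).mono_left
        nhdsWithin_le_nhds
    exact this.eventually (gt_mem_nhds hρ)
  have hev1 : ∀ᶠ ε : ℝ in 𝓝[>] 0, ε < 1 :=
    nhdsWithin_le_nhds (gt_mem_nhds one_pos)
  filter_upwards [hH, hev, hev1, self_mem_nhdsWithin] with ε hεH hεR hε1 hε
  have hε0 : 0 < ε := hε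
  have hend : F x₀ + ε • m ∉ Set.range F := by
    have := key ε hε0 hεR 1 (by simp)
    rwa [one_smul, add_sub_cancel] at this
  refine ⟨?_, hend⟩
  by_contra hB
  have ha : F x₀ + ε • d ∈ body (Set.range F) :=
    hc.convex_body.add_smul_sub_mem (hc.mem_body x₀) (interior_subset hp) ⟨hε0.le, hε1.le⟩
  obtain ⟨s, hs, hmem⟩ := exists_mem_segment_inter hc.range_subset ha hεH hB
  refine key ε hε0 hεR s ⟨hs.1, hs.2.le⟩ ?_
  convert hmem using 1
  module

/-- A point of the half-space outside the body is separated from it by a tangent hyperplane. -/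
theorem exists_inner_pos_of_notMem (hc : IsStrictlyConvexCapillary θ F N) {y : Amb n}
    (hy : y ∈ halfSpace n) (hyB : y ∉ body (Set.range F)) : ∃ x, 0 < inner ℝ (N x) (y - F x) := by
  obtain ⟨p, hp⟩ := hc.interior_body_nonempty
  -- The segment from an interior point `p` to `y` crosses the hypersurface. The tangent hyperplane
  -- at the crossing has `p` strictly on its inner side, hence `y` strictly on its outer side.
  obtain ⟨s, hs, x, hx⟩ := exists_mem_segment_inter hc.range_subset (interior_subset hp) hy hyB
  refine ⟨x, ?_⟩
  have h1 := hc.inner_neg_of_mem_interior hp x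
  have hs0 : 0 < s := by
    rcases hs.1.eq_or_lt with h | h
    · subst h
      rw [zero_smul, add_zero] at hx
      rw [hx, sub_self, inner_zero_right] at h1
      exact absurd h1 (lt_irrefl _)
    · exact h
  have e1 : p - F x = -(s • (y - p)) := by rw [hx]; abel
  have e2 : y - F x = (1 - s) • (y - p) := by rw [hx]; module
  rw [e1, inner_neg_right, inner_smul_right] at h1
  rw [e2, inner_smul_right]
  have h2 : 0 < inner ℝ (N x) (y - p) := by
    by_contra h; push Not at h; nlinarith
  exact mul_pos (by linarith [hs.2]) h2

theorem mem_body_iff (hc : IsStrictlyConvexCapillary θ F N) {y : Amb n} (hy : y ∈ halfSpace n) :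
    y ∈ body (Set.range F) ↔ ∀ x, inner ℝ (N x) (y - F x) ≤ 0 := by
  refine ⟨fun h x => hc.normal_outward x y h, fun h => ?_⟩
  by_contra hB
  obtain ⟨x, hx⟩ := hc.exists_inner_pos_of_notMem hy hB
  exact absurd hx (not_lt.mpr (h x))

end IsStrictlyConvexCapillary

end CapillaryFlow

end

/-! ### The capillary Gauss map is a bijection onto the cap. -/

noncomputable section
set_option linter.unusedSectionVars false
namespace CapillaryFlow

open Filter Topology Asymptotics

theorem cos_pos_of_mem {θ : ℝ} (hθ : θ ∈ Set.Ioo 0 (Real.pi / 2)) : 0 < Real.cos θ :=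
  Real.cos_pos_of_mem_Ioo ⟨by linarith [hθ.1, Real.pi_pos], hθ.2⟩

theorem sin_pos_of_mem {θ : ℝ} (hθ : θ ∈ Set.Ioo 0 (Real.pi / 2)) : 0 < Real.sin θ :=
  Real.sin_pos_of_pos_of_lt_pi hθ.1 (by linarith [hθ.2, Real.pi_pos])

theorem cos_lt_one_of_mem {θ : ℝ} (hθ : θ ∈ Set.Ioo 0 (Real.pi / 2)) : Real.cos θ < 1 := by
  nlinarith [Real.sin_sq_add_cos_sq θ, sin_pos_of_mem hθ, cos_pos_of_mem hθ]

theorem mem_cap_iff {n : ℕ} {θ : ℝ} {ξ : Amb n} : ξ ∈ cap n θ ↔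
    ‖ξ - Real.cos θ • eVec n‖ = 1 ∧ Real.cos θ ≤ (ξ - Real.cos θ • eVec n) (Fin.last n) := by
  rw [cap, Set.mem_ofPred_eq, mem_halfSpace_iff, and_comm]
  simp [eVec_last]

theorem add_mem_cap_iff {n : ℕ} {θ : ℝ} {ν : Amb n} : ν + Real.cos θ • eVec n ∈ cap n θ ↔
    ‖ν‖ = 1 ∧ Real.cos θ ≤ ν (Fin.last n) := by
  rw [mem_cap_iff, add_sub_cancel_right]

namespace IsStrictlyConvexCapillary

variable {n : ℕ} [NeZero n] {M : Type*} [TopologicalSpace M] [CompactSpace M] [ConnectedSpace M]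
  [ChartedSpace (EuclideanHalfSpace n) M] {θ : ℝ} {F N : M → Amb n}

theorem isInteriorPoint_of_pos (hc : IsStrictlyConvexCapillary θ F N) {x : M}
    (hx : 0 < F x (Fin.last n)) : (𝓡∂ n).IsInteriorPoint x :=
  (ModelWithCorners.isInteriorPoint_or_isBoundaryPoint x).resolve_right
    fun h => hx.ne' ((hc.boundary_iff x).mpr h)

theorem normal_last_of_last_eq_zero (hc : IsStrictlyConvexCapillary θ F N) {x : M}
    (hx : F x (Fin.last n) = 0) : N x (Fin.last n) = Real.cos θ := by
  have := hc.contact_angle x ((hc.boundary_iff x).mp hx)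
  rw [inner_eVec] at this
  linarith

theorem injective_tangentMapAt_normal (hc : IsStrictlyConvexCapillary θ F N) (x : M) :
    Function.Injective (tangentMapAt N x) := by
  refine (injective_iff_map_eq_zero _).mpr fun v hv => ?_
  by_contra h
  have := hc.curvature_pos x v h
  rw [hv, inner_zero_left] at this
  exact lt_irrefl _ this

/-- At an interior critical point of the height of `N`, the vertical vector is orthogonal to the
image of `dN`, which is the orthogonal complement of `N`; so `N` is vertical. If it pointed down,
the whole body would lie at least as high as `F x`, which is impossible because the boundary lies at
height zero. -/
theorem normal_last_eq_one_of_min (hc : IsStrictlyConvexCapillary θ F N)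
    (hM : ((𝓡∂ n).boundary M).Nonempty) {x : M} (hx : 0 < F x (Fin.last n))
    (hmin : ∀ y, N x (Fin.last n) ≤ N y (Fin.last n)) : N x (Fin.last n) = 1 := by
  have h1 : ∀ v, inner ℝ (-eVec n) (tangentMapAt N x v) = 0 :=
    inner_tangentMapAt_eq_zero_of_isLocalMin (hc.mdifferentiableAt_normal x)
      (hc.isInteriorPoint_of_pos hx) _ fun y => by
        rw [inner_neg_left, inner_neg_left, real_inner_comm, inner_eVec, real_inner_comm,
          inner_eVec]
        simpa using hmin y
  obtain ⟨a, ha⟩ := exists_smul_of_inner_eq_zero (hc.injective_tangentMapAt_normal x)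
    (hc.normal_ne_zero x) (hc.inner_normal_tangentMapAt_normal x) h1
  have h2 : N x (Fin.last n) = a := by
    have : inner ℝ (N x) (-eVec n) = a := by
      rw [ha, inner_smul_right, real_inner_self_eq_norm_sq, hc.normal_unit]; ring
    rwa [inner_neg_right, inner_eVec, neg_neg] at this
  have h3 : a ^ 2 = 1 := by
    have := congrArg (fun y => ‖y‖ ^ 2) ha
    simp only [norm_neg, norm_eVec, norm_smul, hc.normal_unit, Real.norm_eq_abs, mul_one,
      sq_abs] at this
    linarith
  rcases sq_eq_one_iff.mp h3 with h | h
  · rw [h2, h]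
  · obtain ⟨y, hy⟩ := hM
    have hy0 := (hc.boundary_iff y).mpr hy
    have h4 := hc.normal_outward x _ (hc.mem_body y)
    have h5 : N x = eVec n := by rw [← neg_inj, ha, h]; simp
    rw [h5, real_inner_comm, inner_eVec, PiLp.sub_apply, hy0] at h4
    linarith

/-- The minimum of the height of `N` over the compact `M` is either on the boundary, where the
contact angle makes it `cos θ`, or in the interior, where it is `1`. The normals therefore lie in
the translated cap. -/
theorem cos_le_normal_last (hc : IsStrictlyConvexCapillary θ F N)
    (hM : ((𝓡∂ n).boundary M).Nonempty) (x : M) : Real.cos θ ≤ N x (Fin.last n) := by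
  have hcont : Continuous fun x => N x (Fin.last n) := by
    have := hc.continuous_normal
    fun_prop
  obtain ⟨x₁, -, hx₁⟩ := isCompact_univ.exists_isMinOn ⟨x, trivial⟩ hcont.continuousOn
  refine le_trans ?_ (hx₁ trivial)
  rcases (mem_halfSpace_iff.mp (hc.mem_halfSpace x₁)).eq_or_lt with h | h
  · exact (hc.normal_last_of_last_eq_zero h.symm).ge
  · exact (Real.cos_le_one θ).trans
      (hc.normal_last_eq_one_of_min hM h fun y => hx₁ trivial).ge

theorem cos_lt_normal_last (hc : IsStrictlyConvexCapillary θ F N)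
    (hθ : θ ∈ Set.Ioo 0 (Real.pi / 2)) (hM : ((𝓡∂ n).boundary M).Nonempty) {x : M}
    (hx : 0 < F x (Fin.last n)) : Real.cos θ < N x (Fin.last n) := by
  refine (hc.cos_le_normal_last hM x).lt_of_ne fun h => ?_
  have := hc.normal_last_eq_one_of_min hM hx fun y => h ▸ hc.cos_le_normal_last hM y
  exact (cos_lt_one_of_mem hθ).ne (h.trans this)

/-- A point of the body where an upward direction is maximal lies on the hypersurface. -/
theorem mem_range_of_isMax (hc : IsStrictlyConvexCapillary θ F N) {ν p : Amb n}
    (hν : 0 < ν (Fin.last n)) (hp : p ∈ body (Set.range F))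
    (hmax : ∀ Y ∈ body (Set.range F), inner ℝ ν Y ≤ inner ℝ ν p) : p ∈ Set.range F := by
  by_contra hpS
  obtain ⟨r, hr, hsub⟩ := ball_inter_halfSpace_subset_body hc.isCompact_range.isClosed
    hc.range_subset hpS hp
  have hpH := mem_halfSpace_iff.mp (body_subset_halfSpace hc.range_subset hp)
  have h1 : p - (r / 2) • eVec n ∈ body (Set.range F) := by
    refine hsub ⟨?_, ?_⟩
    · rw [mem_ball_iff_norm, sub_sub_cancel_left, norm_neg, norm_smul, norm_eVec,
        Real.norm_of_nonneg (by positivity)]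
      linarith
    · rw [mem_halfSpace_iff]
      simp only [PiLp.sub_apply, PiLp.smul_apply, eVec_last, smul_eq_mul]
      linarith
  have h2 := hmax _ h1
  rw [inner_sub_right, inner_smul_right, inner_eVec] at h2
  nlinarith

theorem exists_isMax (hc : IsStrictlyConvexCapillary θ F N) {ν : Amb n}
    (hν : 0 < ν (Fin.last n)) :
    ∃ x, ∀ Y ∈ body (Set.range F), inner ℝ ν Y ≤ inner ℝ ν (F x) := by
  obtain ⟨x₀⟩ : Nonempty M := inferInstance
  obtain ⟨p, hp, hmax⟩ := hc.isCompact_body.exists_isMaxOn ⟨_, hc.mem_body x₀⟩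
    (f := fun Y => inner ℝ ν Y) (by fun_prop)
  obtain ⟨x, rfl⟩ := hc.mem_range_of_isMax hν hp hmax
  exact ⟨x, hmax⟩

/-- Moving from `F x` in the tangential direction `m = ν - ⟨ν, N x⟩ N x`, tilted slightly inwards,
stays in the body, so maximality gives `1 - ⟨ν, N x⟩² = ⟨ν, m⟩ ≤ 0`. At a boundary point the contact
angle matters: the height of `m` is `ν_last - a cos θ ≥ 0`, which keeps the motion in the
half-space. The case `N x = -ν` is excluded since both vectors point up. -/
theorem normal_eq_of_isMax (hc : IsStrictlyConvexCapillary θ F N)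
    (hθ : θ ∈ Set.Ioo 0 (Real.pi / 2)) (hM : ((𝓡∂ n).boundary M).Nonempty) {ν : Amb n}
    (hν1 : ‖ν‖ = 1) (hν : Real.cos θ ≤ ν (Fin.last n)) {x : M}
    (hmax : ∀ Y ∈ body (Set.range F), inner ℝ ν Y ≤ inner ℝ ν (F x)) : N x = ν := by
  obtain ⟨p, hp⟩ := hc.interior_body_nonempty
  have hpN := hc.inner_neg_of_mem_interior hp x
  set d := p - F x
  set a : ℝ := inner ℝ ν (N x)
  set m := ν - a • N x
  have ha1 : a ≤ 1 := by
    have := real_inner_le_norm ν (N x)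
    rwa [hν1, hc.normal_unit, one_mul] at this
  have hNm : inner ℝ (N x) m = 0 := by
    simp only [m]
    rw [inner_sub_right, inner_smul_right, real_inner_self_eq_norm_sq, hc.normal_unit,
      real_inner_comm]
    simp [a]
  have hdir : ∀ δ : ℝ, 0 < δ → inner ℝ ν (m + δ • d) ≤ 0 := by
    intro δ hδ
    have hneg : inner ℝ (N x) (m + δ • d) < 0 := by
      rw [inner_add_right, hNm, inner_smul_right]
      nlinarith
    have hH : ∀ᶠ ε : ℝ in 𝓝[>] 0, F x + ε • (m + δ • d) ∈ halfSpace n := by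
      rcases (mem_halfSpace_iff.mp (hc.mem_halfSpace x)).eq_or_lt with h | h
      · filter_upwards [self_mem_nhdsWithin] with ε hε
        have hε0 : 0 < ε := hε
        have hp0 := mem_halfSpace_iff.mp (body_subset_halfSpace hc.range_subset
          (interior_subset hp))
        have hNl := hc.normal_last_of_last_eq_zero h.symm
        rw [mem_halfSpace_iff]
        simp only [m, d, PiLp.add_apply, PiLp.sub_apply, PiLp.smul_apply, smul_eq_mul, ← h, hNl]
        have : a * Real.cos θ ≤ 1 * Real.cos θ :=
          mul_le_mul_of_nonneg_right ha1 (cos_pos_of_mem hθ).le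
        have : 0 ≤ ν (Fin.last n) - a * Real.cos θ + δ * (p (Fin.last n) - 0) := by
          have : 0 ≤ δ * (p (Fin.last n) - 0) := by rw [sub_zero]; positivity
          linarith
        positivity
      · have hcont : Tendsto (fun ε : ℝ => (F x + ε • (m + δ • d)) (Fin.last n)) (𝓝[>] 0)
            (𝓝 (F x (Fin.last n))) := by
          have h : Continuous fun ε : ℝ => (F x + ε • (m + δ • d)) (Fin.last n) := by fun_prop
          have h' := h.tendsto 0
          simp only [zero_smul, add_zero] at h'
          exact h'.mono_left nhdsWithin_le_nhds
        filter_upwards [hcont.eventually (lt_mem_nhds h)] with ε hε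
        exact mem_halfSpace_iff.mpr hε.le
    obtain ⟨ε, hε, hε0⟩ := ((hc.eventually_mem_body x hneg hH).and self_mem_nhdsWithin).exists
    have h1 := hmax _ hε.1
    rw [inner_add_right, inner_smul_right] at h1
    have hε0 : 0 < ε := hε0
    by_contra hcon
    push Not at hcon
    nlinarith [mul_pos hε0 hcon]
  have hm0 : inner ℝ ν m ≤ 0 := by
    have hcont : Tendsto (fun δ : ℝ => inner ℝ ν (m + δ • d)) (𝓝[>] 0) (𝓝 (inner ℝ ν m)) := by
      have h : Continuous fun δ : ℝ => inner ℝ ν (m + δ • d) := by fun_prop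
      have h' := h.tendsto 0
      simp only [zero_smul, add_zero] at h'
      exact h'.mono_left nhdsWithin_le_nhds
    refine le_of_tendsto hcont ?_
    filter_upwards [self_mem_nhdsWithin] with δ hδ using hdir δ hδ
  have hnorm : inner ℝ ν m = 1 - a ^ 2 := by
    simp only [m]
    rw [inner_sub_right, inner_smul_right, real_inner_self_eq_norm_sq, hν1]
    simp only [a]; ring
  have ha : a = 1 := by
    by_contra hne
    have ha2 : a ≤ -1 := by
      by_contra h
      push Not at h
      nlinarith [lt_of_le_of_ne ha1 hne]
    have h2 : ‖ν + N x‖ ^ 2 ≤ 0 := by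
      rw [norm_add_sq_real, hν1, hc.normal_unit]
      change 1 ^ 2 + 2 * a + 1 ^ 2 ≤ 0
      linarith
    have h3 : ν + N x = 0 := by
      rw [← norm_eq_zero]
      exact pow_eq_zero_iff two_ne_zero |>.mp (le_antisymm h2 (by positivity))
    have h4 := congrArg (fun y : Amb n => y (Fin.last n)) h3
    simp only [PiLp.add_apply, PiLp.zero_apply] at h4
    linarith [hc.cos_le_normal_last hM x, cos_pos_of_mem hθ]
  exact ((inner_eq_one_iff_of_norm_eq_one hν1 (hc.normal_unit x)).mp ha).symm

/-- If two points share a normal, the segment joining their images lies in the common supporting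
hyperplane. Its points are maximal, hence on the hypersurface with the same normal, and those close
to `F x₁` contradict the local strict monotonicity of the normal. -/
theorem injective_normal (hc : IsStrictlyConvexCapillary θ F N)
    (hθ : θ ∈ Set.Ioo 0 (Real.pi / 2)) (hM : ((𝓡∂ n).boundary M).Nonempty) :
    Function.Injective N := by
  intro x₁ x₂ hN
  by_contra hne
  have := hc.t2Space
  have hemb := (hc.continuous.isClosedEmbedding hc.injective).isEmbedding
  have hcos := cos_pos_of_mem hθ
  set ν := N x₁
  have hν : Real.cos θ ≤ ν (Fin.last n) := hc.cos_le_normal_last hM x₁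
  have hmax1 : ∀ Y ∈ body (Set.range F), inner ℝ ν Y ≤ inner ℝ ν (F x₁) := fun Y hY => by
    have := hc.normal_outward x₁ Y hY
    rw [inner_sub_right] at this
    linarith
  have hmax2 : ∀ Y ∈ body (Set.range F), inner ℝ ν Y ≤ inner ℝ ν (F x₂) := fun Y hY => by
    have := hc.normal_outward x₂ Y hY
    rw [← hN, inner_sub_right] at this
    linarith
  have heq : inner ℝ ν (F x₂ - F x₁) = 0 := by
    rw [inner_sub_right]
    linarith [hmax1 _ (hc.mem_body x₂), hmax2 _ (hc.mem_body x₁)]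
  have hev := hc.eventually_inner_sub_pos x₁
  rw [hemb.isInducing.nhds_eq_comap, eventually_comap] at hev
  have htend : Tendsto (fun s : ℝ => F x₁ + s • (F x₂ - F x₁)) (𝓝[>] 0) (𝓝 (F x₁)) := by
    have h : Continuous fun s : ℝ => F x₁ + s • (F x₂ - F x₁) := by fun_prop
    have h' := h.tendsto 0
    simp only [zero_smul, add_zero] at h'
    exact h'.mono_left nhdsWithin_le_nhds
  have hev1 : ∀ᶠ ε : ℝ in 𝓝[>] 0, ε < 1 := nhdsWithin_le_nhds (gt_mem_nhds one_pos)
  obtain ⟨s, ⟨hs, hs1⟩, hs0⟩ :=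
    (((htend.eventually hev).and hev1).and self_mem_nhdsWithin).exists
  have hs0 : 0 < s := hs0
  have hmem : F x₁ + s • (F x₂ - F x₁) ∈ body (Set.range F) :=
    hc.convex_body.add_smul_sub_mem (hc.mem_body x₁) (hc.mem_body x₂) ⟨hs0.le, hs1.le⟩
  have hval : inner ℝ ν (F x₁ + s • (F x₂ - F x₁)) = inner ℝ ν (F x₁) := by
    rw [inner_add_right, inner_smul_right, heq, mul_zero, add_zero]
  obtain ⟨x, hx⟩ := hc.mem_range_of_isMax (hcos.trans_le hν) hmem (by rwa [hval])
  have hNx : N x = ν := hc.normal_eq_of_isMax hθ hM (hc.normal_unit x₁) hν (by rwa [hx, hval])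
  have hxne : x ≠ x₁ := by
    rintro rfl
    have h0 : s • (F x₂ - F x) = 0 := by simpa using hx.symm
    rcases smul_eq_zero.mp h0 with h | h
    · exact hs0.ne' h
    · exact hne (hc.injective (sub_eq_zero.mp h)).symm
  have := hs x hx hxne
  rw [hNx, sub_self, inner_zero_left] at this
  exact lt_irrefl _ this

theorem exists_normal_eq (hc : IsStrictlyConvexCapillary θ F N)
    (hθ : θ ∈ Set.Ioo 0 (Real.pi / 2)) (hM : ((𝓡∂ n).boundary M).Nonempty) {ν : Amb n}
    (hν1 : ‖ν‖ = 1) (hν : Real.cos θ ≤ ν (Fin.last n)) : ∃ x, N x = ν := by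
  obtain ⟨x, hx⟩ := hc.exists_isMax ((cos_pos_of_mem hθ).trans_le hν)
  exact ⟨x, hc.normal_eq_of_isMax hθ hM hν1 hν hx⟩

theorem capGaussMap_mem (hc : IsStrictlyConvexCapillary θ F N)
    (hM : ((𝓡∂ n).boundary M).Nonempty) (x : M) : capGaussMap θ N x ∈ cap n θ :=
  add_mem_cap_iff.mpr ⟨hc.normal_unit x, hc.cos_le_normal_last hM x⟩

theorem injective_capGaussMap (hc : IsStrictlyConvexCapillary θ F N)
    (hθ : θ ∈ Set.Ioo 0 (Real.pi / 2)) (hM : ((𝓡∂ n).boundary M).Nonempty) :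
    Function.Injective (capGaussMap θ N) := fun _ _ h =>
  hc.injective_normal hθ hM (add_right_cancel h)

theorem capGaussMap_invFun (hc : IsStrictlyConvexCapillary θ F N)
    (hθ : θ ∈ Set.Ioo 0 (Real.pi / 2)) (hM : ((𝓡∂ n).boundary M).Nonempty) {ξ : Amb n}
    (hξ : ξ ∈ cap n θ) : capGaussMap θ N (Function.invFun (capGaussMap θ N) ξ) = ξ := by
  apply Function.invFun_eq
  obtain ⟨x, hx⟩ := hc.exists_normal_eq hθ hM (mem_cap_iff.mp hξ).1 (mem_cap_iff.mp hξ).2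
  exact ⟨x, by rw [capGaussMap, hx, sub_add_cancel]⟩

theorem invFun_capGaussMap (hc : IsStrictlyConvexCapillary θ F N)
    (hθ : θ ∈ Set.Ioo 0 (Real.pi / 2)) (hM : ((𝓡∂ n).boundary M).Nonempty) (x : M) :
    Function.invFun (capGaussMap θ N) (capGaussMap θ N x) = x :=
  Function.leftInverse_invFun (hc.injective_capGaussMap hθ hM) x

/-- The outward normal supports the body only at its own base point. -/
theorem inner_neg_of_ne (hc : IsStrictlyConvexCapillary θ F N)
    (hθ : θ ∈ Set.Ioo 0 (Real.pi / 2)) (hM : ((𝓡∂ n).boundary M).Nonempty) {x : M} {p : Amb n}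
    (hp : p ∈ body (Set.range F)) (hne : p ≠ F x) : inner ℝ (N x) (p - F x) < 0 := by
  refine (hc.normal_outward x p hp).lt_of_ne fun h => hne ?_
  rw [inner_sub_right, sub_eq_zero] at h
  have hmax : ∀ Y ∈ body (Set.range F), inner ℝ (N x) Y ≤ inner ℝ (N x) p := fun Y hY => by
    have := hc.normal_outward x Y hY
    rw [inner_sub_right] at this
    linarith
  have hlast := hc.cos_le_normal_last hM x
  obtain ⟨y, rfl⟩ := hc.mem_range_of_isMax ((cos_pos_of_mem hθ).trans_le hlast) hp hmax
  have := hc.normal_eq_of_isMax hθ hM (hc.normal_unit x) hlast hmax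
  rw [hc.injective_normal hθ hM this]

end IsStrictlyConvexCapillary

end CapillaryFlow

end

/-! ### Support functions on the cap and the flat part of the body. -/

noncomputable section
set_option linter.unusedSectionVars false
namespace CapillaryFlow

open Filter Topology Asymptotics

/-- The outward unit vector `ν = ξ - cos θ e` of the sphere containing the cap. -/
abbrev capNormal (n : ℕ) (θ : ℝ) (ξ : Amb n) : Amb n := ξ - Real.cos θ • eVec n

theorem capNormal_capGaussMap {n : ℕ} {M : Type*} (θ : ℝ) (N : M → Amb n) (x : M) :
    capNormal n θ (capGaussMap θ N x) = N x := add_sub_cancel_right _ _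

theorem isCompact_cap (n : ℕ) (θ : ℝ) : IsCompact (cap n θ) := by
  have h : cap n θ = Metric.sphere (Real.cos θ • eVec n) 1 ∩ halfSpace n := by
    ext ξ
    rw [Set.mem_inter_iff, mem_sphere_iff_norm, and_comm]
    rfl
  rw [h]
  exact (isCompact_sphere _ _).inter_right (isClosed_halfSpace n)

theorem norm_capNormal {n : ℕ} {θ : ℝ} {ξ : Amb n} (h : ξ ∈ cap n θ) : ‖capNormal n θ ξ‖ = 1 :=
  (mem_cap_iff.mp h).1

theorem ell_eq {n : ℕ} {θ : ℝ} (ξ : Amb n) :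
    ell n θ ξ = 1 - Real.cos θ * capNormal n θ ξ (Fin.last n) := by
  rw [ell, inner_eVec, capNormal]
  simp only [PiLp.sub_apply, PiLp.smul_apply, eVec_last, smul_eq_mul]
  nlinarith [Real.sin_sq_add_cos_sq θ]

theorem ell_add {n : ℕ} {θ : ℝ} (ν : Amb n) :
    ell n θ (ν + Real.cos θ • eVec n) = 1 - Real.cos θ * ν (Fin.last n) := by
  rw [ell_eq, capNormal, add_sub_cancel_right]

theorem ell_pos {n : ℕ} {θ : ℝ} (hθ : θ ∈ Set.Ioo 0 (Real.pi / 2)) {ξ : Amb n}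
    (h : ξ ∈ cap n θ) : 0 < ell n θ ξ := by
  rw [ell_eq]
  have h1 := abs_last_le_norm (capNormal n θ ξ)
  rw [norm_capNormal h] at h1
  nlinarith [le_abs_self (capNormal n θ ξ (Fin.last n)), cos_pos_of_mem hθ, cos_lt_one_of_mem hθ]

theorem continuous_ell (n : ℕ) (θ : ℝ) : Continuous (ell n θ) := by
  unfold ell
  fun_prop

theorem inner_capNormal_incl {n : ℕ} {θ : ℝ} (ξ : Amb n) (z : EuclideanSpace ℝ (Fin n)) :
    inner ℝ (capNormal n θ ξ) (incl z) = inner ℝ ξ (incl z) := by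
  rw [capNormal, inner_sub_left, inner_smul_left, real_inner_comm (incl z) (eVec n), inner_eVec,
    incl_last]
  simp

/-- This is how `ℓ` enters the evolution: the velocity `K (ν + cos θ e)` has normal component `K ℓ`.
-/
theorem inner_capNormal_self {n : ℕ} {θ : ℝ} {ξ : Amb n} (h : ξ ∈ cap n θ) :
    inner ℝ (capNormal n θ ξ) ξ = ell n θ ξ := by
  have e : ξ = capNormal n θ ξ + Real.cos θ • eVec n := (sub_add_cancel _ _).symm
  conv_lhs => rw [e]
  rw [inner_add_right, inner_smul_right, inner_eVec, capNormal, add_sub_cancel_right,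
    real_inner_self_eq_norm_sq, norm_capNormal h, ell_eq]
  ring

namespace IsStrictlyConvexCapillary

variable {n : ℕ} [NeZero n] {M : Type*} [TopologicalSpace M] [CompactSpace M] [ConnectedSpace M]
  [ChartedSpace (EuclideanHalfSpace n) M] {θ : ℝ} {F N : M → Amb n}

theorem supportFn_eq_of_normal (hc : IsStrictlyConvexCapillary θ F N) (z : Amb n) (x : M)
    {ξ : Amb n} (hx : N x = capNormal n θ ξ) :
    supportFn θ (Set.range F) z ξ = inner ℝ (capNormal n θ ξ) (F x - z) := by
  refine IsGreatest.csSup_eq ⟨⟨F x, ⟨x, rfl⟩, rfl⟩, ?_⟩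
  rintro _ ⟨_, ⟨y, rfl⟩, rfl⟩
  have := hc.normal_outward x _ (hc.mem_body y)
  rw [hx, inner_sub_right] at this
  simp only [inner_sub_right (capNormal n θ ξ)]
  linarith

theorem normal_invFun (hc : IsStrictlyConvexCapillary θ F N)
    (hθ : θ ∈ Set.Ioo 0 (Real.pi / 2)) (hM : ((𝓡∂ n).boundary M).Nonempty) {ξ : Amb n}
    (hξ : ξ ∈ cap n θ) : N (Function.invFun (capGaussMap θ N) ξ) = capNormal n θ ξ := by
  rw [← capNormal_capGaussMap θ N, hc.capGaussMap_invFun hθ hM hξ]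

theorem supportFn_eq (hc : IsStrictlyConvexCapillary θ F N)
    (hθ : θ ∈ Set.Ioo 0 (Real.pi / 2)) (hM : ((𝓡∂ n).boundary M).Nonempty) (z : Amb n) {ξ : Amb n}
    (hξ : ξ ∈ cap n θ) : supportFn θ (Set.range F) z ξ =
      inner ℝ (capNormal n θ ξ) (F (Function.invFun (capGaussMap θ N) ξ) - z) :=
  hc.supportFn_eq_of_normal z _ (hc.normal_invFun hθ hM hξ)

theorem supportFn_sub (hc : IsStrictlyConvexCapillary θ F N)
    (hθ : θ ∈ Set.Ioo 0 (Real.pi / 2)) (hM : ((𝓡∂ n).boundary M).Nonempty) (z : Amb n) {ξ : Amb n}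
    (hξ : ξ ∈ cap n θ) : supportFn θ (Set.range F) z ξ =
      supportFn θ (Set.range F) 0 ξ - inner ℝ (capNormal n θ ξ) z := by
  rw [hc.supportFn_eq hθ hM z hξ, hc.supportFn_eq hθ hM 0 hξ, sub_zero, inner_sub_right]

theorem inner_le_supportFn (hc : IsStrictlyConvexCapillary θ F N)
    (hθ : θ ∈ Set.Ioo 0 (Real.pi / 2)) (hM : ((𝓡∂ n).boundary M).Nonempty) (z : Amb n) {ξ : Amb n}
    (hξ : ξ ∈ cap n θ) (x : M) :
    inner ℝ (capNormal n θ ξ) (F x - z) ≤ supportFn θ (Set.range F) z ξ := by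
  rw [hc.supportFn_eq hθ hM z hξ, ← hc.normal_invFun hθ hM hξ]
  have := hc.normal_outward (Function.invFun (capGaussMap θ N) ξ) _ (hc.mem_body x)
  rw [inner_sub_right] at this ⊢
  rw [inner_sub_right]
  linarith

theorem convex_flatPart (hc : IsStrictlyConvexCapillary θ F N) :
    Convex ℝ (flatPart (body (Set.range F))) :=
  hc.convex_body.linear_preimage (inclₗ n).toLinearMap

theorem isCompact_flatPart (hc : IsStrictlyConvexCapillary θ F N) :
    IsCompact (flatPart (body (Set.range F))) :=
  (inclₗ n).isometry.isClosedEmbedding.isCompact_preimage hc.isCompact_body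

/-- If equality held at some `x`, then `incl z = F x`, and a small step along the horizontal part of
`N x` would remain in the flat part while leaving the supporting half-space, because that horizontal
part has inner product `sin² θ > 0` with `N x`. Conversely, by compactness of `M`, strict
inequalities persist for nearby `z`. -/
theorem mem_interior_flatPart_iff (hc : IsStrictlyConvexCapillary θ F N)
    (hθ : θ ∈ Set.Ioo 0 (Real.pi / 2)) (hM : ((𝓡∂ n).boundary M).Nonempty)
    {z : EuclideanSpace ℝ (Fin n)} : z ∈ interior (flatPart (body (Set.range F))) ↔
      ∀ x, inner ℝ (N x) (incl z - F x) < 0 := by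
  constructor
  · intro hz x
    have hzB : incl z ∈ body (Set.range F) := interior_subset (s := flatPart _) hz
    refine hc.inner_neg_of_ne hθ hM hzB fun heq => ?_
    have hlast : F x (Fin.last n) = 0 := by rw [← heq, incl_last]
    have hNl := hc.normal_last_of_last_eq_zero hlast
    have htend : Tendsto (fun ε : ℝ => z + ε • proj (N x)) (𝓝[>] 0) (𝓝 z) := by
      have h : Continuous fun ε : ℝ => z + ε • proj (N x) := by fun_prop
      have h' := h.tendsto 0
      simp only [zero_smul, add_zero] at h'
      exact h'.mono_left nhdsWithin_le_nhds
    obtain ⟨ε, hε, hε0⟩ := ((htend.eventually (mem_interior_iff_mem_nhds.mp hz)).and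
      self_mem_nhdsWithin).exists
    have hε0 : 0 < ε := hε0
    have h1 := hc.normal_outward x _ (show incl (z + ε • proj (N x)) ∈ body (Set.range F) from hε)
    rw [incl_add, heq, add_sub_cancel_left, incl_smul, incl_proj, inner_smul_right,
      inner_add_right, inner_smul_right, inner_eVec, real_inner_self_eq_norm_sq,
      hc.normal_unit, hNl] at h1
    have : 0 < 1 ^ 2 + Real.cos θ * -Real.cos θ := by
      nlinarith [cos_lt_one_of_mem hθ, cos_pos_of_mem hθ]
    nlinarith
  · intro h
    have hev : ∀ᶠ z' in 𝓝 z, ∀ x ∈ (Set.univ : Set M), inner ℝ (N x) (incl z' - F x) < 0 := by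
      refine isCompact_univ.eventually_forall_of_forall_eventually fun x _ => ?_
      have hcont : Continuous fun q : EuclideanSpace ℝ (Fin n) × M =>
          inner ℝ (N q.2) (incl q.1 - F q.2) := by
        have h1 := hc.continuous_normal
        have h2 := hc.continuous
        have h3 := continuous_incl (n := n)
        fun_prop
      exact (hcont.tendsto (z, x)).eventually_lt_const (h x)
    rw [mem_interior_iff_mem_nhds]
    filter_upwards [hev] with z' hz'
    exact (hc.mem_body_iff (incl_mem_halfSpace z')).mpr fun x => (hz' x trivial).le

/-- Admissible base points are exactly those whose support function is positive on the cap, so all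
logarithms below are of positive numbers. -/
theorem mem_interior_flatPart_iff_supportFn_pos (hc : IsStrictlyConvexCapillary θ F N)
    (hθ : θ ∈ Set.Ioo 0 (Real.pi / 2)) (hM : ((𝓡∂ n).boundary M).Nonempty)
    {z : EuclideanSpace ℝ (Fin n)} : z ∈ interior (flatPart (body (Set.range F))) ↔
      ∀ ξ ∈ cap n θ, 0 < supportFn θ (Set.range F) (incl z) ξ := by
  rw [hc.mem_interior_flatPart_iff hθ hM]
  constructor
  · intro h ξ hξ
    rw [hc.supportFn_eq hθ hM _ hξ, ← hc.normal_invFun hθ hM hξ, ← neg_sub, inner_neg_right]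
    linarith [h (Function.invFun (capGaussMap θ N) ξ)]
  · intro h x
    have h1 := h _ (hc.capGaussMap_mem hM x)
    rw [hc.supportFn_eq_of_normal _ x (capNormal_capGaussMap θ N x).symm,
      capNormal_capGaussMap, ← neg_sub, inner_neg_right] at h1
    linarith

/-- A point of the flat part that is not interior lies on the hypersurface. -/
theorem exists_eq_incl_of_notMem_interior (hc : IsStrictlyConvexCapillary θ F N)
    (hθ : θ ∈ Set.Ioo 0 (Real.pi / 2)) (hM : ((𝓡∂ n).boundary M).Nonempty)
    {z : EuclideanSpace ℝ (Fin n)} (hz : z ∈ flatPart (body (Set.range F)))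
    (hz' : z ∉ interior (flatPart (body (Set.range F)))) : ∃ x, F x = incl z := by
  by_contra h
  push Not at h
  exact hz' ((hc.mem_interior_flatPart_iff hθ hM).mpr fun x =>
    hc.inner_neg_of_ne hθ hM hz (h x).symm)

theorem norm_proj_normal_sq (hc : IsStrictlyConvexCapillary θ F N) {x : M}
    (hx : F x (Fin.last n) = 0) : ‖proj (N x)‖ ^ 2 = Real.sin θ ^ 2 := by
  rw [← norm_incl, incl_proj, norm_add_sq_real, inner_smul_right, inner_eVec, norm_smul,
    norm_eVec, hc.normal_unit, hc.normal_last_of_last_eq_zero hx, Real.norm_eq_abs, mul_one, sq_abs]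
  nlinarith [Real.sin_sq_add_cos_sq θ]

/-- The inner conormal `-proj (N x)` has inner product `-sin² θ` with `N x`, so a short step along
it enters the body off the hypersurface. -/
theorem eventually_mem_interior_flatPart (hc : IsStrictlyConvexCapillary θ F N)
    (hθ : θ ∈ Set.Ioo 0 (Real.pi / 2)) (hM : ((𝓡∂ n).boundary M).Nonempty)
    {z : EuclideanSpace ℝ (Fin n)} {x : M} (hx : F x = incl z) :
    ∀ᶠ δ : ℝ in 𝓝[>] 0, z + δ • -proj (N x) ∈ interior (flatPart (body (Set.range F))) := by
  have hlast : F x (Fin.last n) = 0 := by rw [hx, incl_last]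
  have hneg : inner ℝ (N x) (incl (-proj (N x))) < 0 := by
    have h1 : inner ℝ (N x) (incl (proj (N x))) = Real.sin θ ^ 2 := by
      rw [incl_proj, inner_add_right, inner_smul_right, inner_eVec, real_inner_self_eq_norm_sq,
        hc.normal_unit, hc.normal_last_of_last_eq_zero hlast]
      nlinarith [Real.sin_sq_add_cos_sq θ]
    have h2 : incl (-proj (N x)) = -incl (proj (N x)) := (inclₗ n).map_neg _
    rw [h2, inner_neg_right, h1]
    have := sin_pos_of_mem hθ
    have : 0 < Real.sin θ ^ 2 := by positivity
    linarith
  have hH : ∀ᶠ ε : ℝ in 𝓝[>] 0, F x + ε • incl (-proj (N x)) ∈ halfSpace n :=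
    Eventually.of_forall fun ε => by
      rw [hx, ← incl_smul, ← incl_add]
      exact incl_mem_halfSpace _
  filter_upwards [hc.eventually_mem_body x hneg hH] with δ hδ
  rw [hx, ← incl_smul, ← incl_add] at hδ
  exact (hc.mem_interior_flatPart_iff hθ hM).mpr fun y =>
    hc.inner_neg_of_ne hθ hM hδ.1 fun h => hδ.2 ⟨y, h.symm⟩

theorem interior_flatPart_nonempty (hc : IsStrictlyConvexCapillary θ F N)
    (hθ : θ ∈ Set.Ioo 0 (Real.pi / 2)) (hM : ((𝓡∂ n).boundary M).Nonempty) :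
    (interior (flatPart (body (Set.range F)))).Nonempty := by
  obtain ⟨x, hx⟩ := hM
  have hx0 := (hc.boundary_iff x).mpr hx
  obtain ⟨δ, hδ⟩ := (hc.eventually_mem_interior_flatPart hθ ⟨x, hx⟩
    (incl_proj_of_last_eq_zero hx0).symm).exists
  exact ⟨_, hδ⟩

end IsStrictlyConvexCapillary

end CapillaryFlow

end

/-! ### The surface measure of the cap as a cone measure. -/

noncomputable section
set_option linter.unusedSectionVars false
namespace CapillaryFlow

open Filter Topology MeasureTheory

section CapMeasure

open scoped Pointwise

variable {n : ℕ} {θ : ℝ}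

/-- The open sector of the unit ball that is the cone over the interior of the (translated) cap. -/
def sector (n : ℕ) (θ : ℝ) : Set (Amb n) := {y | ‖y‖ < 1 ∧ Real.cos θ * ‖y‖ < y (Fin.last n)}

/-- The radial projection to the sphere that contains the cap. -/
def capPoint (θ : ℝ) (y : Amb n) : Amb n := ‖y‖⁻¹ • y + Real.cos θ • eVec n

theorem mem_sector {y : Amb n} :
    y ∈ sector n θ ↔ ‖y‖ < 1 ∧ Real.cos θ * ‖y‖ < y (Fin.last n) := Iff.rfl

theorem isOpen_sector (n : ℕ) (θ : ℝ) : IsOpen (sector n θ) := by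
  have h1 : IsOpen {y : Amb n | ‖y‖ < 1} := isOpen_lt (by fun_prop) (by fun_prop)
  have h2 : IsOpen {y : Amb n | Real.cos θ * ‖y‖ < y (Fin.last n)} :=
    isOpen_lt (by fun_prop) (by fun_prop)
  exact h1.inter h2

theorem ne_zero_of_mem_sector {y : Amb n} (hy : y ∈ sector n θ) : y ≠ 0 := by
  rintro rfl
  simpa using (mem_sector.mp hy).2

theorem norm_pos_of_mem_sector {y : Amb n} (hy : y ∈ sector n θ) : 0 < ‖y‖ :=
  norm_pos_iff.mpr (ne_zero_of_mem_sector hy)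

theorem capPoint_mem_iff {y : Amb n} (hy : y ≠ 0) :
    capPoint θ y ∈ cap n θ ↔ Real.cos θ * ‖y‖ ≤ y (Fin.last n) := by
  have hn : 0 < ‖y‖ := norm_pos_iff.mpr hy
  rw [capPoint, add_mem_cap_iff, norm_smul, norm_inv, norm_norm, inv_mul_cancel₀ hn.ne',
    PiLp.smul_apply, smul_eq_mul, inv_mul_eq_div, le_div_iff₀ hn]
  simp

theorem capPoint_mem_of_mem_sector {y : Amb n} (hy : y ∈ sector n θ) : capPoint θ y ∈ cap n θ :=
  (capPoint_mem_iff (ne_zero_of_mem_sector hy)).mpr hy.2.le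

theorem capNormal_capPoint (y : Amb n) : capNormal n θ (capPoint θ y) = ‖y‖⁻¹ • y :=
  add_sub_cancel_right _ _

theorem measurable_capPoint : Measurable (capPoint θ : Amb n → Amb n) := by
  unfold capPoint
  fun_prop

theorem continuousAt_capPoint {y : Amb n} (hy : y ≠ 0) : ContinuousAt (capPoint θ) y := by
  unfold capPoint
  have : ‖y‖ ≠ 0 := norm_ne_zero_iff.mpr hy
  fun_prop (disch := assumption)

/-- The lateral surface lies in the frontier of a convex solid cone, and frontiers of convex sets
are null. -/
theorem volume_cone_boundary (hθ : θ ∈ Set.Ioo 0 (Real.pi / 2)) :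
    volume {y : Amb n | y (Fin.last n) = Real.cos θ * ‖y‖} = 0 := by
  set D : Set (Amb n) := {y | Real.cos θ * ‖y‖ ≤ y (Fin.last n)}
  have hcos := cos_pos_of_mem hθ
  have hD : Convex ℝ D := by
    intro x hx y hy a b ha hb _
    simp only [D, Set.mem_ofPred_eq, PiLp.add_apply, PiLp.smul_apply, smul_eq_mul] at *
    have h1 : ‖a • x + b • y‖ ≤ a * ‖x‖ + b * ‖y‖ := by
      refine (norm_add_le _ _).trans ?_
      rw [norm_smul, norm_smul, Real.norm_of_nonneg ha, Real.norm_of_nonneg hb]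
    have h2 := mul_le_mul_of_nonneg_left hx ha
    have h3 := mul_le_mul_of_nonneg_left hy hb
    have h4 := mul_le_mul_of_nonneg_left h1 hcos.le
    linarith
  refine measure_mono_null (fun y hy => ?_) (hD.addHaar_frontier volume)
  have hy' : y (Fin.last n) = Real.cos θ * ‖y‖ := hy
  refine ⟨subset_closure (show Real.cos θ * ‖y‖ ≤ y (Fin.last n) from hy'.ge), fun hint => ?_⟩
  obtain ⟨r, hr, hsub⟩ := Metric.mem_nhds_iff.mp (mem_interior_iff_mem_nhds.mp hint)
  have h1 : y + (r / 2) • eVec n ∈ D := by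
    refine hsub ?_
    rw [mem_ball_iff_norm, add_sub_cancel_left, norm_smul, norm_eVec,
      Real.norm_of_nonneg (by positivity)]
    linarith
  have h2 : Real.cos θ * ‖y + (r / 2) • eVec n‖ ≤ (y + (r / 2) • eVec n) (Fin.last n) := h1
  have h3 : ‖y‖ ≤ ‖y + (r / 2) • eVec n‖ + r / 2 := by
    have := norm_sub_le (y + (r / 2) • eVec n) ((r / 2) • eVec n)
    rwa [add_sub_cancel_right, norm_smul, norm_eVec, Real.norm_of_nonneg (by positivity),
      mul_one] at this
  simp only [PiLp.add_apply, PiLp.smul_apply, eVec_last, smul_eq_mul, hy'] at h2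
  have h4 := cos_lt_one_of_mem hθ
  nlinarith

/-- The spherical measure of a set is `n + 1` times the volume of the cone over it in the unit ball.
For the cap this cone differs from the open `sector` only by the null lateral surface. -/
theorem capMeasure_eq (hθ : θ ∈ Set.Ioo 0 (Real.pi / 2)) :
    capMeasure n θ = ((n + 1 : ℕ) : ENNReal) • (volume.restrict (sector n θ)).map (capPoint θ) := by
  have hτ : Measurable (fun η : Metric.sphere (0 : Amb n) 1 => (η : Amb n) + Real.cos θ • eVec n) :=
    by fun_prop
  have hcap : MeasurableSet (cap n θ) := (isCompact_cap n θ).isClosed.measurableSet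
  ext s hs
  rw [capMeasure, Measure.restrict_apply hs, Measure.map_apply hτ (hs.inter hcap),
    Measure.toSphere_apply' _ (hτ (hs.inter hcap)), Measure.smul_apply,
    Measure.map_apply measurable_capPoint hs, Measure.restrict_apply (measurable_capPoint hs)]
  have hset : Set.Ioo (0 : ℝ) 1 • (Subtype.val '' ((fun η : Metric.sphere (0 : Amb n) 1 =>
      (η : Amb n) + Real.cos θ • eVec n) ⁻¹' (s ∩ cap n θ))) =
      {y : Amb n | y ≠ 0 ∧ ‖y‖ < 1 ∧ capPoint θ y ∈ s ∩ cap n θ} := by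
    ext y
    rw [Set.mem_smul]
    constructor
    · rintro ⟨r, hr, _, ⟨η, hη, rfl⟩, rfl⟩
      have hη1 : ‖(η : Amb n)‖ = 1 := by simp
      have hn : ‖r • (η : Amb n)‖ = r := by
        rw [norm_smul, hη1, Real.norm_of_nonneg hr.1.le, mul_one]
      refine ⟨?_, by rw [hn]; exact hr.2, ?_⟩
      · rw [← norm_pos_iff, hn]; exact hr.1
      · rw [capPoint, hn, smul_smul, inv_mul_cancel₀ hr.1.ne', one_smul]
        exact hη
    · rintro ⟨hy0, hy1, hy⟩
      have hn : 0 < ‖y‖ := norm_pos_iff.mpr hy0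
      refine ⟨‖y‖, ⟨hn, hy1⟩, ‖y‖⁻¹ • y, ⟨⟨‖y‖⁻¹ • y, ?_⟩, hy, rfl⟩, ?_⟩
      · rw [mem_sphere_zero_iff_norm, norm_smul, norm_inv, norm_norm, inv_mul_cancel₀ hn.ne']
      · rw [smul_smul, mul_inv_cancel₀ hn.ne', one_smul]
  rw [hset, smul_eq_mul]
  congr 1
  · simp
  refine measure_congr ?_
  have hnull : ∀ᵐ y : Amb n, y (Fin.last n) ≠ Real.cos θ * ‖y‖ := by
    rw [ae_iff]
    simpa using volume_cone_boundary hθ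
  filter_upwards [hnull] with y hy
  refine propext ⟨fun h => ⟨h.2.2.1, h.2.1, ?_⟩, fun h => ⟨?_, h.2.1, h.1, ?_⟩⟩
  · exact ((capPoint_mem_iff h.1).mp h.2.2.2).lt_of_ne (Ne.symm hy)
  · exact ne_zero_of_mem_sector h.2
  · exact capPoint_mem_of_mem_sector h.2

theorem sector_subset_ball : sector n θ ⊆ Metric.ball 0 1 := fun _ hy =>
  mem_ball_zero_iff.mpr hy.1

theorem volume_sector_lt_top : volume (sector n θ) < ⊤ :=
  (measure_mono sector_subset_ball).trans_lt measure_ball_lt_top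

instance isFiniteMeasure_capMeasure (n : ℕ) (θ : ℝ) : IsFiniteMeasure (capMeasure n θ) := by
  unfold capMeasure
  infer_instance

theorem ae_mem_cap (n : ℕ) (θ : ℝ) : ∀ᵐ ξ ∂capMeasure n θ, ξ ∈ cap n θ :=
  ae_restrict_mem (isCompact_cap n θ).isClosed.measurableSet

theorem capMeasure_restrict (n : ℕ) (θ : ℝ) :
    (capMeasure n θ).restrict (cap n θ) = capMeasure n θ :=
  Measure.restrict_eq_self_of_ae_mem (ae_mem_cap n θ)

theorem integrable_of_continuousOn {g : Amb n → ℝ} (hg : ContinuousOn g (cap n θ)) :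
    Integrable g (capMeasure n θ) := by
  rw [← capMeasure_restrict]
  exact hg.integrableOn_compact (isCompact_cap n θ)

theorem integral_capMeasure (hθ : θ ∈ Set.Ioo 0 (Real.pi / 2)) {g : Amb n → ℝ}
    (hg : ContinuousOn g (cap n θ)) :
    ∫ ξ, g ξ ∂capMeasure n θ = (n + 1) * ∫ y in sector n θ, g (capPoint θ y) := by
  have hm := (integrable_of_continuousOn hg).aestronglyMeasurable
  rw [capMeasure_eq hθ] at hm ⊢
  rw [integral_smul_measure, integral_map measurable_capPoint.aemeasurable]
  · rw [ENNReal.toReal_natCast, smul_eq_mul]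
    push_cast
    rfl
  · exact hm.mono_ac (Measure.absolutelyContinuous_smul (by simp))

theorem integral_congr_cap {f g : Amb n → ℝ} (h : ∀ ξ ∈ cap n θ, f ξ = g ξ) :
    ∫ ξ, f ξ ∂capMeasure n θ = ∫ ξ, g ξ ∂capMeasure n θ :=
  integral_congr_ae ((ae_mem_cap n θ).mono h)

theorem continuousOn_comp_capPoint {g : Amb n → ℝ} (hg : ContinuousOn g (cap n θ)) :
    ContinuousOn (fun y => g (capPoint θ y)) (sector n θ) :=
  hg.comp (fun _ hy => (continuousAt_capPoint (ne_zero_of_mem_sector hy)).continuousWithinAt)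
    fun _ hy => capPoint_mem_of_mem_sector hy

/-- On the open sector, vanishing almost everywhere and continuity give vanishing everywhere. Rim
points of the cap are not covered by the sector, so they are reached as limits. -/
theorem eq_zero_of_integral_eq_zero (hθ : θ ∈ Set.Ioo 0 (Real.pi / 2)) {g : Amb n → ℝ}
    (hg : ContinuousOn g (cap n θ)) (h0 : ∀ ξ ∈ cap n θ, 0 ≤ g ξ)
    (hint : ∫ ξ, g ξ ∂capMeasure n θ = 0) : ∀ ξ ∈ cap n θ, g ξ = 0 := by
  have hae := (integral_eq_zero_iff_of_nonneg_ae ((ae_mem_cap n θ).mono h0)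
    (integrable_of_continuousOn hg)).mp hint
  rw [capMeasure_eq hθ] at hae
  have hae' := ae_of_ae_map measurable_capPoint.aemeasurable
    ((Measure.absolutelyContinuous_smul (c := ((n + 1 : ℕ) : ENNReal)) (by simp)).ae_le hae)
  have hsec : Set.EqOn (fun y => g (capPoint θ y)) (fun _ => 0) (sector n θ) :=
    Measure.eqOn_open_of_ae_eq hae' (isOpen_sector n θ) (continuousOn_comp_capPoint hg)
      continuousOn_const
  intro ξ hξ
  set ν := capNormal n θ ξ
  have hν1 : ‖ν‖ = 1 := norm_capNormal hξ
  have hνl : Real.cos θ ≤ ν (Fin.last n) := (mem_cap_iff.mp hξ).2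
  -- Subtracting `t • eVec n` tilts the normal upwards, into the open sector for small positive `t`;
  -- the factor `1 / 2` keeps the point in the unit ball.
  set y : ℝ → Amb n := fun t => (1 / 2 : ℝ) • (ν - t • eVec n)
  have hy : Continuous y := by fun_prop
  have hysec : ∀ᶠ t in 𝓝[>] (0 : ℝ), y t ∈ sector n θ := by
    filter_upwards [self_mem_nhdsWithin, nhdsWithin_le_nhds (gt_mem_nhds one_pos)] with t ht ht1
    have ht0 : 0 < t := ht
    have hn : ‖ν - t • eVec n‖ ≤ 1 + t := by
      refine (norm_sub_le _ _).trans ?_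
      rw [hν1, norm_smul, norm_eVec, Real.norm_of_nonneg ht0.le, mul_one]
    have hn' : ‖y t‖ ≤ (1 + t) / 2 := by
      rw [norm_smul, Real.norm_of_nonneg (by norm_num)]; linarith
    refine mem_sector.mpr ⟨by linarith, ?_⟩
    have h1 : y t (Fin.last n) = (ν (Fin.last n) + t) / 2 := by
      simp only [y, PiLp.smul_apply, PiLp.sub_apply, eVec_last, smul_eq_mul]; ring
    rw [h1]
    nlinarith [cos_pos_of_mem hθ, cos_lt_one_of_mem hθ]
  have hy0 : y 0 = (1 / 2 : ℝ) • ν := by simp [y]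
  have hy00 : y 0 ≠ 0 := by
    rw [← norm_pos_iff, hy0, norm_smul, hν1, Real.norm_of_nonneg (by norm_num)]; norm_num
  have hcp : capPoint θ (y 0) = ξ := by
    rw [hy0, capPoint, norm_smul, hν1, Real.norm_of_nonneg (by norm_num), smul_smul]
    norm_num
    exact sub_add_cancel _ _
  have hlim : Tendsto (fun t => capPoint θ (y t)) (𝓝[>] 0) (𝓝[cap n θ] ξ) := by
    refine tendsto_nhdsWithin_iff.mpr ⟨?_, hysec.mono fun t ht => capPoint_mem_of_mem_sector ht⟩
    have := (continuousAt_capPoint (θ := θ) hy00).comp hy.continuousAt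
    rw [ContinuousAt, Function.comp, hcp] at this
    exact this.mono_left nhdsWithin_le_nhds
  refine tendsto_nhds_unique ((hg ξ hξ).tendsto.comp hlim) ?_
  refine tendsto_const_nhds.congr' ?_
  filter_upwards [hysec] with t ht using (hsec ht).symm

theorem integral_pos_of_exists_pos (hθ : θ ∈ Set.Ioo 0 (Real.pi / 2)) {g : Amb n → ℝ}
    (hg : ContinuousOn g (cap n θ)) (h0 : ∀ ξ ∈ cap n θ, 0 ≤ g ξ)
    (hpos : ∃ ξ ∈ cap n θ, 0 < g ξ) : 0 < ∫ ξ, g ξ ∂capMeasure n θ := by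
  obtain ⟨ξ, hξ, h⟩ := hpos
  refine (integral_nonneg_of_ae ((ae_mem_cap n θ).mono h0)).lt_of_ne fun h' => h.ne' ?_
  exact eq_zero_of_integral_eq_zero hθ hg h0 h'.symm ξ hξ

/-- Linear isometries that fix `e` preserve the sector and commute with the radial projection. The
lemma is applied to reflections in vertical hyperplanes. -/
theorem measurePreserving_capMeasure (hθ : θ ∈ Set.Ioo 0 (Real.pi / 2)) (R : Amb n ≃ₗᵢ[ℝ] Amb n)
    (hR : R (eVec n) = eVec n) : MeasurePreserving R (capMeasure n θ) (capMeasure n θ) := by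
  have hRm : Measurable R := R.continuous.measurable
  refine ⟨hRm, ?_⟩
  have hcomm : R ∘ capPoint θ = capPoint θ ∘ R := by
    ext1 y
    simp [capPoint, hR]
  have hlast : ∀ y : Amb n, R y (Fin.last n) = y (Fin.last n) := fun y => by
    have := R.inner_map_map y (eVec n)
    rw [hR, inner_eVec, inner_eVec] at this
    linarith
  have hsec : R ⁻¹' sector n θ = sector n θ := by
    ext y
    simp [mem_sector, hlast]
  rw [capMeasure_eq hθ, Measure.map_smul, Measure.map_map hRm measurable_capPoint, hcomm,
    ← Measure.map_map measurable_capPoint hRm]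
  congr 2
  have := (R.measurePreserving.restrict_preimage (isOpen_sector n θ).measurableSet).map_eq
  rwa [hsec] at this

end CapMeasure

end CapillaryFlow

end

/-! ### The body of the cap, and positivity of the capillary area. -/

noncomputable section
set_option linter.unusedSectionVars false
namespace CapillaryFlow

open Filter Topology MeasureTheory

section Omega

variable {n : ℕ} {θ : ℝ}

/-- Outside the ball, a point escapes along the ray from the centre `cos θ e`; the centre lies below
the half-space, so the height does not decrease. Inside, a component avoiding the cap cannot cross
the sphere, by the intermediate value theorem for the distance to the centre. -/
theorem body_cap (hθ : θ ∈ Set.Ioo 0 (Real.pi / 2)) :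
    body (cap n θ) = {y | y ∈ halfSpace n ∧ ‖y - Real.cos θ • eVec n‖ ≤ 1} := by
  have hcos := cos_pos_of_mem hθ
  ext y
  constructor
  · intro hy
    have hyH : y ∈ halfSpace n := body_subset_halfSpace (fun ξ hξ => hξ.1) hy
    refine ⟨hyH, ?_⟩
    by_contra hlt
    push Not at hlt
    refine notMem_body_of_ray (d := y - Real.cos θ • eVec n) (a := y) ?_ (fun t ht => ⟨?_, ?_⟩) hy
    · rw [← norm_pos_iff]; linarith
    · rw [mem_halfSpace_iff] at hyH ⊢
      simp only [PiLp.add_apply, PiLp.sub_apply, PiLp.smul_apply, eVec_last, smul_eq_mul]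
      have : 0 ≤ t * (y (Fin.last n) - Real.cos θ * -1) := mul_nonneg ht (by linarith)
      linarith
    · intro hmem
      have h1 := hmem.2
      have e : y + t • (y - Real.cos θ • eVec n) - Real.cos θ • eVec n =
          (1 + t) • (y - Real.cos θ • eVec n) := by module
      rw [e, norm_smul, Real.norm_of_nonneg (by linarith)] at h1
      nlinarith
  · rintro ⟨hyH, hy1⟩
    rcases hy1.eq_or_lt with h | h
    · exact Or.inl ⟨hyH, h⟩
    have hyD : y ∈ halfSpace n \ cap n θ := ⟨hyH, fun hc => h.ne hc.2⟩
    refine Or.inr ⟨hyD, (Metric.isBounded_closedBall (x := Real.cos θ • eVec n) (r := 1)).subset ?_⟩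
    intro x hx
    rw [mem_closedBall_iff_norm]
    by_contra hlt
    push Not at hlt
    obtain ⟨w, hw, hw1⟩ := (isPreconnected_connectedComponentIn
      (x := y) (F := halfSpace n \ cap n θ)).intermediate_value (mem_connectedComponentIn hyD) hx
      (f := fun x => ‖x - Real.cos θ • eVec n‖) (by fun_prop) ⟨h.le, hlt.le⟩
    have hwD := connectedComponentIn_subset _ _ hw
    exact hwD.2 ⟨hwD.1, hw1⟩

theorem norm_sq_eq (y : Amb n) : ‖y‖ ^ 2 = ‖proj y‖ ^ 2 + y (Fin.last n) ^ 2 := by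
  rw [EuclideanSpace.norm_sq_eq, EuclideanSpace.norm_sq_eq, Fin.sum_univ_castSucc]
  simp [proj_apply]

theorem flatPart_body_cap (hθ : θ ∈ Set.Ioo 0 (Real.pi / 2)) :
    flatPart (body (cap n θ)) = Metric.closedBall 0 (Real.sin θ) := by
  have hsin := sin_pos_of_mem hθ
  ext z
  rw [mem_closedBall_zero_iff, flatPart, Set.mem_ofPred_eq, body_cap hθ, Set.mem_ofPred_eq]
  have h1 : ‖incl z - Real.cos θ • eVec n‖ ^ 2 = ‖z‖ ^ 2 + Real.cos θ ^ 2 := by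
    rw [norm_sub_sq_real, inner_smul_right, inner_eVec, incl_last, norm_smul, norm_eVec, norm_incl,
      Real.norm_eq_abs, mul_one, sq_abs]
    ring
  rw [← sq_le_one_iff₀ (norm_nonneg _), h1, and_iff_right (incl_mem_halfSpace z),
    ← sq_le_sq₀ (norm_nonneg _) hsin.le]
  have := Real.sin_sq_add_cos_sq θ
  constructor <;> intro h <;> linarith

theorem measurePreserving_last_proj (n : ℕ) :
    MeasurePreserving (fun y : Amb n => (y (Fin.last n), proj y)) := by
  have h1 := PiLp.volume_preserving_ofLp (Fin (n + 1))
  have h2 := volume_preserving_piFinSuccAbove (fun _ : Fin (n + 1) => ℝ) (Fin.last n)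
  have h3 := (MeasurePreserving.id (volume : Measure ℝ)).prod
    (PiLp.volume_preserving_toLp (Fin n))
  have h := h3.comp (h2.comp h1)
  have e : (fun y : Amb n => (y (Fin.last n), proj y)) =
      Prod.map id (WithLp.toLp 2) ∘ MeasurableEquiv.piFinSuccAbove (fun _ => ℝ) (Fin.last n) ∘
        WithLp.ofLp := by
    ext y
    · rfl
    · simp [proj, MeasurableEquiv.piFinSuccAbove, Fin.insertNthEquiv, Fin.init]
  rw [e]
  exact h

/-- The straight cone over the flat disc, with its apex at distance `cos θ` from it. -/
def straightCone (n : ℕ) (θ : ℝ) : Set (ℝ × EuclideanSpace ℝ (Fin n)) :=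
  {q | q.1 ∈ Set.Ioo 0 (Real.cos θ) ∧ ‖q.2‖ < Real.tan θ * q.1}

theorem measurableSet_straightCone (n : ℕ) (θ : ℝ) : MeasurableSet (straightCone n θ) :=
  (measurable_fst measurableSet_Ioo).inter (measurableSet_lt (f := fun q : ℝ ×
    EuclideanSpace ℝ (Fin n) => ‖q.2‖) (g := fun q => Real.tan θ * q.1) (by fun_prop)
    (by fun_prop))

theorem volume_straightCone [NeZero n] (hθ : θ ∈ Set.Ioo 0 (Real.pi / 2)) :
    volume (straightCone n θ) = ENNReal.ofReal (Real.tan θ ^ n * (Real.cos θ ^ (n + 1) / (n + 1)))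
      * volume (Metric.ball (0 : EuclideanSpace ℝ (Fin n)) 1) := by
  have hcos := cos_pos_of_mem hθ
  have htan : 0 < Real.tan θ := Real.tan_pos_of_pos_of_lt_pi_div_two hθ.1 hθ.2
  have hmeas := measurableSet_straightCone n θ
  have hslice : ∀ t : ℝ, volume (Prod.mk t ⁻¹' straightCone n θ) =
      (Set.Ioo 0 (Real.cos θ)).indicator (fun t => ENNReal.ofReal ((Real.tan θ * t) ^ n) *
        volume (Metric.ball (0 : EuclideanSpace ℝ (Fin n)) 1)) t := by
    intro t
    by_cases ht : t ∈ Set.Ioo 0 (Real.cos θ)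
    · rw [Set.indicator_of_mem ht]
      have : Prod.mk t ⁻¹' straightCone n θ = Metric.ball 0 (Real.tan θ * t) := by
        ext p
        rw [mem_ball_zero_iff, Set.mem_preimage, straightCone, Set.mem_ofPred_eq]
        exact and_iff_right ht
      rw [this, Measure.addHaar_ball_of_pos _ _ (mul_pos htan ht.1)]
      simp
    · rw [Set.indicator_of_notMem ht]
      have : Prod.mk t ⁻¹' straightCone n θ = ∅ := by
        ext p
        simp only [Set.mem_preimage, Set.mem_empty_iff_false, iff_false]
        exact fun h => ht h.1
      rw [this, measure_empty]
  rw [Measure.volume_eq_prod, Measure.prod_apply hmeas, lintegral_congr hslice,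
    lintegral_indicator measurableSet_Ioo, lintegral_mul_const _ (by fun_prop)]
  congr 1
  rw [← ofReal_integral_eq_lintegral_ofReal]
  · congr 1
    rw [← integral_Ioc_eq_integral_Ioo, ← intervalIntegral.integral_of_le hcos.le]
    simp only [mul_pow, intervalIntegral.integral_const_mul, integral_pow]
    simp
  · have : ContinuousOn (fun t : ℝ => (Real.tan θ * t) ^ n) (Set.Icc 0 (Real.cos θ)) := by fun_prop
    exact this.integrableOn_Icc.mono_set Set.Ioo_subset_Icc_self
  · filter_upwards [ae_restrict_mem measurableSet_Ioo] with t ht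
    exact pow_nonneg (mul_nonneg htan.le ht.1.le) n

/-- The cone `K` over the flat disc, cut off at height `cos θ`, satisfies `(n + 1) |K| = cos θ
|disc|`, whereas the area of the cap is `(n + 1) |sector|`. The sector contains `K` and, disjoint
from it, the nonempty open set `U` above height `cos θ`, so the difference is positive. -/
theorem omega_pos [NeZero n] (hθ : θ ∈ Set.Ioo 0 (Real.pi / 2)) : 0 < omega n θ := by
  have hcos := cos_pos_of_mem hθ
  have hsin := sin_pos_of_mem hθ
  have hcos1 := cos_lt_one_of_mem hθ
  set κ := volume.real (Metric.ball (0 : EuclideanSpace ℝ (Fin n)) 1)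
  have hflat : volume.real (flatPart (body (cap n θ))) = Real.sin θ ^ n * κ := by
    rw [flatPart_body_cap hθ, measureReal_def, Measure.addHaar_closedBall _ _ hsin.le,
      ENNReal.toReal_mul, ENNReal.toReal_ofReal (by positivity)]
    simp [κ, measureReal_def]
  have harea : (capMeasure n θ).real Set.univ = (n + 1) * volume.real (sector n θ) := by
    have := integral_capMeasure (n := n) hθ (g := fun _ => 1) continuousOn_const
    simpa using this
  set K : Set (Amb n) := (fun y : Amb n => (y (Fin.last n), proj y)) ⁻¹' straightCone n θ
  have hmeas := measurableSet_straightCone n θ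
  have hKm : MeasurableSet K := (measurePreserving_last_proj n).measurable hmeas
  have hK : volume.real K = Real.tan θ ^ n * (Real.cos θ ^ (n + 1) / (n + 1)) * κ := by
    have htan : 0 < Real.tan θ := Real.tan_pos_of_pos_of_lt_pi_div_two hθ.1 hθ.2
    rw [measureReal_def, (measurePreserving_last_proj n).measure_preimage hmeas.nullMeasurableSet,
      volume_straightCone hθ, ENNReal.toReal_mul, ENNReal.toReal_ofReal (by positivity)]
    rfl
  have hKsub : K ⊆ sector n θ := by
    rintro y ⟨⟨h0, h1⟩, h2⟩
    dsimp only at h0 h1 h2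
    have h3 : Real.cos θ * ‖proj y‖ < Real.sin θ * y (Fin.last n) := by
      have := mul_lt_mul_of_pos_left h2 hcos
      rwa [← mul_assoc, mul_comm (Real.cos θ) (Real.tan θ), Real.tan_mul_cos hcos.ne'] at this
    have h4 : Real.cos θ * ‖y‖ < y (Fin.last n) := by
      refine lt_of_pow_lt_pow_left₀ 2 h0.le ?_
      rw [mul_pow, norm_sq_eq]
      have := pow_lt_pow_left₀ h3 (by positivity) two_ne_zero
      nlinarith [Real.sin_sq_add_cos_sq θ]
    exact ⟨by by_contra h; push Not at h; nlinarith, h4⟩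
  set U : Set (Amb n) := {y | ‖y‖ < 1 ∧ Real.cos θ < y (Fin.last n)}
  have hUo : IsOpen U := by
    have h1 : IsOpen {y : Amb n | ‖y‖ < 1} := isOpen_lt (by fun_prop) (by fun_prop)
    have h2 : IsOpen {y : Amb n | Real.cos θ < y (Fin.last n)} :=
      isOpen_lt (by fun_prop) (by fun_prop)
    exact h1.inter h2
  have hUne : U.Nonempty := by
    refine ⟨(-(1 + Real.cos θ) / 2) • eVec n, ?_, ?_⟩
    · rw [norm_smul, norm_eVec, Real.norm_eq_abs, mul_one, abs_lt]
      constructor <;> linarith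
    · simp only [PiLp.smul_apply, eVec_last, smul_eq_mul]
      linarith
  have hUsub : U ⊆ sector n θ := by
    rintro y ⟨h1, h2⟩
    exact ⟨h1, by nlinarith⟩
  have hUpos : 0 < volume.real U :=
    ENNReal.toReal_pos (hUo.measure_pos volume hUne).ne'
      ((measure_mono hUsub).trans_lt volume_sector_lt_top).ne
  have hdisj : Disjoint K U := Set.disjoint_left.mpr fun y hy hy' => by
    have h1 : y (Fin.last n) < Real.cos θ := hy.1.2
    exact absurd h1 (not_lt.mpr hy'.2.le)
  have hsum : volume.real K + volume.real U ≤ volume.real (sector n θ) := by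
    have hKf : volume K ≠ ⊤ := ((measure_mono hKsub).trans_lt volume_sector_lt_top).ne
    have hUf : volume U ≠ ⊤ := ((measure_mono hUsub).trans_lt volume_sector_lt_top).ne
    rw [← measureReal_union hdisj hUo.measurableSet hKf hUf]
    exact measureReal_mono (Set.union_subset hKsub hUsub) volume_sector_lt_top.ne
  have hcone : (n + 1) * volume.real K = Real.cos θ * (Real.sin θ ^ n * κ) := by
    rw [hK, ← Real.tan_mul_cos hcos.ne', mul_pow]
    field_simp
    ring
  rw [omega, hflat, harea, ← hcone]
  have : 0 < (n + 1 : ℝ) := by positivity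
  nlinarith

end Omega

end CapillaryFlow

end

/-! ### The integral of `ℓ` over the cap is `n + 1` times the enclosed volume. -/

noncomputable section
set_option linter.unusedSectionVars false
namespace CapillaryFlow

open Filter Topology MeasureTheory

section CapVolume

variable {n : ℕ} {θ : ℝ}

theorem measureReal_image_eq_integral_abs_det {s : Set (Amb n)} (hs : MeasurableSet s)
    {f : Amb n → Amb n} {f' : Amb n → Amb n →L[ℝ] Amb n} (hf : ∀ y ∈ s, HasFDerivAt f (f' y) y)
    (hinj : Set.InjOn f s) : volume.real (f '' s) = ∫ y in s, |(f' y).det| := by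
  have := integral_image_eq_integral_abs_det_fderiv_smul (μ := (volume : Measure (Amb n))) hs
    (fun y hy => (hf y hy).hasFDerivWithinAt) hinj (fun _ => (1 : ℝ))
  simpa using this

theorem hasFDerivAt_norm {y : Amb n} (hy : y ≠ 0) :
    HasFDerivAt (fun y : Amb n => ‖y‖) (innerSL ℝ (‖y‖⁻¹ • y)) y := by
  have hn : 0 < ‖y‖ := norm_pos_iff.mpr hy
  have h := (hasStrictFDerivAt_norm_sq y).hasFDerivAt.sqrt (by positivity)
  have e : (fun y : Amb n => Real.sqrt (‖y‖ ^ 2)) = fun y => ‖y‖ := by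
    ext y; exact Real.sqrt_sq (norm_nonneg y)
  rw [e] at h
  refine h.congr_fderiv ?_
  ext w
  rw [Real.sqrt_sq hn.le]
  simp only [innerSL_apply_apply, inner_smul_left, FunLike.coe_smul, Pi.smul_apply, smul_eq_mul,
    nsmul_eq_mul, conj_trivial]
  field_simp
  norm_num

/-- The `1`-homogeneous parametrization of the body of the cap by the cone over its normals. -/
def capParam (n : ℕ) (θ : ℝ) (y : Amb n) : Amb n := y + (Real.cos θ * ‖y‖) • eVec n

theorem injective_capParam (hθ : θ ∈ Set.Ioo 0 (Real.pi / 2)) :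
    Function.Injective (capParam n θ) := by
  intro y₁ y₂ h
  have hcos := cos_pos_of_mem hθ
  have hcos1 := cos_lt_one_of_mem hθ
  have h1 : y₁ - y₂ = (Real.cos θ * (‖y₂‖ - ‖y₁‖)) • eVec n := by
    rw [capParam, capParam] at h
    rw [sub_eq_iff_eq_add, mul_sub, sub_smul, sub_add_eq_add_sub, add_comm _ y₂, ← h,
      add_sub_cancel_right]
  have h2 := abs_norm_sub_norm_le y₁ y₂
  rw [h1, norm_smul, norm_eVec, mul_one, Real.norm_eq_abs, abs_mul, abs_of_pos hcos,
    abs_sub_comm] at h2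
  have h3 : |‖y₂‖ - ‖y₁‖| = 0 := by nlinarith [abs_nonneg (‖y₂‖ - ‖y₁‖)]
  rw [abs_eq_zero] at h3
  rw [h3, mul_zero, zero_smul, sub_eq_zero] at h1
  exact h1

/-- A preimage of `x` is `x - cos θ r e` with `r` equal to its own norm; such an `r` in `(0, 1)` is
a zero of a continuous function changing sign. -/
theorem capParam_image (hθ : θ ∈ Set.Ioo 0 (Real.pi / 2)) :
    capParam n θ '' sector n θ =
      {x | 0 < x (Fin.last n) ∧ ‖x - Real.cos θ • eVec n‖ < 1} := by
  have hcos := cos_pos_of_mem hθ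
  have hcos1 := cos_lt_one_of_mem hθ
  ext x
  constructor
  · rintro ⟨y, hy, rfl⟩
    refine ⟨?_, ?_⟩
    · simp only [capParam, PiLp.add_apply, PiLp.smul_apply, eVec_last, smul_eq_mul]
      linarith [(mem_sector.mp hy).2]
    · have e : capParam n θ y - Real.cos θ • eVec n =
          y - (Real.cos θ * (1 - ‖y‖)) • eVec n := by
        rw [capParam]; module
      rw [e]
      refine (norm_sub_le _ _).trans_lt ?_
      have h1 : ‖y‖ < 1 := hy.1
      rw [norm_smul, norm_eVec, mul_one, Real.norm_of_nonneg (mul_nonneg hcos.le (by linarith))]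
      nlinarith
  · rintro ⟨hx0, hx1⟩
    have hxn : 0 < ‖x‖ := norm_pos_iff.mpr (by rintro rfl; simp at hx0)
    have hcont : ContinuousOn (fun r : ℝ => ‖x - (Real.cos θ * r) • eVec n‖ - r)
        (Set.Icc 0 1) := by fun_prop
    obtain ⟨r, ⟨hr0, hr1⟩, hr⟩ := intermediate_value_Ioo' zero_le_one hcont
      (show (0 : ℝ) ∈ Set.Ioo _ _ by
        simp only [mul_one, mul_zero, zero_smul, sub_zero]
        exact ⟨by linarith, hxn⟩)
    have hr' : ‖x - (Real.cos θ * r) • eVec n‖ = r := sub_eq_zero.mp hr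
    refine ⟨x - (Real.cos θ * r) • eVec n, ⟨by rw [hr']; exact hr1, ?_⟩, ?_⟩
    · rw [hr']
      simp only [PiLp.sub_apply, PiLp.smul_apply, eVec_last, smul_eq_mul]
      linarith
    · rw [capParam, hr', sub_add_cancel]

theorem capParam_image_ae_eq (hθ : θ ∈ Set.Ioo 0 (Real.pi / 2)) :
    capParam n θ '' sector n θ =ᵐ[volume] body (cap n θ) := by
  have hconv : Convex ℝ (body (cap n θ)) := by
    have : body (cap n θ) = halfSpace n ∩ Metric.closedBall (Real.cos θ • eVec n) 1 := by
      rw [body_cap hθ]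
      ext y
      rw [Set.mem_inter_iff, mem_closedBall_iff_norm]
      rfl
    rw [this]
    exact (convex_halfSpace n).inter (convex_closedBall _ _)
  have hsub : interior (body (cap n θ)) ⊆ capParam n θ '' sector n θ := by
    rw [capParam_image hθ]
    intro y hy
    obtain ⟨r, hr, hball⟩ := Metric.mem_nhds_iff.mp (mem_interior_iff_mem_nhds.mp hy)
    have hmem : ∀ d : Amb n, ‖d‖ = 1 → y + (r / 2) • d ∈ body (cap n θ) := fun d hd => by
      refine hball ?_
      rw [mem_ball_iff_norm, add_sub_cancel_left, norm_smul, hd, Real.norm_of_nonneg (by positivity)]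
      linarith
    rw [body_cap hθ] at hmem
    refine ⟨?_, ?_⟩
    · have h1 := mem_halfSpace_iff.mp (hmem (eVec n) (norm_eVec n)).1
      simp only [PiLp.add_apply, PiLp.smul_apply, eVec_last, smul_eq_mul] at h1
      linarith
    · set w := y - Real.cos θ • eVec n
      rcases eq_or_ne w 0 with h | h
      · rw [h, norm_zero]; exact one_pos
      have hw : 0 < ‖w‖ := norm_pos_iff.mpr h
      have h1 := (hmem (‖w‖⁻¹ • w) (by rw [norm_smul, norm_inv, norm_norm,
        inv_mul_cancel₀ hw.ne'])).2
      have e : y + (r / 2) • ‖w‖⁻¹ • w - Real.cos θ • eVec n = (1 + r / 2 * ‖w‖⁻¹) • w := by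
        simp only [w]; module
      rw [e, norm_smul, Real.norm_of_nonneg (by positivity), add_mul, mul_assoc,
        inv_mul_cancel₀ hw.ne'] at h1
      linarith
  have hsub' : capParam n θ '' sector n θ ⊆ body (cap n θ) := by
    rw [capParam_image hθ, body_cap hθ]
    exact fun y hy => ⟨mem_halfSpace_iff.mpr hy.1.le, hy.2.le⟩
  refine hsub'.eventuallyLE.antisymm ?_
  have h := hconv.addHaar_frontier volume
  have hnull : ∀ᵐ y : Amb n, y ∉ frontier (body (cap n θ)) := by
    rw [ae_iff]
    simpa using h
  filter_upwards [hnull] with y hy hyB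
  exact hsub (by_contra fun hi => hy ⟨subset_closure hyB, hi⟩)

/-- The derivative of `capParam` is a rank-one perturbation of the identity, whose determinant `1 +
cos θ ⟨e, y / ‖y‖⟩` equals `ℓ`. The claim is the change of variables formula. -/
theorem integral_sector_ell (hθ : θ ∈ Set.Ioo 0 (Real.pi / 2)) :
    ∫ y in sector n θ, ell n θ (capPoint θ y) = volume.real (body (cap n θ)) := by
  have hcos := cos_pos_of_mem hθ
  have hder : ∀ y ∈ sector n θ, HasFDerivAt (capParam n θ)
      (ContinuousLinearMap.id ℝ (Amb n) +
        (Real.cos θ • innerSL ℝ (‖y‖⁻¹ • y)).smulRight (eVec n)) y := fun y hy =>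
    (hasFDerivAt_id y).add
      (((hasFDerivAt_norm (ne_zero_of_mem_sector hy)).const_mul (Real.cos θ)).smul_const (eVec n))
  have hdet : ∀ y ∈ sector n θ, |(ContinuousLinearMap.id ℝ (Amb n) +
      (Real.cos θ • innerSL ℝ (‖y‖⁻¹ • y)).smulRight (eVec n)).det| =
        ell n θ (capPoint θ y) := by
    intro y hy
    have h1 : (ContinuousLinearMap.id ℝ (Amb n) +
      (Real.cos θ • innerSL ℝ (‖y‖⁻¹ • y)).smulRight (eVec n)).det =
        ell n θ (capPoint θ y) := by
      have e : ((ContinuousLinearMap.id ℝ (Amb n) +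
          (Real.cos θ • innerSL ℝ (‖y‖⁻¹ • y)).smulRight (eVec n) : Amb n →L[ℝ] Amb n) :
            Amb n →ₗ[ℝ] Amb n) = LinearMap.transvection
          ((Real.cos θ • innerSL ℝ (‖y‖⁻¹ • y) : Amb n →L[ℝ] ℝ) : Amb n →ₗ[ℝ] ℝ) (eVec n) := by
        ext w
        simp [LinearMap.transvection.apply]
      rw [ContinuousLinearMap.det, e, LinearMap.transvection.det]
      rw [ell_eq, capNormal_capPoint]
      simp only [ContinuousLinearMap.coe_coe, FunLike.coe_smul, Pi.smul_apply,
        innerSL_apply_apply, inner_smul_left, inner_eVec, smul_eq_mul, conj_trivial,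
        PiLp.smul_apply]
      ring
    rw [h1, abs_of_pos (ell_pos hθ (capPoint_mem_of_mem_sector hy))]
  rw [← measureReal_congr (capParam_image_ae_eq hθ),
    measureReal_image_eq_integral_abs_det (isOpen_sector n θ).measurableSet hder
      (injective_capParam hθ).injOn]
  exact (setIntegral_congr_fun (isOpen_sector n θ).measurableSet hdet).symm

theorem integral_ell (hθ : θ ∈ Set.Ioo 0 (Real.pi / 2)) :
    ∫ ξ, ell n θ ξ ∂capMeasure n θ = (n + 1) * volume.real (body (cap n θ)) := by
  rw [integral_capMeasure hθ (continuous_ell n θ).continuousOn, integral_sector_ell hθ]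

theorem capPoint_smul {r : ℝ} (hr : 0 < r) (y : Amb n) : capPoint θ (r • y) = capPoint θ y := by
  rw [capPoint, capPoint, norm_smul, Real.norm_of_nonneg hr.le, smul_smul, mul_inv]
  congr 2
  field_simp

/-- The integrand is constant along rays, so dilation by `r` contributes the factor `r ^ (n + 1)`.
-/
theorem integral_sector_inter_ball_ell (hθ : θ ∈ Set.Ioo 0 (Real.pi / 2)) {r : ℝ} (hr : 0 < r)
    (hr1 : r ≤ 1) : ∫ y in sector n θ ∩ Metric.ball 0 r, ell n θ (capPoint θ y) =
      r ^ (n + 1) * volume.real (body (cap n θ)) := by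
  open scoped Pointwise in
  have hset : r • sector n θ = sector n θ ∩ Metric.ball 0 r := by
    ext y
    rw [Set.mem_smul_set_iff_inv_smul_mem₀ hr.ne', Set.mem_inter_iff, mem_ball_zero_iff,
      mem_sector, mem_sector, norm_smul, norm_inv, Real.norm_of_nonneg hr.le, PiLp.smul_apply,
      smul_eq_mul, inv_mul_lt_iff₀ hr, mul_one, mul_left_comm, mul_lt_mul_iff_right₀ (by positivity)]
    constructor
    · exact fun h => ⟨⟨h.1.trans_le hr1, h.2⟩, h.1⟩
    · exact fun h => ⟨h.2, h.1.2⟩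
  have h := Measure.setIntegral_comp_smul_of_pos (volume : Measure (Amb n))
    (fun y => ell n θ (capPoint θ y)) (sector n θ) hr
  simp only [capPoint_smul hr] at h
  rw [hset, integral_sector_ell hθ] at h
  rw [h]
  simp only [finrank_euclideanSpace, Fintype.card_fin, smul_eq_mul]
  field_simp

end CapVolume

end CapillaryFlow

end

/-! ### Gram determinants, inverse Gauss maps and the Jacobian of the cone map. -/

noncomputable section
set_option linter.unusedSectionVars false
namespace CapillaryFlow

open Filter Topology MeasureTheory

section Determinants

variable {n : ℕ}

/-- An orthonormal basis indexed by `n` tangential directions and one normal direction. -/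
def sumBasis (n : ℕ) : OrthonormalBasis (Fin n ⊕ Fin 1) ℝ (Amb n) :=
  (EuclideanSpace.basisFun (Fin (n + 1)) ℝ).reindex finSumFinEquiv.symm

/-- The family consisting of `f` and one more vector. -/
def famCons (f : Fin n → Amb n) (y : Amb n) : Fin n ⊕ Fin 1 → Amb n := Sum.elim f fun _ => y

theorem det_gram (u w : Fin n ⊕ Fin 1 → Amb n) :
    (Matrix.of fun i j => inner ℝ (u i) (w j)).det =
      (sumBasis n).toBasis.det u * (sumBasis n).toBasis.det w := by
  rw [Module.Basis.det_apply, Module.Basis.det_apply,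
    ← Matrix.det_transpose ((sumBasis n).toBasis.toMatrix u), ← Matrix.det_mul]
  congr 1
  ext i j
  rw [Matrix.of_apply, Matrix.mul_apply, ← (sumBasis n).sum_inner_mul_inner]
  refine Finset.sum_congr rfl fun k _ => ?_
  simp [Module.Basis.toMatrix_apply, OrthonormalBasis.repr_apply_apply, real_inner_comm]

/-- The product is a Gram determinant, block triangular because `ν` is orthogonal to every `g j`. -/
theorem det_famCons_mul_det_famCons (f g : Fin n → Amb n) (ν y : Amb n)
    (h : ∀ j, inner ℝ ν (g j) = 0) :
    (sumBasis n).toBasis.det (famCons f ν) * (sumBasis n).toBasis.det (famCons g y) =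
      (Matrix.of fun i j => inner ℝ (f i) (g j)).det * inner ℝ ν y := by
  rw [← det_gram]
  have e : (Matrix.of fun i j => inner ℝ (famCons f ν i) (famCons g y j)) =
      Matrix.fromBlocks (Matrix.of fun i j => inner ℝ (f i) (g j))
        (Matrix.of fun i _ => inner ℝ (f i) y) 0
        (Matrix.of fun (_ _ : Fin 1) => inner ℝ ν y) := by
    ext (i | i) (j | j) <;> simp [famCons, h]
  rw [e, Matrix.det_fromBlocks_zero₂₁]
  simp

/-- Applying `D` to the frame `(m, ν + τ)` gives the frame `(f, y)`, so `D.det` is a quotient of two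
determinants; multiplying both by that of `(f, ν)` turns them into Gram determinants. With `m` and
`f` the derivatives of the normal and of the immersion, this reads `D.det * K = ⟨ν, y⟩`. The
tangential vector `τ` makes room for the time derivative of the normal. -/
theorem det_mul_det_eq (D : Amb n →L[ℝ] Amb n) (f m : Fin n → Amb n) (ν τ y : Amb n)
    (hν : ‖ν‖ = 1) (hτ : inner ℝ ν τ = 0) (hf : ∀ i, inner ℝ ν (f i) = 0)
    (hm : ∀ i, inner ℝ ν (m i) = 0) (hD : ∀ i, D (m i) = f i) (hDν : D (ν + τ) = y) :
    D.det * (Matrix.of fun i j => inner ℝ (m i) (f j)).det =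
      (Matrix.of fun i j => inner ℝ (f i) (f j)).det * inner ℝ ν y := by
  have h1 := det_famCons_mul_det_famCons f f ν y hf
  have h2 := det_famCons_mul_det_famCons f m ν (ν + τ) hm
  have h3 : (sumBasis n).toBasis.det (famCons f y) =
      D.det * (sumBasis n).toBasis.det (famCons m (ν + τ)) := by
    rw [ContinuousLinearMap.det, ← Module.Basis.det_comp]
    congr 1
    ext1 i
    rcases i with i | i
    · exact (hD i).symm
    · exact hDν.symm
  have h4 : (Matrix.of fun i j => inner ℝ (f i) (m j)).det =
      (Matrix.of fun i j => inner ℝ (m i) (f j)).det := by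
    rw [← Matrix.det_transpose]
    congr 1
    ext i j
    simp [real_inner_comm]
  rw [inner_add_right, hτ, real_inner_self_eq_norm_sq, hν, h4] at h2
  rw [← h1, h3]
  linear_combination -D.det * h2

/-- Symmetry is not required. The segment from the identity to `A` consists of matrices positive on
every nonzero vector, so its determinant never vanishes. -/
theorem det_pos_of_forall_pos (A : Matrix (Fin n) (Fin n) ℝ)
    (h : ∀ v : Fin n → ℝ, v ≠ 0 → 0 < v ⬝ᵥ A.mulVec v) : 0 < A.det := by
  set B : ℝ → Matrix (Fin n) (Fin n) ℝ := fun t => (1 - t) • 1 + t • A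
  have hne : ∀ t ∈ Set.Icc (0 : ℝ) 1, (B t).det ≠ 0 := by
    intro t ht h0
    obtain ⟨v, hv, hv0⟩ := Matrix.exists_mulVec_eq_zero_iff.mpr h0
    have h1 : v ⬝ᵥ (B t).mulVec v = (1 - t) * (v ⬝ᵥ v) + t * (v ⬝ᵥ A.mulVec v) := by
      simp [B, Matrix.add_mulVec, Matrix.smul_mulVec, dotProduct_add]
    rw [hv0, dotProduct_zero] at h1
    have h2 : 0 < v ⬝ᵥ v := by
      refine lt_of_le_of_ne ?_ fun h => hv (dotProduct_self_eq_zero.mp h.symm)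
      exact Finset.sum_nonneg fun i _ => mul_self_nonneg _
    have h3 := h v hv
    rcases ht.1.eq_or_lt with h | h
    · rw [← h] at h1; linarith
    · nlinarith [ht.2]
  have hcont : ContinuousOn (fun t => (B t).det) (Set.Icc 0 1) := by
    have : Continuous B := by fun_prop
    exact this.matrix_det.continuousOn
  by_contra hle
  push Not at hle
  have h0 : (B 0).det = 1 := by simp [B]
  have h1 : (B 1).det = A.det := by simp [B]
  obtain ⟨t, ht, h⟩ := intermediate_value_Icc' zero_le_one hcont
    (show (0 : ℝ) ∈ Set.Icc _ _ by rw [h0, h1]; exact ⟨hle, zero_le_one⟩)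
  exact hne t ht h

theorem det_inner_pos (A L : EuclideanSpace ℝ (Fin n) →L[ℝ] Amb n)
    (h : ∀ v, v ≠ 0 → 0 < inner ℝ (A v) (L v)) :
    0 < (Matrix.of fun i j : Fin n => inner ℝ (A (EuclideanSpace.single i 1))
      (L (EuclideanSpace.single j 1))).det := by
  refine det_pos_of_forall_pos _ fun v hv => ?_
  set w : EuclideanSpace ℝ (Fin n) := WithLp.toLp 2 v
  have hw : w = ∑ i, v i • EuclideanSpace.single i (1 : ℝ) := by
    ext j
    simp [w, Finset.sum_apply, Pi.single_apply]
  have hw0 : w ≠ 0 := fun h0 => hv (by simpa [w] using h0)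
  have h1 := h w hw0
  rw [hw] at h1
  simp only [map_sum, map_smul, sum_inner, inner_sum, inner_smul_left, inner_smul_right] at h1
  convert h1 using 1
  simp only [dotProduct, Matrix.mulVec, Matrix.of_apply, Finset.mul_sum, conj_trivial]
  rw [Finset.sum_comm]
  refine Finset.sum_congr rfl fun i _ => Finset.sum_congr rfl fun j _ => ?_
  ring

end Determinants

/-- Differentiability of a map given through a parametrization of its source. -/
theorem exists_hasFDerivAt_of_param {n : ℕ}
    {Q P : ℝ × EuclideanSpace ℝ (Fin n) → Amb n} {p : ℝ × EuclideanSpace ℝ (Fin n)}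
    {Q' P' : ℝ × EuclideanSpace ℝ (Fin n) →L[ℝ] Amb n}
    {Ψ : Amb n → Amb n} {R : Amb n → ℝ × EuclideanSpace ℝ (Fin n)} {y₀ : Amb n}
    (hQ : HasFDerivAt Q Q' p) (hP : HasFDerivAt P P' p) (hinj : Function.Injective Q')
    (hR : ContinuousAt R y₀) (hRp : R y₀ = p) (hQR : ∀ᶠ y in 𝓝 y₀, Q (R y) = y)
    (hΨ : ∀ᶠ y in 𝓝 y₀, Ψ y = P (R y)) :
    ∃ D : Amb n →L[ℝ] Amb n, HasFDerivAt Ψ D y₀ ∧ ∀ w, D (Q' w) = P' w := by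
  set e : (ℝ × EuclideanSpace ℝ (Fin n)) ≃L[ℝ] Amb n :=
    (LinearEquiv.ofInjectiveOfFinrankEq (Q' : _ →ₗ[ℝ] Amb n) hinj
      (by simp [Module.finrank_prod, add_comm])).toContinuousLinearEquiv
  have he : ∀ w, e w = Q' w := fun w => rfl
  have hQe : HasFDerivAt Q (e : _ →L[ℝ] Amb n) (R y₀) := by
    rw [hRp]
    exact hQ.congr_fderiv (ContinuousLinearMap.ext fun w => (he w).symm)
  -- Continuity of the local inverse `R` suffices: invertibility of `Q'` makes it differentiable at
  -- the point, although `Q` is only known to be differentiable there.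
  have hR' := hQe.of_local_left_inverse hR hQR
  have hP' : HasFDerivAt P P' (R y₀) := by rwa [hRp]
  refine ⟨_, (hP'.comp y₀ hR').congr_of_eventuallyEq hΨ, fun w => ?_⟩
  rw [← he w]
  simp

section Inverse

/-- The inverses of a continuous family of injective maps on a compact space are jointly
continuous. -/
theorem continuousOn_family_inverse {T M Y : Type*} [TopologicalSpace T] [TopologicalSpace M]
    [CompactSpace M] [TopologicalSpace Y] [T2Space Y] {s : Set T} {C : Set Y} {g : T → M → Y}
    {inv : T → Y → M} (hg : ContinuousOn (fun q : T × M => g q.1 q.2) (s ×ˢ Set.univ))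
    (hr : ∀ t ∈ s, ∀ ξ ∈ C, g t (inv t ξ) = ξ) (hl : ∀ t ∈ s, ∀ x, inv t (g t x) = x) :
    ContinuousOn (fun q : T × Y => inv q.1 q.2) (s ×ˢ C) := by
  rintro ⟨t₀, ξ₀⟩ ⟨ht₀, hξ₀⟩
  -- As `M` is compact, it is enough that every cluster point of the inverses is the expected one.
  refine tendsto_nhds_of_unique_mapClusterPt fun x hx => ?_
  obtain ⟨U, hU, hUx⟩ := mapClusterPt_iff_ultrafilter.mp hx
  have hUmem : ∀ᶠ q in (U : Filter (T × Y)), q ∈ s ×ˢ C := hU self_mem_nhdsWithin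
  have hU1 : Tendsto Prod.fst (U : Filter (T × Y)) (𝓝 t₀) :=
    (continuous_fst.tendsto (t₀, ξ₀)).mono_left (hU.trans nhdsWithin_le_nhds)
  have hU2 : Tendsto Prod.snd (U : Filter (T × Y)) (𝓝 ξ₀) :=
    (continuous_snd.tendsto (t₀, ξ₀)).mono_left (hU.trans nhdsWithin_le_nhds)
  have hpair : Tendsto (fun q : T × Y => (q.1, inv q.1 q.2)) U
      (𝓝[s ×ˢ Set.univ] (t₀, x)) :=
    tendsto_nhdsWithin_iff.mpr ⟨hU1.prodMk_nhds hUx, hUmem.mono fun q hq => ⟨hq.1, trivial⟩⟩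
  have h1 := ((hg (t₀, x) ⟨ht₀, trivial⟩).tendsto.comp hpair)
  have h2 : Tendsto (fun q : T × Y => g q.1 (inv q.1 q.2)) U (𝓝 ξ₀) :=
    hU2.congr' (hUmem.mono fun q hq => (hr _ hq.1 _ hq.2).symm)
  have h3 : g t₀ x = ξ₀ := tendsto_nhds_unique h1 h2
  rw [← hl t₀ ht₀ x, h3]

end Inverse

theorem hasFDerivAt_comp_extChartAt_symm {n : ℕ} [NeZero n] {M : Type*} [TopologicalSpace M]
    [ChartedSpace (EuclideanHalfSpace n) M] {G : M → Amb n} {x₀ : M}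
    (h : MDifferentiableAt (𝓡∂ n) 𝓘(ℝ, Amb n) G x₀) (hint : (𝓡∂ n).IsInteriorPoint x₀) :
    HasFDerivAt (fun v => G ((extChartAt (𝓡∂ n) x₀).symm v)) (tangentMapAt G x₀)
      (extChartAt (𝓡∂ n) x₀ x₀) :=
  h.hasMFDerivAt.2.hasFDerivAt (mem_interior_iff_mem_nhds.mp hint)

namespace IsStrictlyConvexCapillary

variable {n : ℕ} [NeZero n] {M : Type*} [TopologicalSpace M] [CompactSpace M] [ConnectedSpace M]
  [ChartedSpace (EuclideanHalfSpace n) M] {θ : ℝ} {F N : M → Amb n}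

theorem det_second_pos (hc : IsStrictlyConvexCapillary θ F N) (x : M) :
    0 < (Matrix.of fun i j : Fin n => inner ℝ (tangentMapAt N x (EuclideanSpace.single i 1))
        (tangentMapAt F x (EuclideanSpace.single j 1))).det :=
  det_inner_pos _ _ (hc.curvature_pos x)

theorem det_first_pos (hc : IsStrictlyConvexCapillary θ F N) (x : M) :
    0 < (Matrix.of fun i j : Fin n => inner ℝ (tangentMapAt F x (EuclideanSpace.single i 1))
        (tangentMapAt F x (EuclideanSpace.single j 1))).det :=
  det_inner_pos _ _ fun v hv => by
    rw [real_inner_self_eq_norm_sq]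
    have : tangentMapAt F x v ≠ 0 := fun h => hv ((injective_iff_map_eq_zero _).mp
      (hc.immersion x) v h)
    positivity

theorem gaussCurvature_pos (hc : IsStrictlyConvexCapillary θ F N) (x : M) :
    0 < gaussCurvature F N x := div_pos (hc.det_second_pos x) (hc.det_first_pos x)

/-- The Jacobian of a map that takes the derivative of the normal to that of the immersion. -/
theorem det_mul_gaussCurvature (hc : IsStrictlyConvexCapillary θ F N) (x : M)
    (D : Amb n →L[ℝ] Amb n) (hD : ∀ v, D (tangentMapAt N x v) = tangentMapAt F x v)
    {τ y : Amb n} (hτ : inner ℝ (N x) τ = 0) (hDy : D (N x + τ) = y) :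
    D.det * gaussCurvature F N x = inner ℝ (N x) y := by
  have h := det_mul_det_eq D (fun i => tangentMapAt F x (EuclideanSpace.single i 1))
    (fun i => tangentMapAt N x (EuclideanSpace.single i 1)) (N x) τ y (hc.normal_unit x) hτ
    (fun i => hc.normal_orthogonal x _) (fun i => hc.inner_normal_tangentMapAt_normal x _)
    (fun i => hD _) hDy
  have h1 := hc.det_first_pos x
  rw [gaussCurvature, mul_div_assoc', h, mul_div_cancel_left₀ _ h1.ne']

theorem continuousOn_invFun (hc : IsStrictlyConvexCapillary θ F N)
    (hθ : θ ∈ Set.Ioo 0 (Real.pi / 2)) (hM : ((𝓡∂ n).boundary M).Nonempty) :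
    ContinuousOn (Function.invFun (capGaussMap θ N)) (cap n θ) := by
  have h := continuousOn_family_inverse (s := (Set.univ : Set Unit)) (C := cap n θ)
    (g := fun _ => capGaussMap θ N) (inv := fun _ => Function.invFun (capGaussMap θ N))
    (by
      have : Continuous (capGaussMap θ N) := hc.continuous_normal.add continuous_const
      exact (this.comp continuous_snd).continuousOn)
    (fun _ _ ξ hξ => hc.capGaussMap_invFun hθ hM hξ)
    (fun _ _ x => hc.invFun_capGaussMap hθ hM x)
  exact h.comp (f := fun ξ => ((), ξ)) (by fun_prop) fun ξ hξ => ⟨trivial, hξ⟩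

theorem continuousOn_supportFn (hc : IsStrictlyConvexCapillary θ F N)
    (hθ : θ ∈ Set.Ioo 0 (Real.pi / 2)) (hM : ((𝓡∂ n).boundary M).Nonempty) (z : Amb n) :
    ContinuousOn (supportFn θ (Set.range F) z) (cap n θ) := by
  have h : ContinuousOn (fun ξ => inner ℝ (capNormal n θ ξ)
      (F (Function.invFun (capGaussMap θ N) ξ) - z)) (cap n θ) := by
    have h1 := hc.continuous.comp_continuousOn (hc.continuousOn_invFun hθ hM)
    exact (by fun_prop : ContinuousOn (fun ξ => capNormal n θ ξ) (cap n θ)).inner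
      (h1.sub continuousOn_const)
  exact h.congr fun ξ hξ => hc.supportFn_eq hθ hM z hξ

theorem continuousOn_capGaussCurvature (hc : IsStrictlyConvexCapillary θ F N)
    (hθ : θ ∈ Set.Ioo 0 (Real.pi / 2)) (hM : ((𝓡∂ n).boundary M).Nonempty)
    (hK : Continuous (gaussCurvature F N)) :
    ContinuousOn (capGaussCurvature θ F N) (cap n θ) :=
  hK.comp_continuousOn (hc.continuousOn_invFun hθ hM)

theorem capGaussCurvature_pos (hc : IsStrictlyConvexCapillary θ F N) (ξ : Amb n) :
    0 < capGaussCurvature θ F N ξ := hc.gaussCurvature_pos _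

/-- The body is parametrized by the cone over its normals, from an interior base point. -/
def coneParam (θ : ℝ) (F N : M → Amb n) (z y : Amb n) : Amb n :=
  z + ‖y‖ • (F (Function.invFun (capGaussMap θ N) (capPoint θ y)) - z)

theorem normal_invFun_capPoint (hc : IsStrictlyConvexCapillary θ F N)
    (hθ : θ ∈ Set.Ioo 0 (Real.pi / 2)) (hM : ((𝓡∂ n).boundary M).Nonempty) {y : Amb n}
    (hy : y ∈ sector n θ) :
    N (Function.invFun (capGaussMap θ N) (capPoint θ y)) = ‖y‖⁻¹ • y := by
  rw [hc.normal_invFun hθ hM (capPoint_mem_of_mem_sector hy), capNormal_capPoint]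

theorem last_pos_of_mem_sector (hc : IsStrictlyConvexCapillary θ F N)
    (hθ : θ ∈ Set.Ioo 0 (Real.pi / 2)) (hM : ((𝓡∂ n).boundary M).Nonempty) {y : Amb n}
    (hy : y ∈ sector n θ) :
    0 < F (Function.invFun (capGaussMap θ N) (capPoint θ y)) (Fin.last n) := by
  refine (mem_halfSpace_iff.mp (hc.mem_halfSpace _)).lt_of_ne' fun h => ?_
  have h1 := hc.normal_last_of_last_eq_zero h
  rw [hc.normal_invFun_capPoint hθ hM hy, PiLp.smul_apply, smul_eq_mul, inv_mul_eq_div,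
    div_eq_iff (norm_pos_of_mem_sector hy).ne'] at h1
  exact (mem_sector.mp hy).2.ne h1.symm

theorem continuousAt_invFun_capPoint (hc : IsStrictlyConvexCapillary θ F N)
    (hθ : θ ∈ Set.Ioo 0 (Real.pi / 2)) (hM : ((𝓡∂ n).boundary M).Nonempty) {y : Amb n}
    (hy : y ∈ sector n θ) :
    ContinuousAt (fun y => Function.invFun (capGaussMap θ N) (capPoint θ y)) y := by
  have h := (hc.continuousOn_invFun hθ hM).comp
    (fun y hy => (continuousAt_capPoint (θ := θ) (ne_zero_of_mem_sector hy)).continuousWithinAt)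
    (fun y (hy : y ∈ sector n θ) => capPoint_mem_of_mem_sector hy)
  exact h.continuousAt ((isOpen_sector n θ).mem_nhds hy)

/-- In the coordinates `(r, x)` the source point is `r N(x)` and the image is `z + r (F x - z)`.
Hence `D` sends `dN` to `dF` and `N` to `F - z`, and its determinant is `h / K`. Points of the open
sector correspond to points of positive height, thus to interior points of `M`, where charts cover a
full neighbourhood. -/
theorem exists_hasFDerivAt_coneParam (hc : IsStrictlyConvexCapillary θ F N)
    (hθ : θ ∈ Set.Ioo 0 (Real.pi / 2)) (hM : ((𝓡∂ n).boundary M).Nonempty) (z : Amb n) {y : Amb n}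
    (hy : y ∈ sector n θ) : ∃ D : Amb n →L[ℝ] Amb n, HasFDerivAt (coneParam θ F N z) D y ∧
      D.det = supportFn θ (Set.range F) z (capPoint θ y) /
        capGaussCurvature θ F N (capPoint θ y) := by
  set x₀ := Function.invFun (capGaussMap θ N) (capPoint θ y)
  have hcap := capPoint_mem_of_mem_sector hy
  have hr : 0 < ‖y‖ := norm_pos_of_mem_sector hy
  have hN : N x₀ = ‖y‖⁻¹ • y := hc.normal_invFun_capPoint hθ hM hy
  have hint := hc.isInteriorPoint_of_pos (hc.last_pos_of_mem_sector hθ hM hy)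
  set φ := extChartAt (𝓡∂ n) x₀
  obtain ⟨c, hcφ⟩ : ∃ c : EuclideanSpace ℝ (Fin n) → M, φ.symm = c := ⟨_, rfl⟩
  have hF' := hasFDerivAt_comp_extChartAt_symm (hc.mdifferentiableAt x₀) hint
  have hN' := hasFDerivAt_comp_extChartAt_symm (hc.mdifferentiableAt_normal x₀) hint
  rw [hcφ] at hF' hN'
  set p : ℝ × EuclideanSpace ℝ (Fin n) := (‖y‖, φ x₀)
  have hfst : HasFDerivAt (Prod.fst : ℝ × EuclideanSpace ℝ (Fin n) → ℝ)
    (ContinuousLinearMap.fst ℝ ℝ (EuclideanSpace ℝ (Fin n))) p := hasFDerivAt_fst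
  have hsnd : HasFDerivAt (Prod.snd : ℝ × EuclideanSpace ℝ (Fin n) → _)
    (ContinuousLinearMap.snd ℝ ℝ (EuclideanSpace ℝ (Fin n))) p := hasFDerivAt_snd
  have hQ := hfst.smul (HasFDerivAt.comp p (f := Prod.snd) hN' hsnd)
  have hP := (hfst.smul ((HasFDerivAt.comp p (f := Prod.snd) hF' hsnd).sub_const z)).const_add z
  have hinv : c (φ x₀) = x₀ := hcφ ▸ extChartAt_to_inv x₀
  have hcont := hc.continuousAt_invFun_capPoint hθ hM hy
  refine Exists.elim (exists_hasFDerivAt_of_param (Ψ := coneParam θ F N z) (y₀ := y)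
    (R := fun y' => (‖y'‖, φ (Function.invFun (capGaussMap θ N) (capPoint θ y')))) hQ hP ?_ ?_ rfl
    ?_ ?_) fun D hDD => ?_
  · refine (injective_iff_map_eq_zero _).mpr ?_
    rintro ⟨a, v⟩ h
    have h1 : ‖y‖ • tangentMapAt N x₀ v + a • N x₀ = 0 := by
      simpa [p, hinv] using h
    have h2 := congrArg (fun w => inner ℝ (N x₀) w) h1
    simp only [inner_add_right, inner_smul_right, hc.inner_normal_tangentMapAt_normal,
      real_inner_self_eq_norm_sq, hc.normal_unit, inner_zero_right] at h2
    have ha : a = 0 := by linarith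
    rw [ha, zero_smul, add_zero, smul_eq_zero] at h1
    have hv : v = 0 := (injective_iff_map_eq_zero _).mp (hc.injective_tangentMapAt_normal x₀) v
      (h1.resolve_left hr.ne')
    rw [ha, hv]; rfl
  · exact continuous_norm.continuousAt.prodMk (ContinuousAt.comp (g := φ)
      (f := fun y => Function.invFun (capGaussMap θ N) (capPoint θ y))
      (continuousAt_extChartAt x₀) hcont)
  · filter_upwards [hcont.eventually (extChartAt_source_mem_nhds (I := 𝓡∂ n) x₀),
      (isOpen_sector n θ).mem_nhds hy] with y' hy' hy's
    simp only [Pi.smul_apply', Function.comp]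
    rw [show c (φ _) = _ from hcφ ▸ φ.left_inv hy', hc.normal_invFun_capPoint hθ hM hy's, smul_smul,
      mul_inv_cancel₀ (norm_pos_of_mem_sector hy's).ne', one_smul]
  · filter_upwards [hcont.eventually (extChartAt_source_mem_nhds (I := 𝓡∂ n) x₀)] with y' hy'
    simp only [Pi.smul_apply', Function.comp]
    rw [show c (φ _) = _ from hcφ ▸ φ.left_inv hy']
    rfl
  · obtain ⟨hD, hDw⟩ := hDD
    have e1 : ∀ v, D (tangentMapAt N x₀ v) = tangentMapAt F x₀ v := fun v => by
      have := hDw (0, v)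
      simpa [p, hr.ne'] using this
    have e2 : D (N x₀ + 0) = F x₀ - z := by
      have := hDw (1, 0)
      simpa [p, hinv] using this
    refine ⟨D, hD, ?_⟩
    rw [eq_div_iff (hc.capGaussCurvature_pos _).ne', hc.supportFn_eq hθ hM z hcap,
      ← hc.normal_invFun hθ hM hcap]
    exact hc.det_mul_gaussCurvature x₀ D e1 (inner_zero_right _) e2

end IsStrictlyConvexCapillary

end CapillaryFlow

end

/-! ### The volume of the body as the integral of `h / K`. -/

noncomputable section
set_option linter.unusedSectionVars false
namespace CapillaryFlow

open Filter Topology MeasureTheory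

theorem volume_last_eq_zero (n : ℕ) : volume {y : Amb n | y (Fin.last n) = 0} = 0 := by
  have h := Measure.addHaar_submodule (volume : Measure (Amb n)) (ℝ ∙ eVec n)ᗮ (by
    intro h
    have h1 : eVec n ∈ (ℝ ∙ eVec n)ᗮ := h ▸ Submodule.mem_top
    rw [Submodule.mem_orthogonal_singleton_iff_inner_right, inner_eVec, eVec_last] at h1
    norm_num at h1)
  convert h using 2
  ext y
  rw [SetLike.mem_coe, Submodule.mem_orthogonal_singleton_iff_inner_right, real_inner_comm,
    inner_eVec, neg_eq_zero]
  rfl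

namespace IsStrictlyConvexCapillary

variable {n : ℕ} [NeZero n] {M : Type*} [TopologicalSpace M] [CompactSpace M] [ConnectedSpace M]
  [ChartedSpace (EuclideanHalfSpace n) M] {θ : ℝ} {F N : M → Amb n}

theorem range_subset_frontier (hc : IsStrictlyConvexCapillary θ F N) :
    Set.range F ⊆ frontier (body (Set.range F)) := by
  rintro _ ⟨x, rfl⟩
  refine ⟨subset_closure (hc.mem_body x), fun h => ?_⟩
  have := hc.inner_neg_of_mem_interior h x
  rw [sub_self, inner_zero_right] at this
  exact lt_irrefl _ this

theorem ae_notMem_range (hc : IsStrictlyConvexCapillary θ F N) :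
    ∀ᵐ y : Amb n, y ∉ Set.range F ∧ y (Fin.last n) ≠ 0 := by
  have h1 : ∀ᵐ y : Amb n, y ∉ frontier (body (Set.range F)) := by
    rw [ae_iff]
    simpa using hc.convex_body.addHaar_frontier volume
  have h2 : ∀ᵐ y : Amb n, y (Fin.last n) ≠ 0 := by
    rw [ae_iff]
    simpa using volume_last_eq_zero n
  filter_upwards [h1, h2] with y hy1 hy2
  exact ⟨fun h => hy1 (hc.range_subset_frontier h), hy2⟩

/-- A point of positive height inside the body lies on a segment from a base point in the flat part
to the hypersurface. -/
theorem exists_mem_ray (hc : IsStrictlyConvexCapillary θ F N) {z y : Amb n}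
    (hy : y ∈ body (Set.range F))
    (hyS : y ∉ Set.range F) (hyz : y ≠ z) (hypos : z (Fin.last n) ≤ y (Fin.last n)) :
    ∃ ρ : ℝ, 1 < ρ ∧ ∃ x, F x = z + ρ • (y - z) := by
  have hd : y - z ≠ 0 := sub_ne_zero.mpr hyz
  by_contra hcon
  push Not at hcon
  refine notMem_body_of_ray (S := Set.range F) (a := y) hd (fun t ht => ⟨?_, ?_⟩) hy
  · have h1 := mem_halfSpace_iff.mp (body_subset_halfSpace hc.range_subset hy)
    rw [mem_halfSpace_iff]
    simp only [PiLp.add_apply, PiLp.sub_apply, PiLp.smul_apply, smul_eq_mul]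
    have : 0 ≤ t * (y (Fin.last n) - z (Fin.last n)) := mul_nonneg ht (by linarith)
    linarith
  · rintro ⟨x, hx⟩
    rcases ht.eq_or_lt with h | h
    · rw [← h, zero_smul, add_zero] at hx
      exact hyS ⟨x, hx⟩
    · refine hcon (1 + t) (by linarith) x ?_
      rw [hx]
      module

/-- The volume of the body in terms of its support function and Gauss curvature. -/
theorem volume_body_eq (hc : IsStrictlyConvexCapillary θ F N)
    (hθ : θ ∈ Set.Ioo 0 (Real.pi / 2)) (hM : ((𝓡∂ n).boundary M).Nonempty)
    (hK : Continuous (gaussCurvature F N)) {z : EuclideanSpace ℝ (Fin n)}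
    (hz : z ∈ interior (flatPart (body (Set.range F)))) :
    ∫ ξ, supportFn θ (Set.range F) (incl z) ξ / capGaussCurvature θ F N ξ ∂capMeasure n θ =
      (n + 1) * volume.real (body (Set.range F)) := by
  have hzpos := (hc.mem_interior_flatPart_iff_supportFn_pos hθ hM).mp hz
  have hzneg := (hc.mem_interior_flatPart_iff hθ hM).mp hz
  have hzB : incl z ∈ body (Set.range F) := interior_subset (s := flatPart _) hz
  have hcont : ContinuousOn (fun ξ => supportFn θ (Set.range F) (incl z) ξ /
      capGaussCurvature θ F N ξ) (cap n θ) :=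
    (hc.continuousOn_supportFn hθ hM _).div (hc.continuousOn_capGaussCurvature hθ hM hK)
      fun ξ _ => (hc.capGaussCurvature_pos ξ).ne'
  rw [integral_capMeasure hθ hcont]
  congr 1
  choose! D hD hdet using fun y (hy : y ∈ sector n θ) =>
    hc.exists_hasFDerivAt_coneParam hθ hM (incl z) hy
  have hinj : Set.InjOn (coneParam θ F N (incl z)) (sector n θ) := by
    -- If two points of the hypersurface lay on one ray from the base point, the farther one would
    -- be strictly outside the tangent hyperplane at the nearer one.
    have aux : ∀ (r₁ r₂ : ℝ) (x₁ x₂ : M), 0 < r₁ → r₁ < r₂ →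
        r₁ • (F x₁ - incl z) = r₂ • (F x₂ - incl z) → False := by
      intro r₁ r₂ x₁ x₂ h1 h12 h
      have h2 := hc.normal_outward x₂ _ (hc.mem_body x₁)
      have h3 := hzneg x₂
      have e : F x₁ - F x₂ = (r₂ / r₁ - 1) • (F x₂ - incl z) := by
        have : F x₁ - incl z = (r₂ / r₁) • (F x₂ - incl z) := by
          rw [div_eq_inv_mul, mul_smul, ← h, smul_smul, inv_mul_cancel₀ h1.ne', one_smul]
        rw [sub_smul, one_smul, ← this]
        abel
      rw [e, inner_smul_right] at h2
      rw [← neg_sub, inner_neg_right] at h3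
      have h4 : 0 < r₂ / r₁ - 1 := by rw [sub_pos, one_lt_div h1]; exact h12
      nlinarith
    intro y₁ hy₁ y₂ hy₂ h
    have h' := add_left_cancel h
    have hn : ‖y₁‖ = ‖y₂‖ := by
      rcases lt_trichotomy ‖y₁‖ ‖y₂‖ with hlt | heq | hlt
      · exact (aux _ _ _ _ (norm_pos_of_mem_sector hy₁) hlt h').elim
      · exact heq
      · exact (aux _ _ _ _ (norm_pos_of_mem_sector hy₂) hlt h'.symm).elim
    rw [hn] at h'
    have h2 := hc.injective (sub_left_injective
      (smul_right_injective _ (norm_pos_of_mem_sector hy₂).ne' h'))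
    have h3 := congrArg N h2
    rw [hc.normal_invFun_capPoint hθ hM hy₁, hc.normal_invFun_capPoint hθ hM hy₂, hn] at h3
    exact smul_right_injective _ (inv_ne_zero (norm_pos_of_mem_sector hy₂).ne') h3
  -- Up to the null set formed by the hypersurface and the hyperplane, each `y` in the body lies on
  -- a segment from the base point to some `F x`, with `F x - z = ρ (y - z)` and `ρ > 1`; its
  -- preimage is `ρ⁻¹ • N x`.
  have himage : coneParam θ F N (incl z) '' sector n θ =ᵐ[volume] body (Set.range F) := by
    have hsub : coneParam θ F N (incl z) '' sector n θ ⊆ body (Set.range F) := by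
      rintro _ ⟨y, hy, rfl⟩
      exact hc.convex_body.add_smul_sub_mem hzB (hc.mem_body _) ⟨norm_nonneg y, hy.1.le⟩
    refine hsub.eventuallyLE.antisymm ?_
    filter_upwards [hc.ae_notMem_range] with y hy hyB
    have hy0 := mem_halfSpace_iff.mp (body_subset_halfSpace hc.range_subset hyB)
    have hypos : 0 < y (Fin.last n) := lt_of_le_of_ne hy0 (Ne.symm hy.2)
    obtain ⟨ρ, hρ, x, hx⟩ := hc.exists_mem_ray (z := incl z) hyB hy.1
      (by rintro rfl; rw [incl_last] at hypos; exact lt_irrefl _ hypos) (by rw [incl_last]; exact hy0)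
    have hρ0 : 0 < ρ := one_pos.trans hρ
    have hxpos : 0 < F x (Fin.last n) := by
      rw [hx]
      simp only [PiLp.add_apply, PiLp.sub_apply, PiLp.smul_apply, smul_eq_mul, incl_last, sub_zero, zero_add]
      positivity
    have hNx := hc.cos_lt_normal_last hθ hM hxpos
    have hnorm : ‖ρ⁻¹ • N x‖ = ρ⁻¹ := by
      rw [norm_smul, hc.normal_unit, Real.norm_of_nonneg (by positivity), mul_one]
    refine ⟨ρ⁻¹ • N x, ⟨?_, ?_⟩, ?_⟩
    · rw [hnorm]
      exact inv_lt_one_of_one_lt₀ hρ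
    · rw [hnorm, PiLp.smul_apply, smul_eq_mul, mul_comm]
      gcongr
    · have e : capPoint θ (ρ⁻¹ • N x) = capGaussMap θ N x := by
        rw [capPoint, hnorm, smul_smul, inv_inv, mul_inv_cancel₀ hρ0.ne', one_smul]
        rfl
      rw [coneParam, e, hc.invFun_capGaussMap hθ hM, hnorm, hx, add_sub_cancel_left, smul_smul,
        inv_mul_cancel₀ hρ0.ne', one_smul, add_sub_cancel]
  rw [← measureReal_congr himage,
    measureReal_image_eq_integral_abs_det (isOpen_sector n θ).measurableSet hD hinj]
  refine setIntegral_congr_fun (isOpen_sector n θ).measurableSet fun y hy => ?_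
  have hpos := div_pos (hzpos _ (capPoint_mem_of_mem_sector hy))
    (hc.capGaussCurvature_pos (θ := θ) (capPoint θ y))
  rw [hdet y hy, abs_of_pos hpos]

end IsStrictlyConvexCapillary

end CapillaryFlow

end

/-! ### The envelope theorem and the evolution of the support function. -/

noncomputable section
set_option linter.unusedSectionVars false
namespace CapillaryFlow

open Filter Topology MeasureTheory

/-- The envelope theorem: the derivative of a maximum over a compact space at a time where the
maximizer is unique. -/
theorem hasDerivWithinAt_max {Z : Type*} [TopologicalSpace Z] [CompactSpace Z] {I : Set ℝ}
    (hI : Convex ℝ I) {φ φ' : ℝ → Z → ℝ}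
    (hφ : ContinuousOn (fun q : ℝ × Z => φ q.1 q.2) (I ×ˢ Set.univ))
    (hφ' : ContinuousOn (fun q : ℝ × Z => φ' q.1 q.2) (I ×ˢ Set.univ))
    (hder : ∀ t ∈ I, ∀ z, HasDerivWithinAt (fun t => φ t z) (φ' t z) I t) {t₀ : ℝ} (ht₀ : t₀ ∈ I)
    {z₀ : Z} (hmax : ∀ z, z ≠ z₀ → φ t₀ z < φ t₀ z₀) {m : ℝ → ℝ}
    (hm : ∀ t ∈ I, IsGreatest (Set.range (φ t)) (m t)) :
    HasDerivWithinAt m (φ' t₀ z₀) I t₀ := by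
  set c := φ' t₀ z₀
  have hm₀ : m t₀ = φ t₀ z₀ := by
    refine (hm t₀ ht₀).unique ⟨⟨z₀, rfl⟩, ?_⟩
    rintro _ ⟨z, rfl⟩
    rcases eq_or_ne z z₀ with rfl | h
    · exact le_rfl
    · exact (hmax z h).le
  rw [hasDerivWithinAt_iff_isLittleO, Asymptotics.isLittleO_iff]
  intro ε hε
  have h1 : ∀ᶠ q in 𝓝[I ×ˢ Set.univ] (t₀, z₀), dist (φ' q.1 q.2) c < ε :=
    (hφ' (t₀, z₀) ⟨ht₀, trivial⟩).eventually (Metric.ball_mem_nhds _ hε)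
  rw [nhdsWithin_prod_eq, nhdsWithin_univ, eventually_prod_iff] at h1
  obtain ⟨pA, hA, pW, hW, hAW⟩ := h1
  obtain ⟨δ, hδ, hball⟩ := Metric.mem_nhdsWithin_iff.mp hA
  obtain ⟨W, hWsub, hWo, hzW⟩ := mem_nhds_iff.mp hW
  -- By the mean value inequality, the increments of `φ · z` have slope `c` up to `ε`, uniformly for
  -- `z` near `z₀`.
  have hmean : ∀ t ∈ Metric.ball t₀ δ ∩ I, ∀ z ∈ W,
      |φ t z - φ t₀ z - (t - t₀) * c| ≤ ε * |t - t₀| := by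
    intro t ht z hz
    have hconv : Convex ℝ (Metric.ball t₀ δ ∩ I) := (convex_ball t₀ δ).inter hI
    have h2 := hconv.norm_image_sub_le_of_norm_hasDerivWithin_le (f := fun s => φ s z - s * c)
      (f' := fun s => φ' s z - c) (C := ε) (x := t₀) (y := t)
      (fun s hs => by
        have := ((hder s hs.2 z).mono Set.inter_subset_right).sub
          (((hasDerivAt_id s).mul_const c).hasDerivWithinAt (s := Metric.ball t₀ δ ∩ I))
        rw [one_mul] at this
        exact this)
      (fun s hs => by
        have := hAW (hball hs) (hWsub hz)
        rw [← dist_eq_norm]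
        exact this.le)
      ⟨Metric.mem_ball_self hδ, ht₀⟩ ht
    rw [Real.norm_eq_abs, Real.norm_eq_abs] at h2
    convert h2 using 2
    ring
  -- Away from `z₀` the maximum at `t₀` is missed strictly; compactness preserves this for nearby
  -- times and confines the maximizers to `W`.
  have hloc : ∀ᶠ t in 𝓝 t₀, ∀ z ∈ Wᶜ, t ∈ I → φ t z < φ t z₀ := by
    refine hWo.isClosed_compl.isCompact.eventually_forall_of_forall_eventually fun z hz => ?_
    have hne : z ≠ z₀ := fun h => hz (h ▸ hzW)
    have h3 : ContinuousOn (fun q : ℝ × Z => φ q.1 q.2 - φ q.1 z₀) (I ×ˢ Set.univ) :=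
      hφ.sub (hφ.comp (f := fun q : ℝ × Z => (q.1, z₀)) (by fun_prop) fun q hq => ⟨hq.1, trivial⟩)
    have h4 := (h3 (t₀, z) ⟨ht₀, trivial⟩).tendsto.eventually_lt_const
      (show φ t₀ z - φ t₀ z₀ < 0 by linarith [hmax z hne])
    rw [eventually_nhdsWithin_iff] at h4
    filter_upwards [h4] with q hq hqI
    linarith [hq ⟨hqI, trivial⟩]
  filter_upwards [nhdsWithin_le_nhds (Metric.ball_mem_nhds t₀ hδ), nhdsWithin_le_nhds hloc,
    self_mem_nhdsWithin] with t htb htloc htI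
  obtain ⟨⟨z, hz⟩, hub⟩ := hm t htI
  have hzW' : z ∈ W := by
    by_contra h
    have h5 := htloc z h htI
    have h6 := hub ⟨z₀, rfl⟩
    rw [hz] at h5
    exact absurd h6 (not_le.mpr h5)
  -- The maximizer `z` at time `t` bounds the increment of `m` from above, the fixed `z₀` bounds it
  -- from below.
  have hz1 := abs_le.mp (hmean t ⟨htb, htI⟩ z hzW')
  have hz2 := abs_le.mp (hmean t ⟨htb, htI⟩ z₀ hzW)
  have h7 : φ t₀ z ≤ m t₀ := (hm t₀ ht₀).2 ⟨z, rfl⟩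
  have h8 : φ t z₀ ≤ m t := hub ⟨z₀, rfl⟩
  rw [Real.norm_eq_abs, Real.norm_eq_abs, smul_eq_mul, abs_le]
  constructor <;> linarith

/-- The ray through a point of the cap determines the point. -/
theorem mul_ell_eq_sqrt {n : ℕ} {θ : ℝ} (hθ : θ ∈ Set.Ioo 0 (Real.pi / 2)) {ξ : Amb n}
    (hξ : ξ ∈ cap n θ) {k : ℝ} (hk : 0 < k) :
    k * ell n θ ξ = Real.sqrt ((Real.cos θ * inner ℝ (k • ξ) (eVec n)) ^ 2 +
      Real.sin θ ^ 2 * ‖k • ξ‖ ^ 2) := by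
  symm
  rw [Real.sqrt_eq_iff_eq_sq (by positivity) (mul_pos hk (ell_pos hθ hξ)).le]
  -- The equation of the cap. It turns `ℓ²` into a quadratic form in `ξ`, so that `k ℓ` depends on
  -- `k • ξ` alone.
  have h1 : ‖ξ‖ ^ 2 = Real.sin θ ^ 2 + 2 * (Real.cos θ * inner ℝ ξ (eVec n)) := by
    have h := hξ.2
    have h2 : ‖ξ - Real.cos θ • eVec n‖ ^ 2 = 1 := by rw [h]; norm_num
    rw [norm_sub_sq_real, inner_smul_right, norm_smul, norm_eVec, mul_one, Real.norm_eq_abs,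
      sq_abs] at h2
    nlinarith [Real.sin_sq_add_cos_sq θ]
  rw [inner_smul_left, norm_smul, mul_pow ‖k‖, h1, ell, Real.norm_eq_abs, sq_abs]
  simp only [conj_trivial]
  ring

namespace IsNormalizedFlow

variable {n : ℕ} [NeZero n] {M : Type*} [TopologicalSpace M] [CompactSpace M] [ConnectedSpace M]
  [ChartedSpace (EuclideanHalfSpace n) M] {θ : ℝ} {X ν : ℝ → M → Amb n}

/-- The inverse of the capillary Gauss map at time `t`. -/
abbrev gaussInv (θ : ℝ) (ν : ℝ → M → Amb n) (t : ℝ) : Amb n → M :=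
  Function.invFun (capGaussMap θ (ν t))

/-- At time zero only the velocity `w = K ξ` is known to be continuous. Since `K ℓ = K sin² θ + cos
θ ⟨w, e⟩` and `K ℓ` is the square root above, `K` is a continuous function of `w`. Dividing by it
then gives continuity of the normal. -/
theorem continuousOn_gaussCurvature (hf : IsNormalizedFlow θ X ν)
    (hθ : θ ∈ Set.Ioo 0 (Real.pi / 2)) (hM : ((𝓡∂ n).boundary M).Nonempty) :
    ContinuousOn (fun p : ℝ × M => gaussCurvature (X p.1) (ν p.1) p.2)
      (Set.Ici 0 ×ˢ Set.univ) := by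
  have hsin := sin_pos_of_mem hθ
  have hw := hf.continuous_speed
  set w : ℝ × M → Amb n := fun p =>
    gaussCurvature (X p.1) (ν p.1) p.2 • capGaussMap θ (ν p.1) p.2
  have hkey : ContinuousOn (fun p => (Real.sqrt ((Real.cos θ * inner ℝ (w p) (eVec n)) ^ 2 +
      Real.sin θ ^ 2 * ‖w p‖ ^ 2) - Real.cos θ * inner ℝ (w p) (eVec n)) / Real.sin θ ^ 2)
      (Set.Ici 0 ×ˢ Set.univ) := by
    have h1 : Continuous fun y : Amb n => (Real.sqrt ((Real.cos θ * inner ℝ y (eVec n)) ^ 2 +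
      Real.sin θ ^ 2 * ‖y‖ ^ 2) - Real.cos θ * inner ℝ y (eVec n)) / Real.sin θ ^ 2 := by
      fun_prop
    exact h1.comp_continuousOn hw
  refine hkey.congr fun p hp => ?_
  have hc := hf.capillary p.1 hp.1
  have hk := hc.gaussCurvature_pos p.2
  simp only [w]
  rw [← mul_ell_eq_sqrt hθ (hc.capGaussMap_mem hM p.2) hk, eq_div_iff (by positivity), ell,
    inner_smul_left]
  simp only [conj_trivial]
  ring

theorem continuousOn_capGaussMap (hf : IsNormalizedFlow θ X ν)
    (hθ : θ ∈ Set.Ioo 0 (Real.pi / 2)) (hM : ((𝓡∂ n).boundary M).Nonempty) :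
    ContinuousOn (fun p : ℝ × M => capGaussMap θ (ν p.1) p.2) (Set.Ici 0 ×ˢ Set.univ) := by
  have hpos : ∀ p ∈ (Set.Ici (0 : ℝ)) ×ˢ (Set.univ : Set M),
      gaussCurvature (X p.1) (ν p.1) p.2 ≠ 0 := fun p hp =>
    ((hf.capillary p.1 hp.1).gaussCurvature_pos p.2).ne'
  refine (((hf.continuousOn_gaussCurvature hθ hM).inv₀ hpos).smul hf.continuous_speed).congr
    fun p hp => ?_
  change _ = (gaussCurvature (X p.1) (ν p.1) p.2)⁻¹ •
    gaussCurvature (X p.1) (ν p.1) p.2 • capGaussMap θ (ν p.1) p.2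
  rw [smul_smul, inv_mul_cancel₀ (hpos p hp), one_smul]

theorem continuousOn_gaussInv (hf : IsNormalizedFlow θ X ν)
    (hθ : θ ∈ Set.Ioo 0 (Real.pi / 2)) (hM : ((𝓡∂ n).boundary M).Nonempty) :
    ContinuousOn (fun q : ℝ × Amb n => gaussInv θ ν q.1 q.2) (Set.Ici 0 ×ˢ cap n θ) :=
  continuousOn_family_inverse (g := fun t => capGaussMap θ (ν t)) (inv := gaussInv θ ν)
    (hf.continuousOn_capGaussMap hθ hM)
    (fun t ht _ hξ => (hf.capillary t ht).capGaussMap_invFun hθ hM hξ)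
    (fun t ht x => (hf.capillary t ht).invFun_capGaussMap hθ hM x)

theorem continuousOn_comp_gaussInv (hf : IsNormalizedFlow θ X ν)
    (hθ : θ ∈ Set.Ioo 0 (Real.pi / 2)) (hM : ((𝓡∂ n).boundary M).Nonempty) {E : Type*}
    [TopologicalSpace E] {g : ℝ → M → E}
    (hg : ContinuousOn (fun p : ℝ × M => g p.1 p.2) (Set.Ici 0 ×ˢ Set.univ)) :
    ContinuousOn (fun q : ℝ × Amb n => g q.1 (gaussInv θ ν q.1 q.2)) (Set.Ici 0 ×ˢ cap n θ) :=
  hg.comp (f := fun q : ℝ × Amb n => (q.1, gaussInv θ ν q.1 q.2))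
    (continuous_fst.continuousOn.prodMk (hf.continuousOn_gaussInv hθ hM))
    fun _ hq => ⟨hq.1, trivial⟩

theorem continuousOn_capGaussCurvature (hf : IsNormalizedFlow θ X ν)
    (hθ : θ ∈ Set.Ioo 0 (Real.pi / 2)) (hM : ((𝓡∂ n).boundary M).Nonempty) :
    ContinuousOn (fun q : ℝ × Amb n => capGaussCurvature θ (X q.1) (ν q.1) q.2)
      (Set.Ici 0 ×ˢ cap n θ) :=
  hf.continuousOn_comp_gaussInv hθ hM (g := fun t => gaussCurvature (X t) (ν t))
    (hf.continuousOn_gaussCurvature hθ hM)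

theorem continuousOn_supportFn (hf : IsNormalizedFlow θ X ν)
    (hθ : θ ∈ Set.Ioo 0 (Real.pi / 2)) (hM : ((𝓡∂ n).boundary M).Nonempty) :
    ContinuousOn (fun q : ℝ × Amb n => supportFn θ (Set.range (X q.1)) 0 q.2)
      (Set.Ici 0 ×ˢ cap n θ) := by
  have h1 := hf.continuousOn_comp_gaussInv hθ hM hf.continuous
  have h2 : ContinuousOn (fun q : ℝ × Amb n => capNormal n θ q.2) (Set.Ici 0 ×ˢ cap n θ) := by
    fun_prop
  refine (h2.inner h1).congr fun q hq => ?_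
  rw [(hf.capillary q.1 hq.1).supportFn_eq hθ hM 0 hq.2, sub_zero]

theorem continuous_gaussCurvature (hf : IsNormalizedFlow θ X ν)
    (hθ : θ ∈ Set.Ioo 0 (Real.pi / 2)) (hM : ((𝓡∂ n).boundary M).Nonempty) {t : ℝ} (ht : 0 ≤ t) :
    Continuous (gaussCurvature (X t) (ν t)) :=
  continuousOn_univ.mp ((hf.continuousOn_gaussCurvature hθ hM).comp (f := fun x : M => (t, x))
    (by fun_prop) fun _ _ => ⟨ht, trivial⟩)

/-- Evolution of the support function. -/
theorem hasDerivWithinAt_supportFn (hf : IsNormalizedFlow θ X ν)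
    (hθ : θ ∈ Set.Ioo 0 (Real.pi / 2)) (hM : ((𝓡∂ n).boundary M).Nonempty) {ξ : Amb n}
    (hξ : ξ ∈ cap n θ) {t : ℝ} (ht : 0 ≤ t) :
    HasDerivWithinAt (fun s => supportFn θ (Set.range (X s)) 0 ξ)
      (supportFn θ (Set.range (X t)) 0 ξ - capGaussCurvature θ (X t) (ν t) ξ * ell n θ ξ)
      (Set.Ici 0) t := by
  set N := capNormal n θ ξ
  have hc := hf.capillary t ht
  -- The support function is the maximum over `M` of `⟨N, X⟩`, with the unique maximizer `gaussInv θ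
  -- ν t ξ`. The envelope theorem avoids differentiating the inverse Gauss map in time and includes
  -- the right derivative at zero.
  have h := hasDerivWithinAt_max (Z := M) (convex_Ici (0 : ℝ))
    (φ := fun s x => inner ℝ N (X s x))
    (φ' := fun s x => inner ℝ N (X s x - gaussCurvature (X s) (ν s) x • capGaussMap θ (ν s) x))
    (ContinuousOn.inner continuousOn_const hf.continuous)
    (ContinuousOn.inner continuousOn_const (hf.continuous.sub hf.continuous_speed))
    (fun s hs x => by
      have := (hasDerivWithinAt_const (𝕜 := ℝ) s (Set.Ici 0) N).inner ℝ (hf.evolution s hs x)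
      simpa using this)
    ht (z₀ := gaussInv θ ν t ξ)
    (fun x hx => by
      have h1 := hc.inner_neg_of_ne hθ hM (x := gaussInv θ ν t ξ) (hc.mem_body x)
        (fun h => hx (hc.injective h))
      rw [hc.normal_invFun hθ hM hξ, inner_sub_right] at h1
      linarith)
    (m := fun s => supportFn θ (Set.range (X s)) 0 ξ)
    (fun s hs => by
      have hcs := hf.capillary s hs
      refine ⟨⟨gaussInv θ ν s ξ, ?_⟩, ?_⟩
      · simp only
        rw [hcs.supportFn_eq hθ hM 0 hξ, sub_zero]
      · rintro _ ⟨x, rfl⟩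
        have := hcs.inner_le_supportFn hθ hM 0 hξ x
        rwa [sub_zero] at this)
  convert h using 1
  rw [hc.supportFn_eq hθ hM 0 hξ, hc.capGaussMap_invFun hθ hM hξ, sub_zero, inner_sub_right,
    inner_smul_right, inner_capNormal_self hξ]
  rfl

end IsNormalizedFlow

end CapillaryFlow

end

/-! ### Generalized cross products and differentiability of the normal. -/

noncomputable section
set_option linter.unusedSectionVars false
namespace CapillaryFlow

open Filter Topology MeasureTheory

section CrossProduct

variable {n : ℕ}

/-- The generalized cross product of `n` vectors of `ℝⁿ⁺¹`. -/
def crossProd (Y : Fin n → Amb n) : Amb n :=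
  ∑ k, (sumBasis n).toBasis.det (famCons Y (sumBasis n k)) • sumBasis n k

theorem inner_crossProd (Y : Fin n → Amb n) (y : Amb n) :
    inner ℝ (crossProd Y) y = (sumBasis n).toBasis.det (famCons Y y) := by
  have hfam : ∀ y, famCons Y y = Function.update (famCons Y 0) (Sum.inr 0) y := fun y => by
    ext1 i
    rcases i with i | i
    · rw [Function.update_of_ne (by simp)]; rfl
    · rw [Subsingleton.elim i 0, Function.update_self]; rfl
  have hlin : (sumBasis n).toBasis.det (famCons Y y) =
      ∑ k, inner ℝ (sumBasis n k) y * (sumBasis n).toBasis.det (famCons Y (sumBasis n k)) := by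
    conv_lhs => rw [← (sumBasis n).sum_repr' y]
    rw [hfam, (sumBasis n).toBasis.det.map_update_sum]
    refine Finset.sum_congr rfl fun k _ => ?_
    rw [(sumBasis n).toBasis.det.map_update_smul, ← hfam, smul_eq_mul]
  rw [hlin, crossProd, sum_inner]
  refine Finset.sum_congr rfl fun k _ => ?_
  rw [inner_smul_left, mul_comm]
  rfl

/-- The remainder `y = W - ⟨W, ν⟩ ν` of the cross product `W` is orthogonal to `ν`, so the Gram
identity gives `⟨W, ν⟩ ⟨W, y⟩ = 0`; hence `y` is orthogonal to both `W` and `ν`, and vanishes. -/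
theorem crossProd_eq_smul {Y : Fin n → Amb n} {ν : Amb n} (hν : ‖ν‖ = 1)
    (hY : ∀ j, inner ℝ ν (Y j) = 0) (h0 : inner ℝ (crossProd Y) ν ≠ 0) :
    crossProd Y = (inner ℝ (crossProd Y) ν : ℝ) • ν := by
  set a : ℝ := inner ℝ (crossProd Y) ν
  set y := crossProd Y - a • ν
  have hνy : inner ℝ ν y = 0 := by
    rw [inner_sub_right, inner_smul_right, real_inner_self_eq_norm_sq, hν, real_inner_comm]
    simp [a]
  have h1 := det_famCons_mul_det_famCons Y Y ν y hY
  rw [hνy, mul_zero, ← inner_crossProd, ← inner_crossProd] at h1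
  have h2 : inner ℝ (crossProd Y) y = 0 := (mul_eq_zero.mp h1).resolve_left h0
  have h3 : inner ℝ y y = 0 := by
    nth_rw 1 [show y = crossProd Y - a • ν from rfl]
    rw [inner_sub_left, inner_smul_left, h2, hνy, mul_zero, sub_zero]
  exact sub_eq_zero.mp (inner_self_eq_zero.mp h3)

theorem sq_inner_crossProd {Y : Fin n → Amb n} {ν : Amb n} (hν : ‖ν‖ = 1)
    (hY : ∀ j, inner ℝ ν (Y j) = 0) :
    (inner ℝ (crossProd Y) ν) ^ 2 = (Matrix.of fun i j => inner ℝ (Y i) (Y j)).det := by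
  have h1 := det_famCons_mul_det_famCons Y Y ν ν hY
  rw [real_inner_self_eq_norm_sq, hν, ← inner_crossProd] at h1
  linarith

theorem DifferentiableAt.crossProd {E : Type*} [NormedAddCommGroup E] [NormedSpace ℝ E]
    {Y : Fin n → E → Amb n} {q : E} (h : ∀ i, DifferentiableAt ℝ (Y i) q) :
    DifferentiableAt ℝ (fun q => crossProd fun i => Y i q) q := by
  have hfam : ∀ k i, DifferentiableAt ℝ (fun q => famCons (fun i => Y i q) (sumBasis n k) i) q := by
    rintro k (i | i)
    · exact h i
    · exact differentiableAt_const _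
  unfold CapillaryFlow.crossProd
  refine DifferentiableAt.fun_sum fun k _ => DifferentiableAt.smul_const ?_ _
  simp only [Module.Basis.det_apply, Matrix.det_apply, Module.Basis.toMatrix_apply,
    OrthonormalBasis.coe_toBasis_repr_apply, OrthonormalBasis.repr_apply_apply]
  refine DifferentiableAt.fun_sum fun σ _ => DifferentiableAt.const_smul ?_ _
  have hent : ∀ i j, DifferentiableAt ℝ (fun q => (inner ℝ (sumBasis n j)
      (famCons (fun i => Y i q) (sumBasis n k) i) : ℝ)) q := fun i j =>
    (differentiableAt_const _).inner ℝ (hfam k i)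
  fun_prop

end CrossProduct

/-- A continuous unit normal of a differentiably varying family of hyperplanes is
differentiable. -/
theorem differentiableAt_normal_of_orthogonal {n : ℕ} {E : Type*} [NormedAddCommGroup E]
    [NormedSpace ℝ E] {Y : Fin n → E → Amb n} {ν : E → Amb n} {q₀ : E}
    (hY : ∀ i, DifferentiableAt ℝ (Y i) q₀) (hν : ContinuousAt ν q₀)
    (hν1 : ∀ᶠ q in 𝓝 q₀, ‖ν q‖ = 1) (horth : ∀ᶠ q in 𝓝 q₀, ∀ j, inner ℝ (ν q) (Y j q) = 0)
    (hdet : (Matrix.of fun i j => inner ℝ (Y i q₀) (Y j q₀)).det ≠ 0) :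
    DifferentiableAt ℝ ν q₀ := by
  set W : E → Amb n := fun q => crossProd fun i => Y i q
  have hW : DifferentiableAt ℝ W q₀ := DifferentiableAt.crossProd hY
  set a : ℝ := inner ℝ (W q₀) (ν q₀)
  have ha : a ≠ 0 := fun h => hdet (by
    rw [← sq_inner_crossProd (Y := fun i => Y i q₀) hν1.self_of_nhds horth.self_of_nhds]
    exact pow_eq_zero_iff two_ne_zero |>.mpr h)
  have hpos : ∀ᶠ q in 𝓝 q₀, 0 < a * inner ℝ (W q) (ν q) := by
    have : ContinuousAt (fun q => a * inner ℝ (W q) (ν q)) q₀ :=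
      continuousAt_const.mul (hW.continuousAt.inner hν)
    exact this.eventually (lt_mem_nhds (mul_self_pos.mpr ha))
  -- The cross product is a multiple of `ν` of either sign; the factor `a`, its coefficient at `q₀`,
  -- corrects the sign nearby. So `ν` is the normalization of a differentiable nonvanishing field.
  have heq : ν =ᶠ[𝓝 q₀] fun q => ‖a • W q‖⁻¹ • (a • W q) := by
    filter_upwards [hν1, horth, hpos] with q h1 h2 h3
    have h4 : inner ℝ (W q) (ν q) ≠ 0 := fun h => by rw [h, mul_zero] at h3; exact lt_irrefl _ h3
    have h5 : W q = (inner ℝ (W q) (ν q) : ℝ) • ν q := crossProd_eq_smul h1 h2 h4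
    have h6 : a • W q = (a * inner ℝ (W q) (ν q)) • ν q := by
      conv_lhs => rw [h5]
      rw [smul_smul]
    rw [h6, norm_smul, h1, mul_one, Real.norm_of_nonneg h3.le, smul_smul, inv_mul_cancel₀ h3.ne',
      one_smul]
  refine DifferentiableAt.congr_of_eventuallyEq ?_ heq
  have hne : a • W q₀ ≠ 0 := by
    refine smul_ne_zero ha fun h => ha ?_
    simp only [a, h, inner_zero_left]
  exact (((hW.const_smul a).norm ℝ hne).inv (norm_ne_zero_iff.mpr hne)).smul (hW.const_smul a)

section JointChart

variable {n : ℕ} [NeZero n] {M : Type*} [TopologicalSpace M] [CompactSpace M] [ConnectedSpace M]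
  [ChartedSpace (EuclideanHalfSpace n) M] {θ : ℝ} {X ν : ℝ → M → Amb n}

theorem target_mem_nhds {x₀ : M} (hint : (𝓡∂ n).IsInteriorPoint x₀) :
    (extChartAt (𝓡∂ n) x₀).target ∈ 𝓝 (extChartAt (𝓡∂ n) x₀ x₀) := by
  have h1 := extChartAt_target_mem_nhdsWithin (I := 𝓡∂ n) x₀
  have h2 : Set.range (𝓡∂ n) ∈ 𝓝 (extChartAt (𝓡∂ n) x₀ x₀) := mem_interior_iff_mem_nhds.mp hint
  rwa [nhdsWithin_eq_nhds.mpr h2] at h1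

variable [IsManifold (𝓡∂ n) ∞ M]

theorem IsNormalizedFlow.contDiffOn_chart (hf : IsNormalizedFlow θ X ν) (x₀ : M) :
    ContDiffOn ℝ ∞ (fun q : ℝ × EuclideanSpace ℝ (Fin n) =>
      X q.1 ((extChartAt (𝓡∂ n) x₀).symm q.2))
      (Set.Ioi 0 ×ˢ (extChartAt (𝓡∂ n) x₀).target) := by
  rw [← contMDiffOn_iff_contDiffOn]
  have h1 : ContMDiffOn 𝓘(ℝ, ℝ × EuclideanSpace ℝ (Fin n)) 𝓘(ℝ, ℝ) ∞
      (Prod.fst : ℝ × EuclideanSpace ℝ (Fin n) → ℝ)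
      (Set.Ioi 0 ×ˢ (extChartAt (𝓡∂ n) x₀).target) := contDiff_fst.contMDiff.contMDiffOn
  have h2 : ContMDiffOn 𝓘(ℝ, ℝ × EuclideanSpace ℝ (Fin n)) 𝓘(ℝ, EuclideanSpace ℝ (Fin n)) ∞
      (Prod.snd : ℝ × EuclideanSpace ℝ (Fin n) → _)
      (Set.Ioi 0 ×ˢ (extChartAt (𝓡∂ n) x₀).target) := contDiff_snd.contMDiff.contMDiffOn
  have h3 := (contMDiffOn_extChartAt_symm (I := 𝓡∂ n) (n := ∞) x₀).comp h2 fun q hq => hq.2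
  exact hf.smooth.comp (h1.prodMk h3) fun q hq => ⟨hq.1, trivial⟩

/-- The hypothesis on the normal refers to the preferred chart at each point. The chain rule
transfers the orthogonality to the fixed chart at `x₀`, at points other than its centre. -/
theorem inner_fderiv_chart_eq_zero {F N : M → Amb n} (hc : IsStrictlyConvexCapillary θ F N)
    {x₀ : M} {v : EuclideanSpace ℝ (Fin n)}
    (hv : (extChartAt (𝓡∂ n) x₀).target ∈ 𝓝 v) {L : EuclideanSpace ℝ (Fin n) →L[ℝ] Amb n}
    (hL : HasFDerivAt (fun v => F ((extChartAt (𝓡∂ n) x₀).symm v)) L v)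
    (w : EuclideanSpace ℝ (Fin n)) :
    inner ℝ (N ((extChartAt (𝓡∂ n) x₀).symm v)) (L w) = 0 := by
  have h1 : MDifferentiableAt 𝓘(ℝ, EuclideanSpace ℝ (Fin n)) (𝓡∂ n)
      (extChartAt (𝓡∂ n) x₀).symm v :=
    ((contMDiffOn_extChartAt_symm (I := 𝓡∂ n) (n := ∞) x₀).contMDiffAt hv).mdifferentiableAt
      (by simp)
  have h2 := (hc.mdifferentiableAt ((extChartAt (𝓡∂ n) x₀).symm v)).hasMFDerivAt.comp v
    h1.hasMFDerivAt
  have h3 := hasMFDerivAt_unique h2 hL.hasMFDerivAt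
  rw [← h3]
  exact hc.normal_orthogonal _ _

end JointChart

end CapillaryFlow

end

/-! ### The sweeping map of the rescaled flow and its Jacobian. -/

noncomputable section
set_option linter.unusedSectionVars false
namespace CapillaryFlow

open Filter Topology MeasureTheory

namespace IsNormalizedFlow

variable {n : ℕ} [NeZero n] {M : Type*} [TopologicalSpace M] [CompactSpace M] [ConnectedSpace M]
  [ChartedSpace (EuclideanHalfSpace n) M] {θ : ℝ} {X ν : ℝ → M → Amb n}

/-- The map that sweeps out the region between two rescaled bodies of the flow: the point
`exp (-t) • ν` goes to `exp (-t)` times the point of the hypersurface at time `t` with normal `ν`. -/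
def sweep (θ : ℝ) (X ν : ℝ → M → Amb n) (y : Amb n) : Amb n :=
  ‖y‖ • X (-Real.log ‖y‖) (gaussInv θ ν (-Real.log ‖y‖) (capPoint θ y))

theorem neg_log_norm_pos {y : Amb n} (hy : y ∈ sector n θ) : 0 < -Real.log ‖y‖ := by
  have := Real.log_neg (norm_pos_of_mem_sector hy) hy.1
  linarith

theorem continuousAt_gaussInv_sector (hf : IsNormalizedFlow θ X ν)
    (hθ : θ ∈ Set.Ioo 0 (Real.pi / 2)) (hM : ((𝓡∂ n).boundary M).Nonempty) {y : Amb n}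
    (hy : y ∈ sector n θ) :
    ContinuousAt (fun y => gaussInv θ ν (-Real.log ‖y‖) (capPoint θ y)) y := by
  have h1 : ContinuousOn (fun y : Amb n => (-Real.log ‖y‖, capPoint θ y)) (sector n θ) := by
    intro y hy
    have h2 : ContinuousAt (fun y : Amb n => -Real.log ‖y‖) y :=
      ((Real.continuousAt_log (norm_pos_of_mem_sector hy).ne').comp
        continuous_norm.continuousAt).neg
    exact (h2.prodMk (continuousAt_capPoint (ne_zero_of_mem_sector hy))).continuousWithinAt
  have h3 := (hf.continuousOn_gaussInv hθ hM).comp h1 fun y (hy : y ∈ sector n θ) =>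
    ⟨(neg_log_norm_pos hy).le, capPoint_mem_of_mem_sector hy⟩
  exact h3.continuousAt ((isOpen_sector n θ).mem_nhds hy)

variable [IsManifold (𝓡∂ n) ∞ M]

/-- Joint differentiability of the position and the normal in a chart, for positive times. -/
theorem exists_hasFDerivAt_chart (hf : IsNormalizedFlow θ X ν)
    (hθ : θ ∈ Set.Ioo 0 (Real.pi / 2)) (hM : ((𝓡∂ n).boundary M).Nonempty) {t : ℝ} (ht : 0 < t)
    {x₀ : M} (hint : (𝓡∂ n).IsInteriorPoint x₀) :
    ∃ L L' : ℝ × EuclideanSpace ℝ (Fin n) →L[ℝ] Amb n,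
      HasFDerivAt (fun q : ℝ × EuclideanSpace ℝ (Fin n) =>
        X q.1 ((extChartAt (𝓡∂ n) x₀).symm q.2)) L (t, extChartAt (𝓡∂ n) x₀ x₀) ∧
      HasFDerivAt (fun q : ℝ × EuclideanSpace ℝ (Fin n) =>
        ν q.1 ((extChartAt (𝓡∂ n) x₀).symm q.2)) L' (t, extChartAt (𝓡∂ n) x₀ x₀) ∧
      (∀ v, L (0, v) = tangentMapAt (X t) x₀ v) ∧
      L (1, 0) = X t x₀ - gaussCurvature (X t) (ν t) x₀ • capGaussMap θ (ν t) x₀ ∧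
      (∀ v, L' (0, v) = tangentMapAt (ν t) x₀ v) ∧ inner ℝ (ν t x₀) (L' (1, 0)) = 0 := by
  have hc := hf.capillary t ht.le
  set φ := extChartAt (𝓡∂ n) x₀
  have hO : φ.target ∈ 𝓝 (φ x₀) := target_mem_nhds hint
  have hinv : φ.symm (φ x₀) = x₀ := extChartAt_to_inv x₀
  set p : ℝ × EuclideanSpace ℝ (Fin n) := (t, φ x₀)
  set Xc : ℝ × EuclideanSpace ℝ (Fin n) → Amb n := fun q => X q.1 (φ.symm q.2)
  set νc : ℝ × EuclideanSpace ℝ (Fin n) → Amb n := fun q => ν q.1 (φ.symm q.2)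
  have hsm := hf.contDiffOn_chart x₀
  have hnhds : Set.Ioi (0 : ℝ) ×ˢ φ.target ∈ 𝓝 p := prod_mem_nhds (Ioi_mem_nhds ht) hO
  have hev : ∀ᶠ q in 𝓝 p, Set.Ioi (0 : ℝ) ×ˢ φ.target ∈ 𝓝 q := eventually_mem_nhds_iff.mpr hnhds
  have hcd : ContDiffAt ℝ ∞ Xc p := hsm.contDiffAt hnhds
  have hdiff : ∀ q, Set.Ioi (0 : ℝ) ×ˢ φ.target ∈ 𝓝 q → DifferentiableAt ℝ Xc q := fun q hq =>
    (hsm.contDiffAt hq).differentiableAt (by simp)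
  have hslice : ∀ (G : ℝ × EuclideanSpace ℝ (Fin n) → Amb n) G' (q : ℝ × EuclideanSpace ℝ (Fin n)),
      HasFDerivAt G G' q → HasFDerivAt (fun v => G (q.1, v))
        (G' ∘L ContinuousLinearMap.inr ℝ ℝ (EuclideanSpace ℝ (Fin n))) q.2 := by
    intro G G' q h
    exact HasFDerivAt.comp q.2 (f := fun v => (q.1, v)) (g := G) h (hasFDerivAt_prodMk_right q.1 q.2)
  set L := fderiv ℝ Xc p
  have hL : HasFDerivAt Xc L p := (hdiff p hnhds).hasFDerivAt
  have hL0 : ∀ v, L (0, v) = tangentMapAt (X t) x₀ v := fun v => by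
    have h := (hslice Xc L p hL).unique
      (hasFDerivAt_comp_extChartAt_symm (hc.mdifferentiableAt x₀) hint)
    exact DFunLike.congr_fun h v
  have hL1 : L (1, 0) = X t x₀ - gaussCurvature (X t) (ν t) x₀ • capGaussMap θ (ν t) x₀ := by
    have h1 := (HasFDerivAt.comp t (f := fun s => (s, φ x₀)) (g := Xc) hL
      (hasFDerivAt_prodMk_left t (φ x₀))).hasDerivAt
    have h2 := (hf.evolution t ht.le x₀).hasDerivAt (Ici_mem_nhds ht)
    have e : Xc ∘ (fun s => (s, φ x₀)) = fun s => X s x₀ := by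
      ext1 s
      simp only [Xc, Function.comp, hinv]
    rw [e] at h1
    exact h1.unique h2
  -- These chart derivatives of `X` span the tangent spaces and vary differentiably. The normal, so
  -- far only jointly continuous, thereby becomes jointly differentiable.
  set Y : Fin n → ℝ × EuclideanSpace ℝ (Fin n) → Amb n :=
    fun i q => fderiv ℝ Xc q (0, EuclideanSpace.single i 1)
  have hYp : ∀ i, Y i p = tangentMapAt (X t) x₀ (EuclideanSpace.single i 1) := fun i => hL0 _
  have hYd : ∀ i, DifferentiableAt ℝ (Y i) p := fun i =>
    ((hcd.fderiv_right (m := ∞) le_rfl).differentiableAt (by simp)).clm_apply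
      (differentiableAt_const _)
  have hνcont : ContinuousAt νc p := by
    have h1 : ContinuousAt (fun q : ℝ × M => capGaussMap θ (ν q.1) q.2) (t, x₀) :=
      (hf.continuousOn_capGaussMap hθ hM).continuousAt
        (prod_mem_nhds (Ici_mem_nhds ht) univ_mem)
    have h2 : ContinuousAt (fun q : ℝ × EuclideanSpace ℝ (Fin n) => (q.1, φ.symm q.2)) p :=
      continuousAt_fst.prodMk (ContinuousAt.comp (g := φ.symm)
        (f := (Prod.snd : ℝ × EuclideanSpace ℝ (Fin n) → _)) (continuousAt_extChartAt_symm x₀)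
        continuousAt_snd)
    have h3 : ContinuousAt (fun q : ℝ × EuclideanSpace ℝ (Fin n) =>
        capGaussMap θ (ν q.1) (φ.symm q.2)) p := by
      refine ContinuousAt.comp (f := fun q : ℝ × EuclideanSpace ℝ (Fin n) => (q.1, φ.symm q.2))
        (g := fun q : ℝ × M => capGaussMap θ (ν q.1) q.2) ?_ h2
      simpa only [p, hinv] using h1
    refine (h3.sub (continuousAt_const (y := Real.cos θ • eVec n))).congr
      (Eventually.of_forall fun q => ?_)
    exact add_sub_cancel_right _ _
  have hν1 : ∀ᶠ q in 𝓝 p, ‖νc q‖ = 1 := by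
    filter_upwards [hnhds] with q hq
    exact (hf.capillary q.1 (le_of_lt hq.1)).normal_unit _
  have horth : ∀ᶠ q in 𝓝 p, ∀ j, inner ℝ (νc q) (Y j q) = 0 := by
    filter_upwards [hev] with q hq j
    have hq0 : 0 < q.1 := (mem_of_mem_nhds hq).1
    have hq2 : φ.target ∈ 𝓝 q.2 := by
      rw [nhds_prod_eq, prod_mem_prod_iff] at hq
      exact hq.2
    exact inner_fderiv_chart_eq_zero (hf.capillary q.1 hq0.le) hq2
      (hslice Xc _ q (hdiff q hq).hasFDerivAt) _
  have hνd : DifferentiableAt ℝ νc p := by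
    refine differentiableAt_normal_of_orthogonal hYd hνcont hν1 horth ?_
    simp only [hYp]
    exact (hc.det_first_pos x₀).ne'
  refine ⟨L, fderiv ℝ νc p, hL, hνd.hasFDerivAt, hL0, hL1, fun v => ?_, ?_⟩
  · have h := (hslice νc _ p hνd.hasFDerivAt).unique
      (hasFDerivAt_comp_extChartAt_symm (hc.mdifferentiableAt_normal x₀) hint)
    exact DFunLike.congr_fun h v
  · have h1 := (hasStrictFDerivAt_norm_sq (νc p)).hasFDerivAt.comp p hνd.hasFDerivAt
    have h2 : (fun y => ‖y‖ ^ 2) ∘ νc =ᶠ[𝓝 p] fun _ => (1 : ℝ) := by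
      filter_upwards [hν1] with q hq
      simp [hq]
    have h3 := h1.unique ((hasFDerivAt_const (1 : ℝ) p).congr_of_eventuallyEq h2)
    have h4 := DFunLike.congr_fun h3 (1, 0)
    have h5 : νc p = ν t x₀ := by simp only [νc, p, hinv]
    simpa [h5] using h4

/-- In the coordinates `(t, x)` the source is `exp (-t) ν` and the image is `exp (-t) X`. The
derivative `D` sends `dν` to `dX` and, from the time direction, `∂ₜν - ν` to `∂ₜX - X = -K ξ`. Since
`∂ₜν` is tangential, the determinant formula gives `D.det * K = ⟨ν, K ξ⟩ = K ℓ`, and the curvature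
cancels. -/
theorem exists_hasFDerivAt_sweep (hf : IsNormalizedFlow θ X ν)
    (hθ : θ ∈ Set.Ioo 0 (Real.pi / 2)) (hM : ((𝓡∂ n).boundary M).Nonempty) {y : Amb n}
    (hy : y ∈ sector n θ) : ∃ D : Amb n →L[ℝ] Amb n, HasFDerivAt (sweep θ X ν) D y ∧
      D.det = ell n θ (capPoint θ y) := by
  set t := -Real.log ‖y‖
  have ht : 0 < t := neg_log_norm_pos hy
  have hr : 0 < ‖y‖ := norm_pos_of_mem_sector hy
  have hexp : ∀ y' ∈ sector n θ, Real.exp (-(-Real.log ‖y'‖)) = ‖y'‖ := fun y' hy' => by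
    rw [neg_neg, Real.exp_log (norm_pos_of_mem_sector hy')]
  have hc := hf.capillary t ht.le
  set x₀ := gaussInv θ ν t (capPoint θ y)
  have hcap := capPoint_mem_of_mem_sector hy
  have hint : (𝓡∂ n).IsInteriorPoint x₀ := hc.isInteriorPoint_of_pos (hc.last_pos_of_mem_sector hθ hM hy)
  obtain ⟨L, L', hL, hL', hLv, hL1, hLv', hL1'⟩ := hf.exists_hasFDerivAt_chart hθ hM ht hint
  set φ := extChartAt (𝓡∂ n) x₀
  obtain ⟨c, hcφ⟩ : ∃ c : EuclideanSpace ℝ (Fin n) → M, φ.symm = c := ⟨_, rfl⟩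
  have hinv : c (φ x₀) = x₀ := hcφ ▸ extChartAt_to_inv x₀
  rw [hcφ] at hL hL'
  set p : ℝ × EuclideanSpace ℝ (Fin n) := (t, φ x₀)
  have hfst : HasFDerivAt (fun q : ℝ × EuclideanSpace ℝ (Fin n) => Real.exp (-q.1))
      (Real.exp (-p.1) • -ContinuousLinearMap.fst ℝ ℝ (EuclideanSpace ℝ (Fin n))) p :=
    (hasFDerivAt_fst (p := p)).neg.exp
  have hQ := hfst.smul hL'
  have hP := hfst.smul hL
  have hcont := hf.continuousAt_gaussInv_sector hθ hM hy
  have hsrc : ∀ᶠ y' in 𝓝 y, gaussInv θ ν (-Real.log ‖y'‖) (capPoint θ y') ∈ φ.source :=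
    hcont.eventually (extChartAt_source_mem_nhds (I := 𝓡∂ n) x₀)
  refine Exists.elim (exists_hasFDerivAt_of_param (Ψ := sweep θ X ν) (y₀ := y)
    (R := fun y' => (-Real.log ‖y'‖, φ (gaussInv θ ν (-Real.log ‖y'‖) (capPoint θ y'))))
    hQ hP ?_ ?_ rfl ?_ ?_) fun D hDD => ?_
  · refine (injective_iff_map_eq_zero _).mpr ?_
    rintro ⟨a, v⟩ h
    have e : ((a, v) : ℝ × EuclideanSpace ℝ (Fin n)) = a • (1, 0) + (0, v) := by simp
    have h1 : Real.exp (-t) • (a • L' (1, 0) + tangentMapAt (ν t) x₀ v) -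
        (Real.exp (-t) * a) • ν t x₀ = 0 := by
      rw [← hLv' v, ← map_smul, ← map_add, ← e, ← h]
      simp [p, hinv, sub_eq_add_neg]
    have h2 := congrArg (fun w => inner ℝ (ν t x₀) w) h1
    simp only [inner_sub_right, inner_add_right, inner_smul_right, hL1',
      hc.inner_normal_tangentMapAt_normal, real_inner_self_eq_norm_sq, hc.normal_unit,
      inner_zero_right] at h2
    have hexp0 := Real.exp_pos (-t)
    have ha : a = 0 := by
      have : Real.exp (-t) * a = 0 := by linarith
      exact (mul_eq_zero.mp this).resolve_left hexp0.ne'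
    rw [ha, zero_smul, zero_add, mul_zero, zero_smul, sub_zero, smul_eq_zero] at h1
    have hv : v = 0 := (injective_iff_map_eq_zero _).mp (hc.injective_tangentMapAt_normal x₀) v
      (h1.resolve_left hexp0.ne')
    rw [ha, hv]; rfl
  · have h1 : ContinuousAt (fun y : Amb n => -Real.log ‖y‖) y :=
      ((Real.continuousAt_log hr.ne').comp continuous_norm.continuousAt).neg
    exact h1.prodMk (ContinuousAt.comp (g := φ)
      (f := fun y => gaussInv θ ν (-Real.log ‖y‖) (capPoint θ y))
      (continuousAt_extChartAt x₀) hcont)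
  · filter_upwards [hsrc, (isOpen_sector n θ).mem_nhds hy] with y' hy' hy's
    change Real.exp (-(-Real.log ‖y'‖)) • ν _ (c (φ _)) = y'
    rw [show c (φ _) = _ from hcφ ▸ φ.left_inv hy', hexp y' hy's,
      (hf.capillary _ (neg_log_norm_pos hy's).le).normal_invFun_capPoint hθ hM hy's, smul_smul,
      mul_inv_cancel₀ (norm_pos_of_mem_sector hy's).ne', one_smul]
  · filter_upwards [hsrc, (isOpen_sector n θ).mem_nhds hy] with y' hy' hy's
    change sweep θ X ν y' = Real.exp (-(-Real.log ‖y'‖)) • X _ (c (φ _))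
    rw [show c (φ _) = _ from hcφ ▸ φ.left_inv hy', hexp y' hy's]
    rfl
  · obtain ⟨hD, hDw⟩ := hDD
    have hexp0 := (Real.exp_pos (-t)).ne'
    have e1 : ∀ v, D (tangentMapAt (ν t) x₀ v) = tangentMapAt (X t) x₀ v := fun v => by
      have := hDw (0, v)
      simpa [p, hexp0, hLv, hLv'] using this
    have e2 : D (ν t x₀ + -L' (1, 0)) =
        gaussCurvature (X t) (ν t) x₀ • capGaussMap θ (ν t) x₀ := by
      have h1 := hDw (1, 0)
      have h2 : Real.exp (-t) • D (L' (1, 0) - ν t x₀) = Real.exp (-t) • (L (1, 0) - X t x₀) := by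
        have h3 : Real.exp (-t) • (L' (1, 0) - ν t x₀) = (Real.exp (-t)) • L' (1, 0) +
          (-Real.exp (-t)) • ν t x₀ := by module
        rw [← map_smul, h3]
        have h4 : Real.exp (-t) • (L (1, 0) - X t x₀) = (Real.exp (-t)) • L (1, 0) +
          (-Real.exp (-t)) • X t x₀ := by module
        rw [h4]
        simpa [p, hinv] using h1
      have h3 := smul_right_injective _ hexp0 h2
      have h4 : ν t x₀ + -L' (1, 0) = -(L' (1, 0) - ν t x₀) := by abel
      rw [h4, map_neg, h3, hL1]
      abel
    have h5 := hc.det_mul_gaussCurvature x₀ D e1 (by rw [inner_neg_right, hL1', neg_zero]) e2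
    rw [inner_smul_right, mul_comm] at h5
    refine ⟨D, hD, mul_left_cancel₀ (hc.gaussCurvature_pos x₀).ne' (h5.trans ?_)⟩
    rw [← capNormal_capGaussMap θ (ν t) x₀, inner_capNormal_self (hc.capGaussMap_mem hM x₀),
      hc.capGaussMap_invFun hθ hM hcap]

end IsNormalizedFlow

end CapillaryFlow

end

/-! ### Conservation of the enclosed volume. -/

noncomputable section
open scoped Pointwise
set_option linter.unusedSectionVars false
namespace CapillaryFlow

open Filter Topology MeasureTheory

theorem eventually_forall_pos_of_continuousOn {α β : Type*} [TopologicalSpace α]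
    [TopologicalSpace β] {I : Set α} {C : Set β} (hC : IsCompact C) {f : α × β → ℝ}
    (hf : ContinuousOn f (I ×ˢ C)) {t : α} (ht : t ∈ I) (hpos : ∀ ξ ∈ C, 0 < f (t, ξ)) :
    ∀ᶠ s in 𝓝[I] t, ∀ ξ ∈ C, 0 < f (s, ξ) := by
  have h1 : ∀ᶠ s in 𝓝 t, ∀ ξ ∈ C, s ∈ I → 0 < f (s, ξ) := by
    have : ∀ᶠ s in 𝓝 t, ∀ ξ ∈ C, ξ ∈ C → s ∈ I → 0 < f (s, ξ) := by
      refine hC.eventually_forall_of_forall_eventually fun ξ hξ => ?_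
      have h2 := (hf (t, ξ) ⟨ht, hξ⟩).tendsto.eventually_const_lt (hpos ξ hξ)
      rw [eventually_nhdsWithin_iff] at h2
      filter_upwards [h2] with q hq h3 h4 using hq ⟨h4, h3⟩
    filter_upwards [this] with s hs ξ hξ using hs ξ hξ hξ
  rw [eventually_nhdsWithin_iff]
  filter_upwards [h1] with s hs hsI ξ hξ using hs ξ hξ hsI

namespace IsNormalizedFlow

variable {n : ℕ} [NeZero n] {M : Type*} [TopologicalSpace M] [CompactSpace M] [ConnectedSpace M]
  [ChartedSpace (EuclideanHalfSpace n) M] {θ : ℝ} {X ν : ℝ → M → Amb n}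

/-- The support function of the rescaled hypersurface `exp (-t) • X t`. -/
def scaledSupport (θ : ℝ) (X : ℝ → M → Amb n) (t : ℝ) (ξ : Amb n) : ℝ :=
  Real.exp (-t) * supportFn θ (Set.range (X t)) 0 ξ

theorem continuousOn_scaledSupport (hf : IsNormalizedFlow θ X ν)
    (hθ : θ ∈ Set.Ioo 0 (Real.pi / 2)) (hM : ((𝓡∂ n).boundary M).Nonempty) :
    ContinuousOn (fun q : ℝ × Amb n => scaledSupport θ X q.1 q.2) (Set.Ici 0 ×ˢ cap n θ) :=
  (by fun_prop : Continuous fun q : ℝ × Amb n => Real.exp (-q.1)).continuousOn.mul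
    (hf.continuousOn_supportFn hθ hM)

/-- The derivative is `-exp (-t) K ℓ < 0`, so the rescaled bodies shrink strictly in every direction
of the cap. -/
theorem strictAntiOn_scaledSupport (hf : IsNormalizedFlow θ X ν)
    (hθ : θ ∈ Set.Ioo 0 (Real.pi / 2)) (hM : ((𝓡∂ n).boundary M).Nonempty) {ξ : Amb n}
    (hξ : ξ ∈ cap n θ) : StrictAntiOn (fun t => scaledSupport θ X t ξ) (Set.Ici 0) := by
  refine strictAntiOn_of_deriv_neg (convex_Ici 0) ?_ fun t ht => ?_
  · exact (hf.continuousOn_scaledSupport hθ hM).comp (f := fun t => (t, ξ)) (by fun_prop)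
      fun t ht => ⟨ht, hξ⟩
  · rw [interior_Ici] at ht
    have h1 := (hf.hasDerivWithinAt_supportFn hθ hM hξ (le_of_lt ht)).hasDerivAt (Ici_mem_nhds ht)
    have h2 := ((hasDerivAt_id t).neg.exp).mul h1
    have h3 : HasDerivAt (fun t => scaledSupport θ X t ξ) _ t := h2
    rw [h3.deriv]
    have h4 := mul_pos (Real.exp_pos (-t)) (mul_pos
      ((hf.capillary t (le_of_lt ht)).capGaussCurvature_pos (θ := θ) ξ) (ell_pos hθ hξ))
    simp only [id, Pi.neg_apply]
    linarith

/-- Membership in the rescaled body, by the support function. -/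
theorem exp_smul_mem_body_iff (hf : IsNormalizedFlow θ X ν)
    (hθ : θ ∈ Set.Ioo 0 (Real.pi / 2)) (hM : ((𝓡∂ n).boundary M).Nonempty) {t : ℝ} (ht : 0 ≤ t)
    {y : Amb n} (hy : y ∈ halfSpace n) : Real.exp t • y ∈ body (Set.range (X t)) ↔
      ∀ ξ ∈ cap n θ, inner ℝ (capNormal n θ ξ) y ≤ scaledSupport θ X t ξ := by
  have hc := hf.capillary t ht
  have hy' : Real.exp t • y ∈ halfSpace n := by
    rw [mem_halfSpace_iff, PiLp.smul_apply, smul_eq_mul]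
    exact mul_nonneg (Real.exp_pos t).le hy
  have key : ∀ x, inner ℝ (ν t x) (Real.exp t • y - X t x) ≤ 0 ↔
      inner ℝ (ν t x) y ≤ scaledSupport θ X t (capGaussMap θ (ν t) x) := fun x => by
    have h := hc.supportFn_eq_of_normal 0 x (capNormal_capGaussMap θ (ν t) x).symm
    rw [capNormal_capGaussMap, sub_zero] at h
    rw [scaledSupport, h, inner_sub_right, inner_smul_right, Real.exp_neg, sub_nonpos,
      le_inv_mul_iff₀ (Real.exp_pos t)]
  rw [hc.mem_body_iff hy']
  constructor
  · intro h ξ hξ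
    have h1 := (key _).mp (h (Function.invFun (capGaussMap θ (ν t)) ξ))
    rwa [hc.normal_invFun hθ hM hξ, hc.capGaussMap_invFun hθ hM hξ] at h1
  · intro h x
    refine (key x).mpr ?_
    have h1 := h _ (hc.capGaussMap_mem hM x)
    rwa [capNormal_capGaussMap] at h1

theorem exp_smul_sweep {y : Amb n} (hy : y ∈ sector n θ) :
    Real.exp (-Real.log ‖y‖) • sweep θ X ν y =
      X (-Real.log ‖y‖) (gaussInv θ ν (-Real.log ‖y‖) (capPoint θ y)) := by
  have h := norm_pos_of_mem_sector hy
  rw [sweep, smul_smul, Real.exp_neg, Real.exp_log h, inv_mul_cancel₀ h.ne', one_smul]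

theorem sweep_mem_halfSpace (hf : IsNormalizedFlow θ X ν) {y : Amb n} (hy : y ∈ sector n θ) :
    sweep θ X ν y ∈ halfSpace n := by
  rw [mem_halfSpace_iff, sweep, PiLp.smul_apply, smul_eq_mul]
  exact mul_nonneg (norm_nonneg _)
    ((hf.capillary _ (neg_log_norm_pos hy).le).mem_halfSpace _)

theorem inner_sweep (hf : IsNormalizedFlow θ X ν)
    (hθ : θ ∈ Set.Ioo 0 (Real.pi / 2)) (hM : ((𝓡∂ n).boundary M).Nonempty) {y : Amb n}
    (hy : y ∈ sector n θ) : inner ℝ (capNormal n θ (capPoint θ y)) (sweep θ X ν y) =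
      scaledSupport θ X (-Real.log ‖y‖) (capPoint θ y) := by
  rw [scaledSupport, (hf.capillary _ (neg_log_norm_pos hy).le).supportFn_eq hθ hM 0
    (capPoint_mem_of_mem_sector hy), sub_zero, sweep, inner_smul_right, neg_neg,
    Real.exp_log (norm_pos_of_mem_sector hy)]

theorem inner_sweep_le (hf : IsNormalizedFlow θ X ν)
    (hθ : θ ∈ Set.Ioo 0 (Real.pi / 2)) (hM : ((𝓡∂ n).boundary M).Nonempty) {y : Amb n}
    (hy : y ∈ sector n θ) {ξ : Amb n} (hξ : ξ ∈ cap n θ) :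
    inner ℝ (capNormal n θ ξ) (sweep θ X ν y) ≤ scaledSupport θ X (-Real.log ‖y‖) ξ := by
  refine (hf.exp_smul_mem_body_iff hθ hM (neg_log_norm_pos hy).le
    (hf.sweep_mem_halfSpace hy)).mp ?_ ξ hξ
  rw [exp_smul_sweep hy]
  exact (hf.capillary _ (neg_log_norm_pos hy).le).mem_body _

/-- The swept point at one time attains the rescaled support function in its own normal direction,
and at every later time this function is strictly smaller, so different times give different points.
At equal times, embeddedness determines the parameter and hence the normal. -/
theorem injOn_sweep (hf : IsNormalizedFlow θ X ν)
    (hθ : θ ∈ Set.Ioo 0 (Real.pi / 2)) (hM : ((𝓡∂ n).boundary M).Nonempty) :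
    Set.InjOn (sweep θ X ν) (sector n θ) := by
  have aux : ∀ y₁ ∈ sector n θ, ∀ y₂ ∈ sector n θ, -Real.log ‖y₁‖ < -Real.log ‖y₂‖ →
      sweep θ X ν y₁ ≠ sweep θ X ν y₂ := by
    intro y₁ hy₁ y₂ hy₂ hlt h
    have hξ := capPoint_mem_of_mem_sector hy₁
    have h1 := hf.inner_sweep_le hθ hM hy₂ hξ
    rw [← h, hf.inner_sweep hθ hM hy₁] at h1
    exact h1.not_gt (hf.strictAntiOn_scaledSupport hθ hM hξ (neg_log_norm_pos hy₁).le
      (neg_log_norm_pos hy₂).le hlt)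
  intro y₁ hy₁ y₂ hy₂ h
  have hlog : -Real.log ‖y₁‖ = -Real.log ‖y₂‖ := by
    rcases lt_trichotomy (-Real.log ‖y₁‖) (-Real.log ‖y₂‖) with hlt | heq | hlt
    · exact (aux _ hy₁ _ hy₂ hlt h).elim
    · exact heq
    · exact (aux _ hy₂ _ hy₁ hlt h.symm).elim
  have hn : ‖y₁‖ = ‖y₂‖ := Real.log_injOn_pos (norm_pos_of_mem_sector hy₁)
    (norm_pos_of_mem_sector hy₂) (neg_injective hlog)
  have h2 := congrArg (fun y => Real.exp (-Real.log ‖y₁‖) • y) h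
  rw [exp_smul_sweep hy₁, hn, exp_smul_sweep hy₂] at h2
  have hc := hf.capillary _ (neg_log_norm_pos hy₂).le
  have h3 := congrArg (ν (-Real.log ‖y₂‖)) (hc.injective h2)
  rw [hc.normal_invFun_capPoint hθ hM hy₂, ← hn] at h3
  have hc' := hf.capillary _ (neg_log_norm_pos hy₁).le
  rw [hc'.normal_invFun_capPoint hθ hM hy₁] at h3
  exact smul_right_injective _ (inv_ne_zero (norm_pos_of_mem_sector hy₁).ne') h3

/-- For a point `y` of the difference, let `τ` be the last time at which it belongs to the rescaled
body. It must then lie on the rescaled hypersurface: otherwise it is interior, and by compactness of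
the cap it stays in the body a little longer. -/
theorem sweep_image_ae_eq (hf : IsNormalizedFlow θ X ν)
    (hθ : θ ∈ Set.Ioo 0 (Real.pi / 2)) (hM : ((𝓡∂ n).boundary M).Nonempty) {T : ℝ} (hT : 0 < T) :
    sweep θ X ν '' (sector n θ \ Metric.closedBall 0 (Real.exp (-T))) =ᵐ[volume]
      (body (Set.range (X 0)) \ Real.exp (-T) • body (Set.range (X T)) : Set (Amb n)) := by
  have hc0 := hf.capillary 0 le_rfl
  have hTmem : ∀ y, y ∈ Real.exp (-T) • body (Set.range (X T)) ↔
      Real.exp T • y ∈ body (Set.range (X T)) := fun y => by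
    rw [Set.mem_smul_set_iff_inv_smul_mem₀ (Real.exp_pos _).ne', Real.exp_neg, inv_inv]
  have h0mem : ∀ y ∈ halfSpace n, y ∈ body (Set.range (X 0)) ↔
      ∀ ξ ∈ cap n θ, inner ℝ (capNormal n θ ξ) y ≤ scaledSupport θ X 0 ξ := fun y hy => by
    rw [← hf.exp_smul_mem_body_iff hθ hM le_rfl hy, Real.exp_zero, one_smul]
  refine EventuallyLE.antisymm (LE.le.eventuallyLE ?_) ?_
  · rintro _ ⟨y, ⟨hy, hyr⟩, rfl⟩
    have ht := neg_log_norm_pos hy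
    have htT : -Real.log ‖y‖ < T := by
      rw [mem_closedBall_zero_iff, not_le] at hyr
      have := Real.log_lt_log (Real.exp_pos _) hyr
      rw [Real.log_exp] at this
      linarith
    refine ⟨(h0mem _ (hf.sweep_mem_halfSpace hy)).mpr fun ξ hξ => ?_, fun h => ?_⟩
    · exact (hf.inner_sweep_le hθ hM hy hξ).trans
        (hf.strictAntiOn_scaledSupport hθ hM hξ Set.self_mem_Ici ht.le ht).le
    · rw [hTmem, hf.exp_smul_mem_body_iff hθ hM hT.le (hf.sweep_mem_halfSpace hy)] at h
      have hξ := capPoint_mem_of_mem_sector hy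
      have h1 := h _ hξ
      rw [hf.inner_sweep hθ hM hy] at h1
      exact h1.not_gt (hf.strictAntiOn_scaledSupport hθ hM hξ ht.le hT.le htT)
  · filter_upwards [hc0.ae_notMem_range] with y hy hyB
    have hy0 : y ∈ halfSpace n := body_subset_halfSpace hc0.range_subset hyB.1
    have hypos : 0 < y (Fin.last n) := lt_of_le_of_ne hy0 (Ne.symm hy.2)
    set J : Set ℝ := Set.Icc 0 T ∩ ⋂ ξ ∈ cap n θ,
      {t | t ∈ Set.Icc 0 T ∧ inner ℝ (capNormal n θ ξ) y ≤ scaledSupport θ X t ξ}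
    have hJmem : ∀ t, t ∈ J ↔ t ∈ Set.Icc 0 T ∧
        ∀ ξ ∈ cap n θ, inner ℝ (capNormal n θ ξ) y ≤ scaledSupport θ X t ξ := fun t => by
      simp only [J, Set.mem_inter_iff, Set.mem_iInter, Set.mem_ofPred_eq]
      exact ⟨fun h => ⟨h.1, fun ξ hξ => (h.2 ξ hξ).2⟩, fun h => ⟨h.1, fun ξ hξ => ⟨h.1, h.2 ξ hξ⟩⟩⟩
    have hJc : IsCompact J := by
      refine isCompact_Icc.inter_right (isClosed_biInter fun ξ hξ => ?_)
      refine isClosed_Icc.isClosed_le continuousOn_const ?_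
      exact (hf.continuousOn_scaledSupport hθ hM).comp (f := fun t => (t, ξ)) (by fun_prop)
        fun t ht => ⟨ht.1, hξ⟩
    have h0J : (0 : ℝ) ∈ J := (hJmem 0).mpr ⟨⟨le_rfl, hT.le⟩, (h0mem y hy0).mp hyB.1⟩
    have hτJ := hJc.sSup_mem ⟨0, h0J⟩
    set τ := sSup J
    obtain ⟨⟨hτ0, hτT⟩, hτ⟩ := (hJmem τ).mp hτJ
    have hτT' : τ < T := by
      refine lt_of_le_of_ne hτT fun h => hyB.2 ?_
      rw [hTmem, hf.exp_smul_mem_body_iff hθ hM hT.le hy0, ← h]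
      exact hτ
    have hc := hf.capillary τ hτ0
    have hτB := (hf.exp_smul_mem_body_iff hθ hM hτ0 hy0).mpr hτ
    have hlast : 0 < (Real.exp τ • y) (Fin.last n) := by
      rw [PiLp.smul_apply, smul_eq_mul]
      exact mul_pos (Real.exp_pos τ) hypos
    obtain ⟨x, hx⟩ : Real.exp τ • y ∈ Set.range (X τ) := by
      by_contra hnot
      have hint := mem_interior_body hc.isCompact_range.isClosed hc.range_subset hnot hτB hlast
      have hstrict : ∀ ξ ∈ cap n θ,
          0 < scaledSupport θ X τ ξ - inner ℝ (capNormal n θ ξ) y := fun ξ hξ => by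
        have h1 := hc.inner_neg_of_mem_interior hint (Function.invFun (capGaussMap θ (ν τ)) ξ)
        have h2 := hc.supportFn_eq hθ hM 0 hξ
        rw [hc.normal_invFun hθ hM hξ, inner_sub_right, inner_smul_right] at h1
        rw [scaledSupport, h2, sub_zero, sub_pos, Real.exp_neg, lt_inv_mul_iff₀ (Real.exp_pos τ)]
        linarith
      have hev := eventually_forall_pos_of_continuousOn (isCompact_cap n θ)
        (f := fun q : ℝ × Amb n => scaledSupport θ X q.1 q.2 - inner ℝ (capNormal n θ q.2) y)
        ((hf.continuousOn_scaledSupport hθ hM).sub (by fun_prop)) hτ0 hstrict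
      have hev' : ∀ᶠ s in 𝓝[>] τ, ∀ ξ ∈ cap n θ,
          0 < scaledSupport θ X s ξ - inner ℝ (capNormal n θ ξ) y :=
        hev.filter_mono (nhdsWithin_mono τ fun s hs => hτ0.trans (le_of_lt hs))
      obtain ⟨s, hs, hsτ, hsT⟩ := (hev'.and (Ioo_mem_nhdsGT hτT')).exists
      have hsJ : s ∈ J := (hJmem s).mpr ⟨⟨hτ0.trans hsτ.le, hsT.le⟩,
        fun ξ hξ => (sub_pos.mp (hs ξ hξ)).le⟩
      exact (le_csSup hJc.bddAbove hsJ).not_gt hsτ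
    have hτpos : 0 < τ := by
      refine lt_of_le_of_ne hτ0 fun h => hy.1 ⟨x, ?_⟩
      rw [h, hx, ← h, Real.exp_zero, one_smul]
    have hnorm : ‖Real.exp (-τ) • ν τ x‖ = Real.exp (-τ) := by
      rw [norm_smul, hc.normal_unit, Real.norm_of_nonneg (Real.exp_pos _).le, mul_one]
    have hNx := hc.cos_lt_normal_last hθ hM (x := x) (by rw [hx]; exact hlast)
    refine ⟨Real.exp (-τ) • ν τ x, ⟨⟨?_, ?_⟩, ?_⟩, ?_⟩
    · rw [hnorm, Real.exp_lt_one_iff]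
      linarith
    · rw [hnorm, PiLp.smul_apply, smul_eq_mul, mul_comm]
      exact mul_lt_mul_of_pos_left hNx (Real.exp_pos _)
    · rw [mem_closedBall_zero_iff, hnorm, not_le, Real.exp_lt_exp]
      linarith
    · have e : capPoint θ (Real.exp (-τ) • ν τ x) = capGaussMap θ (ν τ) x := by
        rw [capPoint, hnorm, smul_smul, inv_mul_cancel₀ (Real.exp_pos _).ne', one_smul]
        rfl
      rw [sweep, e, hnorm, Real.log_exp, neg_neg,
        show gaussInv θ ν τ (capGaussMap θ (ν τ) x) = x from hc.invFun_capGaussMap hθ hM x, hx, smul_smul,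
        ← Real.exp_add, neg_add_cancel, Real.exp_zero, one_smul]

variable [IsManifold (𝓡∂ n) ∞ M]

/-- The flow preserves the volume of the unit spherical cap. -/
theorem volume_body_eq_cap (hf : IsNormalizedFlow θ X ν)
    (hθ : θ ∈ Set.Ioo 0 (Real.pi / 2)) (hM : ((𝓡∂ n).boundary M).Nonempty)
    (hvol : volume (body (Set.range (X 0))) = volume (body (cap n θ))) {t : ℝ} (ht : 0 ≤ t) :
    volume.real (body (Set.range (X t))) = volume.real (body (cap n θ)) := by
  have hvol' : volume.real (body (Set.range (X 0))) = volume.real (body (cap n θ)) := by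
    rw [measureReal_def, hvol, measureReal_def]
  rcases ht.eq_or_lt with rfl | ht
  · exact hvol'
  have hc0 := hf.capillary 0 le_rfl
  have hct := hf.capillary t ht.le
  set r := Real.exp (-t)
  have hr : 0 < r := Real.exp_pos _
  have hr1 : r ≤ 1 := Real.exp_le_one_iff.mpr (by linarith)
  choose! D hD hdet using fun y (hy : y ∈ sector n θ) => hf.exists_hasFDerivAt_sweep hθ hM hy
  have hA : MeasurableSet (sector n θ \ Metric.closedBall (0 : Amb n) r) :=
    (isOpen_sector n θ).measurableSet.diff Metric.isClosed_closedBall.measurableSet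
  -- The volume lost between the times `0` and `t` is the integral of the Jacobian `ℓ` over the
  -- shell `exp (-t) < ‖y‖ < 1` of the sector. By homogeneity that integral is `1 - exp (-(n + 1)
  -- t)` times the volume enclosed by the cap.
  have h1 := measureReal_image_eq_integral_abs_det hA (fun y hy => hD y hy.1)
    ((hf.injOn_sweep hθ hM).mono Set.sdiff_subset)
  rw [measureReal_congr (hf.sweep_image_ae_eq hθ hM ht), setIntegral_congr_fun hA
    (g := fun y => ell n θ (capPoint θ y)) fun y hy => by
      simp only [hdet y hy.1, abs_of_pos (ell_pos hθ (capPoint_mem_of_mem_sector hy.1))]] at h1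
  have hsub : r • body (Set.range (X t)) ⊆ body (Set.range (X 0)) := by
    rintro _ ⟨y, hy, rfl⟩
    have hyH : y ∈ halfSpace n := body_subset_halfSpace hct.range_subset hy
    have hryH : r • y ∈ halfSpace n := by
      rw [mem_halfSpace_iff, PiLp.smul_apply, smul_eq_mul]
      exact mul_nonneg hr.le hyH
    have h2 : ∀ ξ ∈ cap n θ, inner ℝ (capNormal n θ ξ) (r • y) ≤ scaledSupport θ X t ξ := by
      rw [← hf.exp_smul_mem_body_iff hθ hM ht.le hryH, smul_smul, ← Real.exp_add, add_neg_cancel,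
        Real.exp_zero, one_smul]
      exact hy
    have h3 := (hf.exp_smul_mem_body_iff hθ hM le_rfl hryH).mpr fun ξ hξ =>
      (h2 ξ hξ).trans (hf.strictAntiOn_scaledSupport hθ hM hξ Set.self_mem_Ici ht.le ht).le
    rwa [Real.exp_zero, one_smul] at h3
  have hmeas : MeasurableSet (r • body (Set.range (X t))) :=
    (hct.isCompact_body.smul r).isClosed.measurableSet
  rw [measureReal_sdiff hsub hmeas hc0.isCompact_body.measure_lt_top.ne] at h1
  have hscale : volume.real (r • body (Set.range (X t))) =
      r ^ (n + 1) * volume.real (body (Set.range (X t))) := by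
    rw [measureReal_def, Measure.addHaar_smul, ENNReal.toReal_mul, finrank_euclideanSpace,
      Fintype.card_fin, ENNReal.toReal_ofReal (abs_nonneg _), abs_of_pos (by positivity),
      measureReal_def]
  have hint : IntegrableOn (fun y => ell n θ (capPoint θ y)) (sector n θ) := by
    have h2 := integrable_of_continuousOn (continuous_ell n θ).continuousOn (θ := θ)
    rw [capMeasure_eq hθ, integrable_smul_measure (by simp) (by simp),
      integrable_map_measure (continuous_ell n θ).aestronglyMeasurable
        measurable_capPoint.aemeasurable] at h2
    exact h2
  have hsplit : ∫ y in sector n θ \ Metric.closedBall 0 r, ell n θ (capPoint θ y) =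
      (∫ y in sector n θ, ell n θ (capPoint θ y)) -
        ∫ y in sector n θ ∩ Metric.ball 0 r, ell n θ (capPoint θ y) := by
    have h2 : (sector n θ ∩ Metric.ball 0 r : Set (Amb n)) =ᵐ[volume]
        (sector n θ ∩ Metric.closedBall 0 r : Set (Amb n)) := by
      refine (ae_eq_refl _).inter ?_
      rw [← Metric.sphere_union_ball]
      have h3 : Metric.sphere (0 : Amb n) r =ᵐ[volume] (∅ : Set (Amb n)) :=
        ae_eq_empty.mpr (Measure.addHaar_sphere volume 0 r)
      have h4 := h3.union (ae_eq_refl (Metric.ball (0 : Amb n) r))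
      rw [Set.empty_union] at h4
      exact h4.symm
    rw [setIntegral_congr_set h2, eq_sub_iff_add_eq, add_comm]
    exact integral_inter_add_sdiff Metric.isClosed_closedBall.measurableSet hint
  rw [hscale, hsplit, integral_sector_ell hθ, integral_sector_inter_ball_ell hθ hr hr1,
    hvol'] at h1
  have h2 : r ^ (n + 1) * volume.real (body (Set.range (X t))) =
      r ^ (n + 1) * volume.real (body (cap n θ)) := by linarith
  exact mul_left_cancel₀ (by positivity) h2

/-- The normalization identity: the integral of `U ℓ / K` is that of `ℓ`. -/
theorem integral_supportFn_div (hf : IsNormalizedFlow θ X ν)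
    (hθ : θ ∈ Set.Ioo 0 (Real.pi / 2)) (hM : ((𝓡∂ n).boundary M).Nonempty)
    (hvol : volume (body (Set.range (X 0))) = volume (body (cap n θ))) {t : ℝ} (ht : 0 ≤ t)
    {z : EuclideanSpace ℝ (Fin n)} (hz : z ∈ interior (flatPart (body (Set.range (X t))))) :
    ∫ ξ, supportFn θ (Set.range (X t)) (incl z) ξ / capGaussCurvature θ (X t) (ν t) ξ
      ∂capMeasure n θ = ∫ ξ, ell n θ ξ ∂capMeasure n θ := by
  rw [(hf.capillary t ht).volume_body_eq hθ hM (hf.continuous_gaussCurvature hθ hM ht) hz,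
    hf.volume_body_eq_cap hθ hM hvol ht, integral_ell hθ]

end IsNormalizedFlow

end CapillaryFlow

end

/-! ### Integrals with parameters, and strict concavity in the base point. -/

noncomputable section
set_option linter.unusedSectionVars false
namespace CapillaryFlow

open Filter Topology MeasureTheory

section ParametricIntegral

variable {n : ℕ} {θ : ℝ}

theorem continuousOn_slice {α : Type*} [TopologicalSpace α] {I : Set α} {G : α × Amb n → ℝ}
    (hG : ContinuousOn G (I ×ˢ cap n θ)) {t : α} (ht : t ∈ I) :
    ContinuousOn (fun ξ => G (t, ξ)) (cap n θ) :=
  hG.comp (f := fun ξ => (t, ξ)) (by fun_prop) fun _ hξ => ⟨ht, hξ⟩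

theorem eventually_abs_sub_lt {α : Type*} [TopologicalSpace α] {I : Set α}
    {G : α × Amb n → ℝ} (hG : ContinuousOn G (I ×ˢ cap n θ)) {t : α} (ht : t ∈ I) {ε : ℝ}
    (hε : 0 < ε) : ∀ᶠ s in 𝓝[I] t, ∀ ξ ∈ cap n θ, |G (s, ξ) - G (t, ξ)| < ε := by
  have h1 : ContinuousOn (fun q : α × Amb n => ε - |G q - G (t, q.2)|) (I ×ˢ cap n θ) :=
    continuousOn_const.sub (hG.sub ((continuousOn_slice hG ht).comp continuousOn_snd
      fun q hq => hq.2)).abs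
  filter_upwards [eventually_forall_pos_of_continuousOn (isCompact_cap n θ) h1 ht
    fun ξ _ => by simpa using hε] with s hs ξ hξ
  exact sub_pos.mp (hs ξ hξ)

theorem abs_integral_le {g : Amb n → ℝ} {C : ℝ} (hC : ∀ ξ ∈ cap n θ, |g ξ| ≤ C) :
    |∫ ξ, g ξ ∂capMeasure n θ| ≤ C * (capMeasure n θ).real Set.univ := by
  rw [← Real.norm_eq_abs]
  refine norm_integral_le_of_norm_le_const ?_
  filter_upwards [ae_mem_cap n θ] with ξ hξ
  exact hC ξ hξ

theorem exists_pos_mul_le {ε : ℝ} (hε : 0 < ε) (c : ℝ) : ∃ δ > 0, δ * c ≤ ε := by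
  refine ⟨ε / (|c| + 1), by positivity, ?_⟩
  have h : c ≤ |c| + 1 := by linarith [le_abs_self c]
  calc ε / (|c| + 1) * c ≤ ε / (|c| + 1) * (|c| + 1) := by gcongr
    _ = ε := by field_simp

theorem continuousOn_integral_cap {α : Type*} [TopologicalSpace α] {I : Set α}
    {G : α × Amb n → ℝ} (hG : ContinuousOn G (I ×ˢ cap n θ)) :
    ContinuousOn (fun t => ∫ ξ, G (t, ξ) ∂capMeasure n θ) I := by
  intro t ht
  refine Metric.tendsto_nhds.mpr fun ε hε => ?_
  obtain ⟨δ, hδ, hδε⟩ := exists_pos_mul_le (half_pos hε) ((capMeasure n θ).real Set.univ)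
  filter_upwards [eventually_abs_sub_lt hG ht hδ, self_mem_nhdsWithin] with s hs hsI
  rw [Real.dist_eq, ← integral_sub (integrable_of_continuousOn (continuousOn_slice hG hsI))
    (integrable_of_continuousOn (continuousOn_slice hG ht))]
  have := abs_integral_le fun ξ hξ => (hs ξ hξ).le
  linarith

/-- Differentiation under the integral over the cap, within a convex set of times. -/
theorem hasDerivWithinAt_integral_cap {I : Set ℝ} (hI : Convex ℝ I) {G G' : ℝ × Amb n → ℝ}
    (hG : ContinuousOn G (I ×ˢ cap n θ)) (hG' : ContinuousOn G' (I ×ˢ cap n θ))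
    (hder : ∀ t ∈ I, ∀ ξ ∈ cap n θ, HasDerivWithinAt (fun s => G (s, ξ)) (G' (t, ξ)) I t)
    {t : ℝ} (ht : t ∈ I) :
    HasDerivWithinAt (fun s => ∫ ξ, G (s, ξ) ∂capMeasure n θ)
      (∫ ξ, G' (t, ξ) ∂capMeasure n θ) I t := by
  rw [hasDerivWithinAt_iff_isLittleO, Asymptotics.isLittleO_iff]
  intro ε hε
  obtain ⟨η, hη, hηε⟩ := exists_pos_mul_le hε ((capMeasure n θ).real Set.univ)
  obtain ⟨δ, hδ, hball⟩ := Metric.mem_nhdsWithin_iff.mp (eventually_abs_sub_lt hG' ht hη)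
  filter_upwards [inter_mem_nhdsWithin I (Metric.ball_mem_nhds t hδ)] with s hs
  have hmean : ∀ ξ ∈ cap n θ, |G (s, ξ) - G (t, ξ) - (s - t) * G' (t, ξ)| ≤ η * |s - t| := by
    intro ξ hξ
    have h2 := ((convex_ball t δ).inter hI).norm_image_sub_le_of_norm_hasDerivWithin_le
      (f := fun s => G (s, ξ) - s * G' (t, ξ))
      (f' := fun s => G' (s, ξ) - G' (t, ξ)) (C := η) (x := t) (y := s)
      (fun r hr => by
        have := ((hder r hr.2 ξ hξ).mono Set.inter_subset_right).sub
          (((hasDerivAt_id r).mul_const (G' (t, ξ))).hasDerivWithinAt (s := Metric.ball t δ ∩ I))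
        rw [one_mul] at this
        exact this)
      (fun r hr => (hball hr ξ hξ).le) ⟨Metric.mem_ball_self hδ, ht⟩ ⟨hs.2, hs.1⟩
    rw [Real.norm_eq_abs, Real.norm_eq_abs] at h2
    convert h2 using 2
    ring
  have i1 := integrable_of_continuousOn (continuousOn_slice hG hs.1)
  have i2 := integrable_of_continuousOn (continuousOn_slice hG ht)
  have i3 := (integrable_of_continuousOn (continuousOn_slice hG' ht)).const_mul (s - t)
  have h3 := abs_integral_le hmean
  rw [integral_sub (f := fun ξ => G (s, ξ) - G (t, ξ)) (i1.sub i2) i3, integral_sub i1 i2,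
    integral_const_mul] at h3
  rw [smul_eq_mul, Real.norm_eq_abs, Real.norm_eq_abs]
  refine h3.trans ?_
  rw [mul_right_comm]
  gcongr

end ParametricIntegral

/-- The integral whose supremum over the base points is, up to normalization, the entropy. -/
def logIntegral {n : ℕ} (θ : ℝ) (S : Set (Amb n)) (z : EuclideanSpace ℝ (Fin n)) : ℝ :=
  ∫ ξ, Real.log (capSupportFn θ S (incl z) ξ) * ell n θ ξ ∂capMeasure n θ

theorem entropyAt_eq {n : ℕ} (θ : ℝ) (S : Set (Amb n)) (z : EuclideanSpace ℝ (Fin n)) :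
    entropyAt θ S z = 1 / omega n θ * logIntegral θ S z := rfl

theorem smul_incl_mem_cap {n : ℕ} {θ : ℝ} {d : EuclideanSpace ℝ (Fin n)} (hd : ‖d‖ = 1) :
    Real.sin θ • incl d ∈ cap n θ := by
  refine ⟨?_, ?_⟩
  · rw [← incl_smul]
    exact incl_mem_halfSpace _
  · have h1 : ‖Real.sin θ • incl d - Real.cos θ • eVec n‖ ^ 2 = 1 := by
      rw [norm_sub_sq_real, norm_smul, norm_smul, norm_incl, hd, norm_eVec, inner_smul_left,
        inner_smul_right, inner_eVec, incl_last]
      simp [Real.sin_sq_add_cos_sq]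
    exact (pow_eq_one_iff_of_nonneg (norm_nonneg _) two_ne_zero).mp h1

/-- The horizontal directions are separated by the normals of the cap. -/
theorem exists_mem_cap_inner_incl_pos {n : ℕ} {θ : ℝ} (hθ : θ ∈ Set.Ioo 0 (Real.pi / 2))
    {v : EuclideanSpace ℝ (Fin n)} (hv : v ≠ 0) :
    ∃ ξ ∈ cap n θ, 0 < inner ℝ (capNormal n θ ξ) (incl v) := by
  have hv' := norm_pos_iff.mpr hv
  refine ⟨_, smul_incl_mem_cap (d := ‖v‖⁻¹ • v) ?_, ?_⟩
  · rw [norm_smul, norm_inv, norm_norm, inv_mul_cancel₀ hv'.ne']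
  · rw [inner_capNormal_incl, incl_smul, inner_smul_left, inner_smul_left,
      real_inner_self_eq_norm_sq, norm_incl]
    have := sin_pos_of_mem hθ
    simp only [conj_trivial]
    positivity

namespace IsStrictlyConvexCapillary

variable {n : ℕ} [NeZero n] {M : Type*} [TopologicalSpace M] [CompactSpace M] [ConnectedSpace M]
  [ChartedSpace (EuclideanHalfSpace n) M] {θ : ℝ} {F N : M → Amb n}

theorem supportFn_incl (hc : IsStrictlyConvexCapillary θ F N)
    (hθ : θ ∈ Set.Ioo 0 (Real.pi / 2)) (hM : ((𝓡∂ n).boundary M).Nonempty)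
    (z w : EuclideanSpace ℝ (Fin n)) {ξ : Amb n} (hξ : ξ ∈ cap n θ) :
    supportFn θ (Set.range F) (incl (z + w)) ξ = supportFn θ (Set.range F) (incl z) ξ -
      inner ℝ (capNormal n θ ξ) (incl w) := by
  rw [hc.supportFn_sub hθ hM _ hξ, hc.supportFn_sub hθ hM (incl z) hξ, incl_add, inner_add_right]
  ring

theorem capSupportFn_pos (hc : IsStrictlyConvexCapillary θ F N)
    (hθ : θ ∈ Set.Ioo 0 (Real.pi / 2)) (hM : ((𝓡∂ n).boundary M).Nonempty)
    {z : EuclideanSpace ℝ (Fin n)} (hz : z ∈ interior (flatPart (body (Set.range F)))) {ξ : Amb n}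
    (hξ : ξ ∈ cap n θ) : 0 < capSupportFn θ (Set.range F) (incl z) ξ :=
  div_pos ((hc.mem_interior_flatPart_iff_supportFn_pos hθ hM).mp hz ξ hξ) (ell_pos hθ hξ)

theorem continuousOn_log_mul_ell (hc : IsStrictlyConvexCapillary θ F N)
    (hθ : θ ∈ Set.Ioo 0 (Real.pi / 2)) (hM : ((𝓡∂ n).boundary M).Nonempty) :
    ContinuousOn (fun q : EuclideanSpace ℝ (Fin n) × Amb n =>
        Real.log (capSupportFn θ (Set.range F) (incl q.1) q.2) * ell n θ q.2)
      (interior (flatPart (body (Set.range F))) ×ˢ cap n θ) := by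
  have h1 : ContinuousOn (fun q : EuclideanSpace ℝ (Fin n) × Amb n =>
      supportFn θ (Set.range F) (incl q.1) q.2)
      (interior (flatPart (body (Set.range F))) ×ˢ cap n θ) := by
    have h2 : ContinuousOn (fun q : EuclideanSpace ℝ (Fin n) × Amb n =>
        supportFn θ (Set.range F) 0 q.2 - inner ℝ (capNormal n θ q.2) (incl q.1))
        (interior (flatPart (body (Set.range F))) ×ˢ cap n θ) := by
      refine ((hc.continuousOn_supportFn hθ hM 0).comp continuousOn_snd fun q hq => hq.2).sub ?_
      have := continuous_incl (n := n)
      fun_prop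
    exact h2.congr fun q hq => hc.supportFn_sub hθ hM _ hq.2
  have h3 : ContinuousOn (fun q : EuclideanSpace ℝ (Fin n) × Amb n => ell n θ q.2)
      (interior (flatPart (body (Set.range F))) ×ˢ cap n θ) :=
    ((continuous_ell n θ).comp continuous_snd).continuousOn
  exact ((h1.div h3 fun q hq => (ell_pos hθ hq.2).ne').log
    fun q hq => (hc.capSupportFn_pos hθ hM hq.1 hq.2).ne').mul h3

theorem continuousOn_logIntegral (hc : IsStrictlyConvexCapillary θ F N)
    (hθ : θ ∈ Set.Ioo 0 (Real.pi / 2)) (hM : ((𝓡∂ n).boundary M).Nonempty) :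
    ContinuousOn (logIntegral θ (Set.range F)) (interior (flatPart (body (Set.range F)))) :=
  continuousOn_integral_cap (hc.continuousOn_log_mul_ell hθ hM)

/-- For fixed `ξ` the capillary support function is affine in the base point, and `log` is strictly
concave. Two distinct base points have different values at some `ξ`, and continuity makes the
integrated inequality strict. -/
theorem strictConcaveOn_logIntegral (hc : IsStrictlyConvexCapillary θ F N)
    (hθ : θ ∈ Set.Ioo 0 (Real.pi / 2)) (hM : ((𝓡∂ n).boundary M).Nonempty) :
    StrictConcaveOn ℝ (interior (flatPart (body (Set.range F))))
      (logIntegral θ (Set.range F)) := by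
  have hconv : Convex ℝ (interior (flatPart (body (Set.range F)))) := hc.convex_flatPart.interior
  refine ⟨hconv, fun x hx y hy hxy a b ha hb hab => ?_⟩
  have hm := hconv hx hy ha.le hb.le hab
  have hcont := hc.continuousOn_log_mul_ell hθ hM
  have cx := continuousOn_slice hcont hx
  have cy := continuousOn_slice hcont hy
  have cm := continuousOn_slice hcont hm
  have ix := integrable_of_continuousOn cx
  have iy := integrable_of_continuousOn cy
  have im := integrable_of_continuousOn cm
  have hu : ∀ ξ ∈ cap n θ, capSupportFn θ (Set.range F) (incl (a • x + b • y)) ξ =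
      a * capSupportFn θ (Set.range F) (incl x) ξ + b * capSupportFn θ (Set.range F) (incl y) ξ := by
    intro ξ hξ
    simp only [capSupportFn]
    rw [hc.supportFn_sub hθ hM _ hξ, hc.supportFn_sub hθ hM (incl x) hξ,
      hc.supportFn_sub hθ hM (incl y) hξ, incl_add, incl_smul, incl_smul, inner_add_right,
      inner_smul_right, inner_smul_right]
    obtain rfl : b = 1 - a := by linarith
    ring
  have hpos := integral_pos_of_exists_pos hθ ((cm.sub (cx.const_smul a)).sub (cy.const_smul b))
    (fun ξ hξ => ?_) ?_
  · have e : ∫ ξ, ((Real.log (capSupportFn θ (Set.range F) (incl (a • x + b • y)) ξ) *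
          ell n θ ξ - a * (Real.log (capSupportFn θ (Set.range F) (incl x) ξ) * ell n θ ξ)) -
          b * (Real.log (capSupportFn θ (Set.range F) (incl y) ξ) * ell n θ ξ)) ∂capMeasure n θ =
        logIntegral θ (Set.range F) (a • x + b • y) - a * logIntegral θ (Set.range F) x -
          b * logIntegral θ (Set.range F) y := by
      have h1 := integral_sub (im.sub (ix.const_mul a)) (iy.const_mul b)
      have h2 := integral_sub im (ix.const_mul a)
      have h3 := integral_const_mul (μ := capMeasure n θ) a
        fun ξ => Real.log (capSupportFn θ (Set.range F) (incl x) ξ) * ell n θ ξ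
      have h4 := integral_const_mul (μ := capMeasure n θ) b
        fun ξ => Real.log (capSupportFn θ (Set.range F) (incl y) ξ) * ell n θ ξ
      simp only [Pi.sub_apply] at h1 h2
      rw [h1, h2, h3, h4]
      rfl
    have hpos' := hpos.trans_eq e
    simp only [smul_eq_mul]
    linarith
  · have h1 := strictConcaveOn_log_Ioi.concaveOn.2 (hc.capSupportFn_pos hθ hM hx hξ)
      (hc.capSupportFn_pos hθ hM hy hξ) ha.le hb.le hab
    simp only [smul_eq_mul] at h1
    simp only [Pi.sub_apply, Pi.smul_apply, smul_eq_mul, hu ξ hξ]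
    have := ell_pos hθ hξ
    nlinarith
  · obtain ⟨ξ, hξ, h0⟩ := exists_mem_cap_inner_incl_pos hθ (sub_ne_zero.mpr hxy)
    refine ⟨ξ, hξ, ?_⟩
    have hl := ell_pos hθ hξ
    have hne : capSupportFn θ (Set.range F) (incl x) ξ ≠ capSupportFn θ (Set.range F) (incl y) ξ := by
      simp only [capSupportFn]
      intro h
      rw [div_left_inj' hl.ne', hc.supportFn_sub hθ hM (incl x) hξ,
        hc.supportFn_sub hθ hM (incl y) hξ] at h
      rw [incl_sub, inner_sub_right] at h0
      linarith
    have h1 := strictConcaveOn_log_Ioi.2 (hc.capSupportFn_pos hθ hM hx hξ)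
      (hc.capSupportFn_pos hθ hM hy hξ) hne ha hb hab
    simp only [smul_eq_mul] at h1
    simp only [Pi.sub_apply, Pi.smul_apply, smul_eq_mul, hu ξ hξ]
    nlinarith

end IsStrictlyConvexCapillary

end CapillaryFlow

end

/-! ### Reflections and the support function about a rim point. -/

noncomputable section
set_option linter.unusedSectionVars false
namespace CapillaryFlow

open Filter Topology MeasureTheory

section Reflection

variable {n : ℕ} {θ : ℝ}

/-- The reflection in the vertical hyperplane orthogonal to `incl w`. -/
def vertReflection (w : EuclideanSpace ℝ (Fin n)) : Amb n ≃ₗᵢ[ℝ] Amb n :=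
  Submodule.reflection (ℝ ∙ incl w)ᗮ

theorem vertReflection_apply (w : EuclideanSpace ℝ (Fin n)) (y : Amb n) :
    vertReflection w y = y - (2 * (inner ℝ y (incl w) / ‖w‖ ^ 2)) • incl w := by
  rw [vertReflection, Submodule.reflection_orthogonal_apply, Submodule.reflection_singleton_apply,
    real_inner_comm, norm_incl, neg_sub, two_mul, add_smul, two_smul]
  simp

theorem vertReflection_vertReflection (w : EuclideanSpace ℝ (Fin n)) (y : Amb n) :
    vertReflection w (vertReflection w y) = y :=
  Submodule.reflection_reflection _ y

theorem vertReflection_eVec (w : EuclideanSpace ℝ (Fin n)) :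
    vertReflection w (eVec n) = eVec n := by
  rw [vertReflection_apply, real_inner_comm, inner_eVec, incl_last]
  simp

theorem vertReflection_last (w : EuclideanSpace ℝ (Fin n)) (y : Amb n) :
    vertReflection w y (Fin.last n) = y (Fin.last n) := by
  rw [vertReflection_apply, PiLp.sub_apply, PiLp.smul_apply, incl_last, smul_zero, sub_zero]

theorem capNormal_vertReflection (w : EuclideanSpace ℝ (Fin n)) (ξ : Amb n) :
    capNormal n θ (vertReflection w ξ) = vertReflection w (capNormal n θ ξ) := by
  rw [map_sub, map_smul, vertReflection_eVec]

theorem vertReflection_mem_cap (w : EuclideanSpace ℝ (Fin n)) {ξ : Amb n} (hξ : ξ ∈ cap n θ) :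
    vertReflection w ξ ∈ cap n θ := by
  refine ⟨?_, ?_⟩
  · rw [mem_halfSpace_iff, vertReflection_last]
    exact hξ.1
  · have := norm_capNormal hξ
    rwa [← (vertReflection w).norm_map, ← capNormal_vertReflection] at this

theorem ell_vertReflection (w : EuclideanSpace ℝ (Fin n)) (ξ : Amb n) :
    ell n θ (vertReflection w ξ) = ell n θ ξ := by
  rw [ell, ell, inner_eVec, inner_eVec, vertReflection_last]

theorem inner_vertReflection_incl {w : EuclideanSpace ℝ (Fin n)} (y : Amb n) :
    inner ℝ (vertReflection w y) (incl w) = -inner ℝ y (incl w) := by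
  rcases eq_or_ne w 0 with rfl | hw
  · have : incl (0 : EuclideanSpace ℝ (Fin n)) = 0 := (inclₗ n).map_zero
    simp [this]
  rw [vertReflection_apply, inner_sub_left, inner_smul_left, real_inner_self_eq_norm_sq, norm_incl]
  have := norm_pos_iff.mpr hw
  simp only [conj_trivial]
  field_simp
  ring

theorem integral_comp_vertReflection (hθ : θ ∈ Set.Ioo 0 (Real.pi / 2))
    (w : EuclideanSpace ℝ (Fin n)) (g : Amb n → ℝ) :
    ∫ ξ, g (vertReflection w ξ) ∂capMeasure n θ = ∫ ξ, g ξ ∂capMeasure n θ :=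
  (measurePreserving_capMeasure hθ _ (vertReflection_eVec w)).integral_comp
    (vertReflection w).toHomeomorph.measurableEmbedding g

end Reflection

namespace IsStrictlyConvexCapillary

variable {n : ℕ} [NeZero n] {M : Type*} [TopologicalSpace M] [CompactSpace M] [ConnectedSpace M]
  [ChartedSpace (EuclideanHalfSpace n) M] {θ : ℝ} {F N : M → Amb n}

theorem proj_normal_ne_zero (hc : IsStrictlyConvexCapillary θ F N)
    (hθ : θ ∈ Set.Ioo 0 (Real.pi / 2)) {x : M} (hx : F x (Fin.last n) = 0) : proj (N x) ≠ 0 := by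
  intro h
  have h1 := hc.norm_proj_normal_sq hx
  rw [h, norm_zero] at h1
  have := sin_pos_of_mem hθ
  nlinarith

/-- Reflecting the normals in the direction of the inner conormal at a boundary point decreases the
support function with respect to this point, at a linear rate. -/
theorem exists_mul_le_supportFn_sub (hc : IsStrictlyConvexCapillary θ F N)
    (hθ : θ ∈ Set.Ioo 0 (Real.pi / 2)) (hM : ((𝓡∂ n).boundary M).Nonempty)
    {z : EuclideanSpace ℝ (Fin n)} {x : M} (hx : F x = incl z) :
    ∃ c > 0, ∀ ξ ∈ cap n θ, 0 ≤ inner ℝ (capNormal n θ ξ) (incl (-proj (N x))) →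
      c * inner ℝ (capNormal n θ ξ) (incl (-proj (N x))) ≤
        supportFn θ (Set.range F) (incl z) ξ -
          supportFn θ (Set.range F) (incl z) (vertReflection (-proj (N x)) ξ) := by
  set w := -proj (N x)
  have hxl : F x (Fin.last n) = 0 := by rw [hx, incl_last]
  have hw : w ≠ 0 := neg_ne_zero.mpr (hc.proj_normal_ne_zero hθ hxl)
  have hw0 : 0 < ‖w‖ := norm_pos_iff.mpr hw
  have hw1 : ‖w‖ ≤ 1 := by
    have h1 := hc.norm_proj_normal_sq hxl
    have h2 : ‖w‖ = ‖proj (N x)‖ := norm_neg _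
    rw [← h2] at h1
    nlinarith [Real.sin_sq_add_cos_sq θ, sq_nonneg (Real.cos θ)]
  set h : Amb n → ℝ := supportFn θ (Set.range F) (incl z)
  set s : Amb n → ℝ := fun ξ => inner ℝ (capNormal n θ ξ) (incl w)
  set R := vertReflection w
  set P : Amb n → Amb n := fun ξ => F (Function.invFun (capGaussMap θ N) (R ξ))
  set κ : Amb n → ℝ := fun ξ => inner ℝ (incl w) (P ξ - incl z)
  have hNx : N x = Real.cos θ • -eVec n - incl w := by
    have h1 := incl_proj (N x)
    rw [hc.normal_last_of_last_eq_zero hxl] at h1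
    have h2 : incl w = -incl (proj (N x)) := (inclₗ n).map_neg _
    rw [h2, h1]
    module
  -- As `N x = cos θ E - w`, the supporting inequality at `x` reads `cos θ Y_last ≤ ⟨w, Y - z⟩`,
  -- whose left side is nonnegative; strictness holds away from `F x`.
  have hκ : ∀ Y ∈ body (Set.range F), 0 ≤ inner ℝ (incl w) (Y - incl z) ∧
      (Y ≠ F x → 0 < inner ℝ (incl w) (Y - incl z)) := by
    intro Y hY
    have h1 := hc.normal_outward x Y hY
    have hYl : 0 ≤ Y (Fin.last n) := body_subset_halfSpace hc.range_subset hY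
    have hcos := cos_pos_of_mem hθ
    have e : inner ℝ (N x) (Y - F x) =
        Real.cos θ * Y (Fin.last n) - inner ℝ (incl w) (Y - incl z) := by
      rw [hNx, hx, inner_sub_left, inner_smul_left, inner_neg_left, real_inner_comm, inner_eVec,
        PiLp.sub_apply, incl_last]
      simp
    have h2 := mul_nonneg hcos.le hYl
    refine ⟨by linarith, fun hne => ?_⟩
    have h3 := hc.inner_neg_of_ne hθ hM hY hne
    linarith
  have hdecomp : ∀ ξ, capNormal n θ ξ = capNormal n θ (R ξ) + (2 * (s ξ / ‖w‖ ^ 2)) • incl w := by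
    intro ξ
    rw [capNormal_vertReflection, vertReflection_apply, sub_add_cancel]
  -- The support point `P ξ` of the reflected normal is a competitor for the original normal; the
  -- two normals differ by a multiple of `w`, which produces `κ`.
  have hlin : ∀ ξ ∈ cap n θ, 2 * (s ξ / ‖w‖ ^ 2) * κ ξ ≤ h ξ - h (R ξ) := by
    intro ξ hξ
    have h1 := hc.inner_le_supportFn hθ hM (incl z) hξ (Function.invFun (capGaussMap θ N) (R ξ))
    have h2 := hc.supportFn_eq hθ hM (incl z) (vertReflection_mem_cap w hξ)
    rw [hdecomp, inner_add_left, inner_smul_left, conj_trivial] at h1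
    change h (R ξ) = _ at h2
    change _ ≤ h ξ at h1
    change _ + _ * κ ξ ≤ _ at h1
    linarith
  have hcontR : ContinuousOn R (cap n θ) := R.continuous.continuousOn
  have hmapR : Set.MapsTo R (cap n θ) (cap n θ) := fun ξ hξ => vertReflection_mem_cap w hξ
  have hhc : ContinuousOn h (cap n θ) := hc.continuousOn_supportFn hθ hM _
  have hκc : ContinuousOn κ (cap n θ) := by
    have h1 : ContinuousOn P (cap n θ) :=
      hc.continuous.comp_continuousOn ((hc.continuousOn_invFun hθ hM).comp hcontR hmapR)
    exact continuousOn_const.inner (h1.sub continuousOn_const)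
  -- The linear rate from `κ` degenerates only when `P ξ = F x`. There the reflected normal is `N
  -- x`, so `h (R ξ) = 0` and `h ξ > 0`, and the difference itself is positive. The maximum of the
  -- two is thus positive on a compact set, and `s ≤ 1` converts either bound into a linear one.
  set m : Amb n → ℝ := fun ξ => max (2 / ‖w‖ ^ 2 * κ ξ) (h ξ - h (R ξ))
  have hmc : ContinuousOn m (cap n θ) :=
    ContinuousOn.sup (continuousOn_const.mul hκc) (hhc.sub (hhc.comp hcontR hmapR))
  have hsc : Continuous s := by fun_prop
  have hpos : ∀ ξ ∈ cap n θ ∩ {ξ | 0 ≤ s ξ}, 0 < m ξ := by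
    rintro ξ ⟨hξ, hs⟩
    by_cases hP : P ξ = F x
    · refine lt_max_of_lt_right ?_
      have hN : capNormal n θ (R ξ) = N x := by
        rw [← hc.normal_invFun hθ hM (vertReflection_mem_cap w hξ), hc.injective hP]
      have hRh : h (R ξ) = 0 := by
        have h2 := hc.supportFn_eq hθ hM (incl z) (vertReflection_mem_cap w hξ)
        change h (R ξ) = inner ℝ _ (P ξ - incl z) at h2
        rw [h2, hP, hx, sub_self, inner_zero_right]
      rw [hRh, sub_zero]
      have hsN : s ξ = ‖w‖ ^ 2 := by
        have h3 : s (R ξ) = -s ξ := by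
          simp only [s]
          rw [capNormal_vertReflection, inner_vertReflection_incl]
        have h4 : s (R ξ) = -‖w‖ ^ 2 := by
          simp only [s]
          rw [hN, hNx, inner_sub_left, inner_smul_left, inner_neg_left, real_inner_comm,
            inner_eVec, incl_last, real_inner_self_eq_norm_sq, norm_incl]
          simp
        linarith
      have hne : Function.invFun (capGaussMap θ N) ξ ≠ x := by
        intro hxx
        have h5 := hc.normal_invFun hθ hM hξ
        rw [hxx, ← hN] at h5
        have h6 : s (R ξ) = s ξ := by
          simp only [s]
          rw [h5]
        have h3 : s (R ξ) = -s ξ := by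
          simp only [s]
          rw [capNormal_vertReflection, inner_vertReflection_incl]
        have : 0 < ‖w‖ ^ 2 := by positivity
        linarith
      have h7 := hc.inner_neg_of_ne hθ hM (x := Function.invFun (capGaussMap θ N) ξ)
        (hc.mem_body x) fun hh => hne (hc.injective hh).symm
      have h8 := hc.supportFn_eq hθ hM (incl z) hξ
      rw [hc.normal_invFun hθ hM hξ, hx, ← neg_sub, inner_neg_right, ← h8] at h7
      change -h ξ < 0 at h7
      linarith
    · refine lt_max_of_lt_left ?_
      have := (hκ (P ξ) (hc.mem_body _)).2 hP
      positivity
  obtain ⟨c, hc0, hcm⟩ := ((isCompact_cap n θ).inter_right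
    (isClosed_Ici.preimage hsc)).exists_forall_le' (hmc.mono Set.inter_subset_left) hpos
  refine ⟨c, hc0, fun ξ hξ hs => ?_⟩
  have hs1 : s ξ ≤ 1 := by
    refine (real_inner_le_norm _ _).trans ?_
    rw [norm_capNormal hξ, norm_incl, one_mul]
    exact hw1
  have h1 := hcm ξ ⟨hξ, hs⟩
  change c * s ξ ≤ h ξ - h (R ξ)
  change 0 ≤ s ξ at hs
  have hκ0 := (hκ (P ξ) (hc.mem_body _)).1
  have h2 := hlin ξ hξ
  rcases le_max_iff.mp h1 with h3 | h3
  · calc c * s ξ ≤ 2 / ‖w‖ ^ 2 * κ ξ * s ξ := by gcongr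
      _ = 2 * (s ξ / ‖w‖ ^ 2) * κ ξ := by ring
      _ ≤ _ := h2
  · have h4 : 0 ≤ h ξ - h (R ξ) := hc0.le.trans h3
    calc c * s ξ ≤ (h ξ - h (R ξ)) * s ξ := by gcongr
      _ ≤ (h ξ - h (R ξ)) * 1 := by gcongr
      _ = _ := mul_one _

end IsStrictlyConvexCapillary

end CapillaryFlow

end

/-! ### Existence of a maximizing base point in the interior of the flat part. -/

noncomputable section
set_option linter.unusedSectionVars false
namespace CapillaryFlow

open Filter Topology MeasureTheory

/-- An additive gain `e` in a product of size at most `D` is a multiplicative gain `1 + e / D`. -/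
theorem log_div_add_log_div_le {p q p' q' l e D : ℝ} (hp : 0 < p) (hq : 0 < q) (hp' : 0 < p')
    (hq' : 0 < q') (hl : 0 < l) (he : 0 ≤ e) (hD : 0 < D) (hpq : p * q ≤ D)
    (h : p * q + e ≤ p' * q') :
    Real.log (p / l) + Real.log (q / l) + Real.log (1 + e / D) ≤
      Real.log (p' / l) + Real.log (q' / l) := by
  have h0 : 0 < 1 + e / D := by positivity
  rw [← Real.log_mul (by positivity) (by positivity), ← Real.log_mul (by positivity) h0.ne',
    ← Real.log_mul (by positivity) (by positivity)]
  refine Real.log_le_log (by positivity) ?_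
  have h1 : p * q * (1 + e / D) ≤ p' * q' := by
    have h2 : p * q * (e / D) ≤ e := by
      rw [← mul_div_assoc, div_le_iff₀ hD, mul_comm e D]
      gcongr
    linarith
  have e1 : p / l * (q / l) * (1 + e / D) = p * q * (1 + e / D) / l ^ 2 := by
    field_simp
  have e2 : p' / l * (q' / l) = p' * q' / l ^ 2 := by
    field_simp
  rw [e1, e2]
  gcongr

namespace IsStrictlyConvexCapillary

variable {n : ℕ} [NeZero n] {M : Type*} [TopologicalSpace M] [CompactSpace M] [ConnectedSpace M]
  [ChartedSpace (EuclideanHalfSpace n) M] {θ : ℝ} {F N : M → Amb n}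

theorem supportFn_le_diam (hc : IsStrictlyConvexCapillary θ F N)
    (hθ : θ ∈ Set.Ioo 0 (Real.pi / 2)) (hM : ((𝓡∂ n).boundary M).Nonempty)
    {z : EuclideanSpace ℝ (Fin n)} (hz : z ∈ flatPart (body (Set.range F))) {ξ : Amb n}
    (hξ : ξ ∈ cap n θ) :
    supportFn θ (Set.range F) (incl z) ξ ≤ Metric.diam (body (Set.range F)) := by
  rw [hc.supportFn_eq hθ hM _ hξ]
  refine (real_inner_le_norm _ _).trans ?_
  rw [norm_capNormal hξ, one_mul, ← dist_eq_norm]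
  exact Metric.dist_le_diam_of_mem hc.isCompact_body.isBounded (hc.mem_body _) hz

theorem integrable_log_mul_ell (hc : IsStrictlyConvexCapillary θ F N)
    (hθ : θ ∈ Set.Ioo 0 (Real.pi / 2)) (hM : ((𝓡∂ n).boundary M).Nonempty)
    {z : EuclideanSpace ℝ (Fin n)} (hz : z ∈ interior (flatPart (body (Set.range F)))) :
    Integrable (fun ξ => Real.log (capSupportFn θ (Set.range F) (incl z) ξ) * ell n θ ξ)
      (capMeasure n θ) :=
  integrable_of_continuousOn (continuousOn_slice (hc.continuousOn_log_mul_ell hθ hM) hz)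

/-- Near a boundary point of the flat part, moving inwards increases the logarithmic integral by a
definite amount. -/
theorem exists_logIntegral_lt (hc : IsStrictlyConvexCapillary θ F N)
    (hθ : θ ∈ Set.Ioo 0 (Real.pi / 2)) (hM : ((𝓡∂ n).boundary M).Nonempty)
    {z₀ : EuclideanSpace ℝ (Fin n)} {x : M} (hx : F x = incl z₀) :
    ∃ z₁ ∈ interior (flatPart (body (Set.range F))), ∀ᶠ z in 𝓝 z₀,
      z ∈ interior (flatPart (body (Set.range F))) →
        logIntegral θ (Set.range F) z < logIntegral θ (Set.range F) z₁ := by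
  obtain ⟨c, hc0, hcs⟩ := hc.exists_mul_le_supportFn_sub hθ hM hx
  have hev := hc.eventually_mem_interior_flatPart hθ hM hx
  set w := -proj (N x)
  set Ω := interior (flatPart (body (Set.range F)))
  set R := vertReflection w
  set s : Amb n → ℝ := fun ξ => inner ℝ (capNormal n θ ξ) (incl w)
  have hw : 0 < ‖w‖ := norm_pos_iff.mpr
    (neg_ne_zero.mpr (hc.proj_normal_ne_zero hθ (by rw [hx, incl_last])))
  have hsR : ∀ ξ, s (R ξ) = -s ξ := fun ξ => by
    simp only [s]
    rw [capNormal_vertReflection, inner_vertReflection_incl]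
  -- Shifting by `δ w` changes the product at `ξ` and `R ξ` by at least `δ s (c / 2) s - δ² s²`; the
  -- bound `δ ≤ c / 4` leaves a gain of `δ s² c / 4`.
  obtain ⟨δ, hδΩ, hδ0, hδc⟩ := (hev.and (Ioc_mem_nhdsGT (show (0 : ℝ) < c / 4 by positivity))).exists
  set D := (Metric.diam (body (Set.range F)) + 1) ^ 2
  have hdiam : 0 ≤ Metric.diam (body (Set.range F)) := Metric.diam_nonneg
  have hD : 0 < D := by positivity
  -- This gain in the logarithm does not depend on `z`, so its integral `η` is a uniform amount for
  -- all `z` near `z₀`.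
  set g : Amb n → ℝ := fun ξ => Real.log (1 + δ * s ξ ^ 2 * (c / 4) / D) * ell n θ ξ
  have hsc : Continuous s := by fun_prop
  have hg1 : ∀ ξ, 0 ≤ δ * s ξ ^ 2 * (c / 4) / D := fun ξ => by positivity
  have hgc : Continuous g := by
    refine (Continuous.log (by fun_prop) fun ξ => ?_).mul (continuous_ell n θ)
    have := hg1 ξ
    positivity
  have hη : 0 < ∫ ξ, g ξ ∂capMeasure n θ := by
    refine integral_pos_of_exists_pos hθ hgc.continuousOn (fun ξ hξ => ?_) ?_
    · exact mul_nonneg (Real.log_nonneg (by linarith [hg1 ξ])) (ell_pos hθ hξ).le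
    · obtain ⟨ξ, hξ, h0⟩ := exists_mem_cap_inner_incl_pos hθ (norm_pos_iff.mp hw)
      refine ⟨ξ, hξ, mul_pos (Real.log_pos ?_) (ell_pos hθ hξ)⟩
      change 0 < s ξ at h0
      have : 0 < δ * s ξ ^ 2 * (c / 4) / D := by positivity
      linarith
  set η := ∫ ξ, g ξ ∂capMeasure n θ
  have hcont : ContinuousAt (fun z => logIntegral θ (Set.range F) (z + δ • w)) z₀ :=
    ContinuousAt.comp (g := logIntegral θ (Set.range F)) (f := fun z => z + δ • w)
      ((hc.continuousOn_logIntegral hθ hM).continuousAt (isOpen_interior.mem_nhds hδΩ))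
      (by fun_prop)
  have hadd : ContinuousAt (fun z => z + δ • w) z₀ := by fun_prop
  refine ⟨z₀ + δ • w, hδΩ, ?_⟩
  -- The radius `c * ‖w‖ / 4` costs at most half of the rate `c` when `z₀` is replaced by `z`. The
  -- tolerance `η / 2` passes from the shifted point of `z` to the fixed point `z₀ + δ • w`.
  filter_upwards [hadd.eventually (isOpen_interior.mem_nhds hδΩ),
    hcont.tendsto.eventually_lt_const (show logIntegral θ (Set.range F) (z₀ + δ • w) <
      logIntegral θ (Set.range F) (z₀ + δ • w) + η / 2 by linarith),
    Metric.ball_mem_nhds z₀ (show 0 < c * ‖w‖ / 4 by positivity)] with z hz1 hz2 hz3 hzΩ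
  change z + δ • w ∈ Ω at hz1
  have hpos := (hc.mem_interior_flatPart_iff_supportFn_pos hθ hM).mp hzΩ
  have hpos' := (hc.mem_interior_flatPart_iff_supportFn_pos hθ hM).mp hz1
  set L : EuclideanSpace ℝ (Fin n) → Amb n → ℝ :=
    fun z ξ => Real.log (capSupportFn θ (Set.range F) (incl z) ξ)
  have hshift : ∀ ξ ∈ cap n θ, supportFn θ (Set.range F) (incl (z + δ • w)) ξ =
      supportFn θ (Set.range F) (incl z) ξ - δ * s ξ := fun ξ hξ => by
    rw [hc.supportFn_incl hθ hM _ _ hξ, incl_smul, inner_smul_right]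
  have hhalf : ∀ ξ ∈ cap n θ, 0 ≤ s ξ →
      L z ξ + L z (R ξ) + Real.log (1 + δ * s ξ ^ 2 * (c / 4) / D) ≤
        L (z + δ • w) ξ + L (z + δ • w) (R ξ) := by
    intro ξ hξ hs
    have hRξ : R ξ ∈ cap n θ := vertReflection_mem_cap w hξ
    have e1 := hc.supportFn_incl hθ hM z₀ (z - z₀) hξ
    have e2 := hc.supportFn_incl hθ hM z₀ (z - z₀) hRξ
    have e3 : inner ℝ (capNormal n θ (R ξ)) (incl (z - z₀)) =
        inner ℝ (capNormal n θ ξ) (incl (z - z₀)) -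
          2 * (s ξ / ‖w‖ ^ 2) * inner ℝ (incl w) (incl (z - z₀)) := by
      rw [capNormal_vertReflection, vertReflection_apply, inner_sub_left, inner_smul_left,
        conj_trivial]
    have h4 : inner ℝ (incl w) (incl (z - z₀)) ≤ c * ‖w‖ ^ 2 / 4 := by
      refine (real_inner_le_norm _ _).trans ?_
      rw [norm_incl, norm_incl]
      rw [Metric.mem_ball, dist_eq_norm] at hz3
      calc ‖w‖ * ‖z - z₀‖ ≤ ‖w‖ * (c * ‖w‖ / 4) := by gcongr
        _ = _ := by ring
    have h5 : 2 * (s ξ / ‖w‖ ^ 2) * inner ℝ (incl w) (incl (z - z₀)) ≤ c / 2 * s ξ := by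
      calc 2 * (s ξ / ‖w‖ ^ 2) * inner ℝ (incl w) (incl (z - z₀))
          ≤ 2 * (s ξ / ‖w‖ ^ 2) * (c * ‖w‖ ^ 2 / 4) := by gcongr
        _ = c / 2 * s ξ := by
          field_simp
          ring
    have h6 : c * s ξ ≤ supportFn θ (Set.range F) (incl z₀) ξ -
        supportFn θ (Set.range F) (incl z₀) (R ξ) := hcs ξ hξ hs
    rw [add_sub_cancel] at e1 e2
    have h7 : c / 2 * s ξ ≤ supportFn θ (Set.range F) (incl z) ξ -
        supportFn θ (Set.range F) (incl z) (R ξ) := by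
      rw [e1, e2, e3]
      linarith
    have hl : ell n θ (R ξ) = ell n θ ξ := ell_vertReflection w ξ
    have hb1 := hc.supportFn_le_diam hθ hM (interior_subset hzΩ) hξ
    have hb2 := hc.supportFn_le_diam hθ hM (interior_subset hzΩ) hRξ
    have hp := hpos ξ hξ
    have hq := hpos (R ξ) hRξ
    have hp' := hpos' ξ hξ
    have hq' := hpos' (R ξ) hRξ
    simp only [L, capSupportFn]
    rw [hl]
    refine log_div_add_log_div_le hp hq hp' hq' (ell_pos hθ hξ) (by positivity) hD ?_ ?_
    · simp only [D]
      rw [sq]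
      gcongr
      · linarith
      · linarith
    · rw [hshift ξ hξ, hshift (R ξ) hRξ, hsR]
      have h8 : 0 ≤ δ * s ξ := by positivity
      nlinarith [mul_le_mul_of_nonneg_left h7 h8, mul_le_mul_of_nonneg_left
        (mul_le_mul_of_nonneg_right hδc hs) h8]
  have hall : ∀ ξ ∈ cap n θ, L z ξ + L z (R ξ) + Real.log (1 + δ * s ξ ^ 2 * (c / 4) / D) ≤
      L (z + δ • w) ξ + L (z + δ • w) (R ξ) := by
    intro ξ hξ
    rcases le_total 0 (s ξ) with hs | hs
    · exact hhalf ξ hξ hs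
    · have h1 := hhalf (R ξ) (vertReflection_mem_cap w hξ) (by rw [hsR]; linarith)
      rw [hsR, neg_sq, show R (R ξ) = ξ from vertReflection_vertReflection w ξ] at h1
      linarith
  -- Both `ℓ` and the measure are invariant under the reflection, so integrating the paired
  -- inequality yields twice each logarithmic integral, with total gain `η`.
  have hrefl : ∀ y ∈ Ω, ContinuousOn (fun ξ => L y (R ξ) * ell n θ ξ) (cap n θ) ∧
      ∫ ξ, L y (R ξ) * ell n θ ξ ∂capMeasure n θ = logIntegral θ (Set.range F) y := by
    intro y hy
    have h1 := continuousOn_slice (hc.continuousOn_log_mul_ell hθ hM) hy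
    have h2 := h1.comp R.continuous.continuousOn fun ξ hξ => vertReflection_mem_cap w hξ
    have h3 := integral_comp_vertReflection hθ w fun ξ => L y ξ * ell n θ ξ
    have h4 : ∀ ξ, ell n θ (vertReflection w ξ) = ell n θ ξ := ell_vertReflection w
    simp only [h4] at h3
    refine ⟨h2.congr fun ξ _ => ?_, h3⟩
    simp only [Function.comp, R, h4]
    rfl
  have hi1 := hc.integrable_log_mul_ell hθ hM hzΩ
  have hi2 := hc.integrable_log_mul_ell hθ hM hz1
  have hi3 := integrable_of_continuousOn (hrefl z hzΩ).1
  have hi4 := integrable_of_continuousOn (hrefl _ hz1).1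
  have hi5 : Integrable g (capMeasure n θ) := integrable_of_continuousOn hgc.continuousOn
  have hfinal := integral_mono_ae ((hi1.add hi3).add hi5) (hi2.add hi4) (by
    filter_upwards [ae_mem_cap n θ] with ξ hξ
    have h1 := mul_le_mul_of_nonneg_right (hall ξ hξ) (ell_pos hθ hξ).le
    simp only [Pi.add_apply, g]
    change L z ξ * _ + _ + _ ≤ L (z + δ • w) ξ * _ + _
    linarith)
  rw [integral_add' (hi1.add hi3) hi5, integral_add' hi1 hi3, integral_add' hi2 hi4,
    (hrefl z hzΩ).2, (hrefl _ hz1).2] at hfinal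
  change logIntegral θ (Set.range F) z + _ + η ≤ logIntegral θ (Set.range F) (z + δ • w) + _
    at hfinal
  linarith

/-- No extension of the integral to the rim is needed. By compactness, the rim has an open
neighbourhood `U` on which one interior value dominates; the flat part without `U` is compact, and
the integral is continuous there. -/
theorem exists_isMaxOn_logIntegral (hc : IsStrictlyConvexCapillary θ F N)
    (hθ : θ ∈ Set.Ioo 0 (Real.pi / 2)) (hM : ((𝓡∂ n).boundary M).Nonempty) :
    ∃ z ∈ interior (flatPart (body (Set.range F))),
      IsMaxOn (logIntegral θ (Set.range F)) (interior (flatPart (body (Set.range F)))) z := by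
  set Ω := interior (flatPart (body (Set.range F)))
  set f := logIntegral θ (Set.range F)
  obtain ⟨p, hp⟩ := hc.interior_flatPart_nonempty hθ hM
  have hcomp : IsCompact (flatPart (body (Set.range F)) \ Ω) :=
    hc.isCompact_flatPart.diff isOpen_interior
  obtain ⟨U, hU, hsub, z₁, hz₁, hUz⟩ : ∃ U : Set (EuclideanSpace ℝ (Fin n)), IsOpen U ∧
      flatPart (body (Set.range F)) \ Ω ⊆ U ∧ ∃ z₁ ∈ Ω, ∀ z ∈ U, z ∈ Ω → f z ≤ f z₁ := by
    refine hcomp.induction_on (p := fun s => ∃ U : Set (EuclideanSpace ℝ (Fin n)), IsOpen U ∧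
      s ⊆ U ∧ ∃ z₁ ∈ Ω, ∀ z ∈ U, z ∈ Ω → f z ≤ f z₁) ?_ ?_ ?_ ?_
    · exact ⟨∅, isOpen_empty, subset_rfl, p, hp, fun z hz => hz.elim⟩
    · rintro s t hst ⟨U, hU, htU, h⟩
      exact ⟨U, hU, hst.trans htU, h⟩
    · rintro s t ⟨U, hU, hsU, z₁, hz₁, h₁⟩ ⟨V, hV, htV, z₂, hz₂, h₂⟩
      refine ⟨U ∪ V, hU.union hV, Set.union_subset_union hsU htV, ?_⟩
      rcases le_total (f z₁) (f z₂) with h | h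
      · refine ⟨z₂, hz₂, fun z hz hzΩ => ?_⟩
        rcases hz with hz | hz
        · exact (h₁ z hz hzΩ).trans h
        · exact h₂ z hz hzΩ
      · refine ⟨z₁, hz₁, fun z hz hzΩ => ?_⟩
        rcases hz with hz | hz
        · exact h₁ z hz hzΩ
        · exact (h₂ z hz hzΩ).trans h
    · rintro z₀ ⟨hz₀, hz₀Ω⟩
      obtain ⟨x, hx⟩ := hc.exists_eq_incl_of_notMem_interior hθ hM hz₀ hz₀Ω
      obtain ⟨z₁, hz₁, hev⟩ := hc.exists_logIntegral_lt hθ hM hx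
      obtain ⟨U, hUsub, hU, hzU⟩ := mem_nhds_iff.mp hev
      exact ⟨U, mem_nhdsWithin_of_mem_nhds (hU.mem_nhds hzU), U, hU, subset_rfl, z₁, hz₁,
        fun z hz hzΩ => (hUsub hz hzΩ).le⟩
  have hC : IsCompact (flatPart (body (Set.range F)) \ U) := hc.isCompact_flatPart.diff hU
  have hCΩ : flatPart (body (Set.range F)) \ U ⊆ Ω := fun z hz => by
    by_contra h
    exact hz.2 (hsub ⟨hz.1, h⟩)
  rcases (flatPart (body (Set.range F)) \ U).eq_empty_or_nonempty with hem | hne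
  · refine ⟨z₁, hz₁, fun z hz => hUz z ?_ hz⟩
    by_contra h
    exact (hem ▸ (⟨interior_subset hz, h⟩ : z ∈ flatPart (body (Set.range F)) \ U) : z ∈ (∅ : Set _))
  · obtain ⟨z₂, hz₂, hmax⟩ := hC.exists_isMaxOn hne ((hc.continuousOn_logIntegral hθ hM).mono hCΩ)
    have hbound : ∀ z ∈ Ω, f z ≤ max (f z₁) (f z₂) := fun z hz => by
      by_cases h : z ∈ U
      · exact (hUz z h hz).trans (le_max_left _ _)
      · exact (hmax ⟨interior_subset hz, h⟩ : f z ≤ f z₂).trans (le_max_right _ _)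
    rcases le_total (f z₁) (f z₂) with h | h
    · exact ⟨z₂, hCΩ hz₂, fun z hz => (hbound z hz).trans_eq (max_eq_right h)⟩
    · exact ⟨z₁, hz₁, fun z hz => (hbound z hz).trans_eq (max_eq_left h)⟩

end IsStrictlyConvexCapillary

end CapillaryFlow

end

/-! ### Moving base points, the derivative of the logarithmic integral, and solitons. -/

noncomputable section
set_option linter.unusedSectionVars false
namespace CapillaryFlow

open Filter Topology MeasureTheory

namespace IsNormalizedFlow

variable {n : ℕ} [NeZero n] {M : Type*} [TopologicalSpace M] [CompactSpace M] [ConnectedSpace M]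
  [ChartedSpace (EuclideanHalfSpace n) M] {θ : ℝ} {X ν : ℝ → M → Amb n} {t₀ : ℝ}

/-- The support function at time `t` with respect to the point `exp (t - t₀) • z`. -/
def movingSupport (θ : ℝ) (X : ℝ → M → Amb n) (t₀ : ℝ)
    (q : (ℝ × EuclideanSpace ℝ (Fin n)) × Amb n) : ℝ :=
  supportFn θ (Set.range (X q.1.1)) 0 q.2 -
    Real.exp (q.1.1 - t₀) * inner ℝ (capNormal n θ q.2) (incl q.1.2)

/-- The pairs `(t, z)` for which `exp (t - t₀) • z` is an admissible base point at time `t`. -/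
def movingBase (θ : ℝ) (X : ℝ → M → Amb n) (t₀ : ℝ) : Set (ℝ × EuclideanSpace ℝ (Fin n)) :=
  {q | 0 ≤ q.1 ∧ ∀ ξ ∈ cap n θ, 0 < movingSupport θ X t₀ (q, ξ)}

/-- The time derivative of `log U ℓ`. -/
def rate (θ : ℝ) (X ν : ℝ → M → Amb n) (t₀ : ℝ)
    (q : (ℝ × EuclideanSpace ℝ (Fin n)) × Amb n) : ℝ :=
  ell n θ q.2 - capGaussCurvature θ (X q.1.1) (ν q.1.1) q.2 * ell n θ q.2 ^ 2 /
    movingSupport θ X t₀ q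

theorem movingSupport_eq (hf : IsNormalizedFlow θ X ν)
    (hθ : θ ∈ Set.Ioo 0 (Real.pi / 2)) (hM : ((𝓡∂ n).boundary M).Nonempty) {t : ℝ} (ht : 0 ≤ t)
    (z : EuclideanSpace ℝ (Fin n)) {ξ : Amb n} (hξ : ξ ∈ cap n θ) :
    movingSupport θ X t₀ ((t, z), ξ) =
      supportFn θ (Set.range (X t)) (incl (Real.exp (t - t₀) • z)) ξ := by
  rw [(hf.capillary t ht).supportFn_sub hθ hM _ hξ, incl_smul, inner_smul_right]
  rfl

theorem movingSupportFn_eq (hf : IsNormalizedFlow θ X ν)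
    (hθ : θ ∈ Set.Ioo 0 (Real.pi / 2)) (hM : ((𝓡∂ n).boundary M).Nonempty) {t : ℝ} (ht : 0 ≤ t)
    (z : EuclideanSpace ℝ (Fin n)) {ξ : Amb n} (hξ : ξ ∈ cap n θ) :
    movingSupportFn θ (fun s => Set.range (X s)) t₀ z t ξ =
      capSupportFn θ (Set.range (X t)) (incl (Real.exp (t - t₀) • z)) ξ := by
  rw [movingSupportFn, capSupportFn, capSupportFn, ← hf.movingSupport_eq hθ hM ht z hξ,
    movingSupport, inner_capNormal_incl, real_inner_comm, sub_div]

theorem mem_movingBase_iff (hf : IsNormalizedFlow θ X ν)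
    (hθ : θ ∈ Set.Ioo 0 (Real.pi / 2)) (hM : ((𝓡∂ n).boundary M).Nonempty) {t : ℝ} (ht : 0 ≤ t)
    {z : EuclideanSpace ℝ (Fin n)} : (t, z) ∈ movingBase θ X t₀ ↔
      Real.exp (t - t₀) • z ∈ interior (flatPart (body (Set.range (X t)))) := by
  rw [(hf.capillary t ht).mem_interior_flatPart_iff_supportFn_pos hθ hM]
  constructor
  · intro h ξ hξ
    rw [← hf.movingSupport_eq hθ hM ht z hξ]
    exact h.2 ξ hξ
  · intro h
    refine ⟨ht, fun ξ hξ => ?_⟩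
    rw [hf.movingSupport_eq hθ hM ht z hξ]
    exact h ξ hξ

theorem continuousOn_movingSupport (hf : IsNormalizedFlow θ X ν)
    (hθ : θ ∈ Set.Ioo 0 (Real.pi / 2)) (hM : ((𝓡∂ n).boundary M).Nonempty) :
    ContinuousOn (movingSupport θ X t₀) ((Set.Ici 0 ×ˢ Set.univ) ×ˢ cap n θ) := by
  refine ContinuousOn.sub ?_ (Continuous.continuousOn ?_)
  · exact (hf.continuousOn_supportFn hθ hM).comp
      (f := fun q : (ℝ × EuclideanSpace ℝ (Fin n)) × Amb n => (q.1.1, q.2)) (by fun_prop)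
      fun q hq => ⟨hq.1.1, hq.2⟩
  · have := continuous_incl (n := n)
    fun_prop

theorem hasDerivWithinAt_movingSupport (hf : IsNormalizedFlow θ X ν)
    (hθ : θ ∈ Set.Ioo 0 (Real.pi / 2)) (hM : ((𝓡∂ n).boundary M).Nonempty) {t : ℝ} (ht : 0 ≤ t)
    (z : EuclideanSpace ℝ (Fin n)) {ξ : Amb n} (hξ : ξ ∈ cap n θ) :
    HasDerivWithinAt (fun s => movingSupport θ X t₀ ((s, z), ξ))
      (movingSupport θ X t₀ ((t, z), ξ) -
        capGaussCurvature θ (X t) (ν t) ξ * ell n θ ξ) (Set.Ici 0) t := by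
  have h1 := hf.hasDerivWithinAt_supportFn hθ hM hξ ht
  have h2 : HasDerivAt (fun s => Real.exp (s - t₀) * inner ℝ (capNormal n θ ξ) (incl z))
      (Real.exp (t - t₀) * 1 * inner ℝ (capNormal n θ ξ) (incl z)) t :=
    (((hasDerivAt_id t).sub_const t₀).exp).mul_const _
  refine (h1.sub h2.hasDerivWithinAt).congr_deriv ?_
  simp only [movingSupport]
  ring

theorem movingBase_subset : movingBase θ X t₀ ⊆ Set.Ici 0 ×ˢ Set.univ :=
  fun _ hq => ⟨hq.1, trivial⟩

theorem continuousOn_log_moving (hf : IsNormalizedFlow θ X ν)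
    (hθ : θ ∈ Set.Ioo 0 (Real.pi / 2)) (hM : ((𝓡∂ n).boundary M).Nonempty) :
    ContinuousOn (fun q : (ℝ × EuclideanSpace ℝ (Fin n)) × Amb n =>
        Real.log (movingSupport θ X t₀ q / ell n θ q.2) * ell n θ q.2)
      (movingBase θ X t₀ ×ˢ cap n θ) := by
  have h1 := (hf.continuousOn_movingSupport hθ hM (t₀ := t₀)).mono
    (Set.prod_mono_left (movingBase_subset (θ := θ) (X := X) (t₀ := t₀)))
  have h2 : ContinuousOn (fun q : (ℝ × EuclideanSpace ℝ (Fin n)) × Amb n => ell n θ q.2)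
      (movingBase θ X t₀ ×ˢ cap n θ) := ((continuous_ell n θ).comp continuous_snd).continuousOn
  exact ((h1.div h2 fun q hq => (ell_pos hθ hq.2).ne').log fun q hq =>
    (div_pos (hq.1.2 q.2 hq.2) (ell_pos hθ hq.2)).ne').mul h2

theorem continuousOn_rate (hf : IsNormalizedFlow θ X ν)
    (hθ : θ ∈ Set.Ioo 0 (Real.pi / 2)) (hM : ((𝓡∂ n).boundary M).Nonempty) :
    ContinuousOn (rate θ X ν t₀) (movingBase θ X t₀ ×ˢ cap n θ) := by
  have h1 := (hf.continuousOn_movingSupport hθ hM (t₀ := t₀)).mono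
    (Set.prod_mono_left (movingBase_subset (θ := θ) (X := X) (t₀ := t₀)))
  have h2 : ContinuousOn (fun q : (ℝ × EuclideanSpace ℝ (Fin n)) × Amb n => ell n θ q.2)
      (movingBase θ X t₀ ×ˢ cap n θ) := ((continuous_ell n θ).comp continuous_snd).continuousOn
  have h3 := (hf.continuousOn_capGaussCurvature hθ hM).comp
      (f := fun q : (ℝ × EuclideanSpace ℝ (Fin n)) × Amb n => (q.1.1, q.2)) (by fun_prop)
      fun q (hq : q ∈ movingBase θ X t₀ ×ˢ cap n θ) => ⟨hq.1.1, hq.2⟩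
  exact h2.sub ((h3.mul (h2.pow 2)).div h1 fun q hq => (hq.1.2 q.2 hq.2).ne')

theorem logIntegral_moving (hf : IsNormalizedFlow θ X ν)
    (hθ : θ ∈ Set.Ioo 0 (Real.pi / 2)) (hM : ((𝓡∂ n).boundary M).Nonempty) {t : ℝ} (ht : 0 ≤ t)
    (z : EuclideanSpace ℝ (Fin n)) :
    logIntegral θ (Set.range (X t)) (Real.exp (t - t₀) • z) =
      ∫ ξ, Real.log (movingSupport θ X t₀ ((t, z), ξ) / ell n θ ξ) * ell n θ ξ
        ∂capMeasure n θ :=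
  integral_congr_cap fun ξ hξ => by
    rw [hf.movingSupport_eq hθ hM ht z hξ]
    rfl

theorem continuousOn_logIntegral_moving (hf : IsNormalizedFlow θ X ν)
    (hθ : θ ∈ Set.Ioo 0 (Real.pi / 2)) (hM : ((𝓡∂ n).boundary M).Nonempty) :
    ContinuousOn (fun q : ℝ × EuclideanSpace ℝ (Fin n) =>
      logIntegral θ (Set.range (X q.1)) (Real.exp (q.1 - t₀) • q.2)) (movingBase θ X t₀) :=
  (continuousOn_integral_cap (hf.continuousOn_log_moving hθ hM)).congr fun q hq =>
    hf.logIntegral_moving hθ hM hq.1 q.2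

theorem hasDerivWithinAt_logIntegral_moving (hf : IsNormalizedFlow θ X ν)
    (hθ : θ ∈ Set.Ioo 0 (Real.pi / 2)) (hM : ((𝓡∂ n).boundary M).Nonempty) {I : Set ℝ}
    (hI : Convex ℝ I) {z : EuclideanSpace ℝ (Fin n)} (hz : ∀ t ∈ I, (t, z) ∈ movingBase θ X t₀)
    {t : ℝ} (ht : t ∈ I) :
    HasDerivWithinAt (fun t => logIntegral θ (Set.range (X t)) (Real.exp (t - t₀) • z))
      (∫ ξ, rate θ X ν t₀ ((t, z), ξ) ∂capMeasure n θ) I t := by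
  have hsub : I ⊆ Set.Ici 0 := fun s hs => (hz s hs).1
  have h1 := hasDerivWithinAt_integral_cap hI (θ := θ)
    (G := fun q : ℝ × Amb n => Real.log (movingSupport θ X t₀ ((q.1, z), q.2) / ell n θ q.2) *
      ell n θ q.2) (G' := fun q : ℝ × Amb n => rate θ X ν t₀ ((q.1, z), q.2))
    ((hf.continuousOn_log_moving hθ hM).comp
      (f := fun q : ℝ × Amb n => ((q.1, z), q.2)) (by fun_prop) fun q hq => ⟨hz _ hq.1, hq.2⟩)
    ((hf.continuousOn_rate hθ hM).comp
      (f := fun q : ℝ × Amb n => ((q.1, z), q.2)) (by fun_prop) fun q hq => ⟨hz _ hq.1, hq.2⟩)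
    (fun s hs ξ hξ => ?_) ht
  · exact h1.congr (fun s hs => hf.logIntegral_moving hθ hM (hsub hs) z)
      (hf.logIntegral_moving hθ hM (hsub ht) z)
  · have hl := ell_pos hθ hξ
    have hpos := (hz s hs).2 ξ hξ
    have h2 := (((hf.hasDerivWithinAt_movingSupport hθ hM (hsub hs) z hξ (t₀ := t₀)).mono
      hsub).div_const (ell n θ ξ)).log (div_pos hpos hl).ne'
    refine (h2.mul_const (ell n θ ξ)).congr_deriv ?_
    simp only [rate]
    field_simp

theorem exists_prod_subset_movingBase (hf : IsNormalizedFlow θ X ν)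
    (hθ : θ ∈ Set.Ioo 0 (Real.pi / 2)) (hM : ((𝓡∂ n).boundary M).Nonempty) (ht₀ : 0 ≤ t₀)
    {z : EuclideanSpace ℝ (Fin n)} (hz : z ∈ interior (flatPart (body (Set.range (X t₀))))) :
    ∃ r > 0, ∃ ε > 0, (Set.Ici 0 ∩ Metric.ball t₀ ε) ×ˢ Metric.closedBall z r ⊆
      movingBase θ X t₀ := by
  obtain ⟨r, hr, hball⟩ := Metric.nhds_basis_closedBall.mem_iff.mp (isOpen_interior.mem_nhds hz)
  refine ⟨r, hr, ?_⟩
  have hcomp : IsCompact (Metric.closedBall z r ×ˢ cap n θ) :=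
    (isCompact_closedBall z r).prod (isCompact_cap n θ)
  have hev := eventually_forall_pos_of_continuousOn (I := Set.Ici (0 : ℝ)) hcomp
    (f := fun q : ℝ × (EuclideanSpace ℝ (Fin n) × Amb n) =>
      movingSupport θ X t₀ ((q.1, q.2.1), q.2.2))
    ((hf.continuousOn_movingSupport hθ hM).comp
      (f := fun q : ℝ × (EuclideanSpace ℝ (Fin n) × Amb n) => ((q.1, q.2.1), q.2.2))
      (by fun_prop) fun q hq => ⟨⟨hq.1, trivial⟩, hq.2.2⟩) (t := t₀) ht₀ (fun p hp => by
        refine ((hf.mem_movingBase_iff hθ hM ht₀).mpr ?_).2 p.2 hp.2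
        rw [sub_self, Real.exp_zero, one_smul]
        exact hball hp.1)
  obtain ⟨ε, hε, hsub⟩ := Metric.mem_nhdsWithin_iff.mp hev
  refine ⟨ε, hε, fun q hq => ⟨hq.1.1, fun ξ hξ => ?_⟩⟩
  exact hsub ⟨hq.1.2, hq.1.1⟩ (q.2, ξ) ⟨hq.2, hξ⟩

end IsNormalizedFlow

/-- The integrand of the dissipation, expanded. -/
theorem sq_sqrt_sub_sqrt {a b : ℝ} (ha : 0 < a) (hb : 0 < b) :
    (Real.sqrt (a / b) - Real.sqrt (b / a)) ^ 2 = a / b + b / a - 2 := by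
  rw [sub_sq, Real.sq_sqrt (by positivity), Real.sq_sqrt (by positivity), mul_assoc,
    ← Real.sqrt_mul (by positivity), div_mul_div_cancel₀ hb.ne', div_self ha.ne', Real.sqrt_one]
  ring

namespace IsStrictlyConvexCapillary

variable {n : ℕ} [NeZero n] {M : Type*} [TopologicalSpace M] [CompactSpace M] [ConnectedSpace M]
  [ChartedSpace (EuclideanHalfSpace n) M] {θ : ℝ} {F N : M → Amb n}

theorem continuousOn_dissipation (hc : IsStrictlyConvexCapillary θ F N)
    (hθ : θ ∈ Set.Ioo 0 (Real.pi / 2)) (hM : ((𝓡∂ n).boundary M).Nonempty)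
    (hK : Continuous (gaussCurvature F N)) {z : EuclideanSpace ℝ (Fin n)}
    (hz : z ∈ interior (flatPart (body (Set.range F)))) :
    ContinuousOn (fun ξ => (Real.sqrt (capSupportFn θ (Set.range F) (incl z) ξ /
        capGaussCurvature θ F N ξ) - Real.sqrt (capGaussCurvature θ F N ξ /
          capSupportFn θ (Set.range F) (incl z) ξ)) ^ 2 * ell n θ ξ) (cap n θ) := by
  have h1 : ContinuousOn (capSupportFn θ (Set.range F) (incl z)) (cap n θ) :=
    (hc.continuousOn_supportFn hθ hM _).div (continuous_ell n θ).continuousOn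
      fun ξ hξ => (ell_pos hθ hξ).ne'
  have h2 := hc.continuousOn_capGaussCurvature hθ hM hK
  exact ((((h1.div h2 fun ξ _ => (hc.capGaussCurvature_pos ξ).ne').sqrt).sub
    ((h2.div h1 fun ξ hξ => (hc.capSupportFn_pos hθ hM hz hξ).ne').sqrt)).pow 2).mul
      (continuous_ell n θ).continuousOn

/-- The dissipation vanishes exactly for the solitons. -/
theorem dissipation_eq_zero_iff (hc : IsStrictlyConvexCapillary θ F N)
    (hθ : θ ∈ Set.Ioo 0 (Real.pi / 2)) (hM : ((𝓡∂ n).boundary M).Nonempty)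
    (hK : Continuous (gaussCurvature F N)) {z : EuclideanSpace ℝ (Fin n)}
    (hz : z ∈ interior (flatPart (body (Set.range F)))) :
    dissipation θ (capSupportFn θ (Set.range F) (incl z)) (capGaussCurvature θ F N) = 0 ↔
      IsSolitonAbout θ F N (incl z) := by
  have hiff : IsSolitonAbout θ F N (incl z) ↔ ∀ ξ ∈ cap n θ,
      capGaussCurvature θ F N ξ = capSupportFn θ (Set.range F) (incl z) ξ := by
    have key : ∀ x, capSupportFn θ (Set.range F) (incl z) (capGaussMap θ N x) =
        inner ℝ (F x - incl z) (N x) / (1 + Real.cos θ * inner ℝ (N x) (eVec n)) := by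
      intro x
      have e : ell n θ (capGaussMap θ N x) = 1 + Real.cos θ * inner ℝ (N x) (eVec n) := by
        rw [capGaussMap, ell_add, inner_eVec]
        ring
      rw [capSupportFn, e, hc.supportFn_eq_of_normal _ x (capNormal_capGaussMap θ N x).symm,
        capNormal_capGaussMap, real_inner_comm]
    constructor
    · intro h ξ hξ
      have h1 := key (Function.invFun (capGaussMap θ N) ξ)
      rw [hc.capGaussMap_invFun hθ hM hξ] at h1
      rw [h1]
      exact h _
    · intro h x
      have h1 := h _ (hc.capGaussMap_mem hM x)
      rw [key, capGaussCurvature, hc.invFun_capGaussMap hθ hM] at h1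
      exact h1
  rw [hiff]
  constructor
  · intro h ξ hξ
    have h1 := eq_zero_of_integral_eq_zero hθ (hc.continuousOn_dissipation hθ hM hK hz)
      (fun ξ hξ => mul_nonneg (sq_nonneg _) (ell_pos hθ hξ).le) h ξ hξ
    have hU := hc.capSupportFn_pos hθ hM hz hξ
    have hKp := hc.capGaussCurvature_pos (θ := θ) ξ
    have h2 := (mul_eq_zero.mp h1).resolve_right (ell_pos hθ hξ).ne'
    rw [sq_sqrt_sub_sqrt hU hKp] at h2
    field_simp at h2
    -- After clearing denominators, `U / K + K / U - 2 = 0` says `(U - K)² = 0`.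
    have h3 : (capSupportFn θ (Set.range F) (incl z) ξ - capGaussCurvature θ F N ξ) ^ 2 = 0 := by
      linarith
    exact (sub_eq_zero.mp (pow_eq_zero_iff two_ne_zero |>.mp h3)).symm
  · intro h
    rw [dissipation, integral_congr_cap (g := fun _ => 0) fun ξ hξ => by rw [h ξ hξ]; simp]
    simp

theorem isGreatest_entropyAt (hθ : θ ∈ Set.Ioo 0 (Real.pi / 2)) {S : Set (Amb n)}
    {z : EuclideanSpace ℝ (Fin n)} (hz : z ∈ interior (flatPart (body S)))
    (hmax : IsMaxOn (logIntegral θ S) (interior (flatPart (body S))) z) :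
    IsGreatest (entropyAt θ S '' interior (flatPart (body S))) (entropyAt θ S z) := by
  refine ⟨⟨z, hz, rfl⟩, ?_⟩
  rintro _ ⟨z', hz', rfl⟩
  rw [entropyAt_eq, entropyAt_eq]
  exact mul_le_mul_of_nonneg_left (hmax hz') (one_div_nonneg.mpr (omega_pos hθ).le)

theorem entropy_eq (hθ : θ ∈ Set.Ioo 0 (Real.pi / 2)) {S : Set (Amb n)}
    {z : EuclideanSpace ℝ (Fin n)} (hz : z ∈ interior (flatPart (body S)))
    (hmax : IsMaxOn (logIntegral θ S) (interior (flatPart (body S))) z) :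
    entropy θ S = 1 / omega n θ * logIntegral θ S z :=
  (isGreatest_entropyAt hθ hz hmax).csSup_eq

end IsStrictlyConvexCapillary

end CapillaryFlow

end

/-! ### Differentiability and monotonicity of the entropy. -/

noncomputable section
set_option linter.unusedSectionVars false
namespace CapillaryFlow

open Filter Topology MeasureTheory

/-- If the maximum of a quasiconcave function exceeds its values on a sphere around an interior
competitor, then it is attained in the ball. -/
theorem mem_closedBall_of_sphere_lt {E : Type*} [NormedAddCommGroup E] [NormedSpace ℝ E] {Ω : Set E}
    {f : E → ℝ} (hf : QuasiconcaveOn ℝ Ω f) {a p : E} (ha : a ∈ Ω) (hp : p ∈ Ω)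
    (hap : f a ≤ f p) {r : ℝ} (hr : 0 < r) (hs : ∀ y ∈ Metric.sphere a r, f y < f a) :
    p ∈ Metric.closedBall a r := by
  by_contra h
  rw [Metric.mem_closedBall, not_le, dist_eq_norm] at h
  have hn : 0 < ‖p - a‖ := hr.trans h
  have hq : a + (r / ‖p - a‖) • (p - a) ∈ {x ∈ Ω | f a ≤ f x} :=
    (hf (f a)).add_smul_sub_mem ⟨ha, le_rfl⟩ ⟨hp, hap⟩
      ⟨by positivity, (div_le_one hn).mpr h.le⟩
  refine (hs _ ?_).not_ge hq.2
  rw [mem_sphere_iff_norm, add_sub_cancel_left, norm_smul, Real.norm_of_nonneg (by positivity),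
    div_mul_cancel₀ _ hn.ne']

namespace IsNormalizedFlow

variable {n : ℕ} [NeZero n] {M : Type*} [TopologicalSpace M] [CompactSpace M] [ConnectedSpace M]
  [ChartedSpace (EuclideanHalfSpace n) M] [IsManifold (𝓡∂ n) ∞ M] {θ : ℝ} {X ν : ℝ → M → Amb n}
  {t₀ : ℝ}

/-- The rate plus the integrand of the dissipation is `h / K - ℓ`, whose integral vanishes by the
normalization identity, that is by conservation of volume. -/
theorem integral_rate_eq (hf : IsNormalizedFlow θ X ν)
    (hθ : θ ∈ Set.Ioo 0 (Real.pi / 2)) (hM : ((𝓡∂ n).boundary M).Nonempty)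
    (hvol : volume (body (Set.range (X 0))) = volume (body (cap n θ))) {t : ℝ}
    {z : EuclideanSpace ℝ (Fin n)} (hz : (t, z) ∈ movingBase θ X t₀) :
    ∫ ξ, rate θ X ν t₀ ((t, z), ξ) ∂capMeasure n θ =
      -dissipation θ (capSupportFn θ (Set.range (X t)) (incl (Real.exp (t - t₀) • z)))
        (capGaussCurvature θ (X t) (ν t)) := by
  have ht : 0 ≤ t := hz.1
  have hc := hf.capillary t ht
  have hzΩ := (hf.mem_movingBase_iff hθ hM ht).mp hz
  have hK := hf.continuous_gaussCurvature hθ hM ht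
  set y := Real.exp (t - t₀) • z
  have h1 := hf.integral_supportFn_div hθ hM hvol ht hzΩ
  have i1 := integrable_of_continuousOn (hc.continuousOn_dissipation hθ hM hK hzΩ)
  have i2 := integrable_of_continuousOn (continuousOn_slice (hf.continuousOn_rate hθ hM) hz)
  have hpos := (hc.mem_interior_flatPart_iff_supportFn_pos hθ hM).mp hzΩ
  have hsum : ∫ ξ, (rate θ X ν t₀ ((t, z), ξ) +
      (Real.sqrt (capSupportFn θ (Set.range (X t)) (incl y) ξ /
        capGaussCurvature θ (X t) (ν t) ξ) - Real.sqrt (capGaussCurvature θ (X t) (ν t) ξ /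
          capSupportFn θ (Set.range (X t)) (incl y) ξ)) ^ 2 * ell n θ ξ) ∂capMeasure n θ =
      ∫ ξ, (supportFn θ (Set.range (X t)) (incl y) ξ / capGaussCurvature θ (X t) (ν t) ξ -
        ell n θ ξ) ∂capMeasure n θ := by
    refine integral_congr_cap fun ξ hξ => ?_
    have hl := ell_pos hθ hξ
    have hh := hpos ξ hξ
    have hk := hc.capGaussCurvature_pos (θ := θ) ξ
    have hm : movingSupport θ X t₀ ((t, z), ξ) = supportFn θ (Set.range (X t)) (incl y) ξ :=
      hf.movingSupport_eq hθ hM ht z hξ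
    rw [sq_sqrt_sub_sqrt (hc.capSupportFn_pos hθ hM hzΩ hξ) hk, rate, hm, capSupportFn]
    field_simp
    ring
  have i3 : Integrable (fun ξ => supportFn θ (Set.range (X t)) (incl y) ξ /
      capGaussCurvature θ (X t) (ν t) ξ) (capMeasure n θ) :=
    integrable_of_continuousOn ((hc.continuousOn_supportFn hθ hM _).div
      (hc.continuousOn_capGaussCurvature hθ hM hK) fun ξ _ => (hc.capGaussCurvature_pos ξ).ne')
  rw [integral_add i2 i1, integral_sub i3
    (integrable_of_continuousOn (continuous_ell n θ).continuousOn), h1, sub_self] at hsum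
  exact eq_neg_of_add_eq_zero_left hsum

/-- The maximum over the admissible base points is attained near the moving one. -/
theorem exists_forall_isGreatest (hf : IsNormalizedFlow θ X ν)
    (hθ : θ ∈ Set.Ioo 0 (Real.pi / 2)) (hM : ((𝓡∂ n).boundary M).Nonempty) (ht₀ : 0 ≤ t₀)
    {z : EuclideanSpace ℝ (Fin n)} (hz : z ∈ interior (flatPart (body (Set.range (X t₀)))))
    (hmax : IsMaxOn (logIntegral θ (Set.range (X t₀)))
      (interior (flatPart (body (Set.range (X t₀))))) z) :
    ∃ r > 0, ∃ ε > 0, (Set.Ici 0 ∩ Metric.ball t₀ ε) ×ˢ Metric.closedBall z r ⊆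
      movingBase θ X t₀ ∧ ∀ t ∈ Set.Ici 0 ∩ Metric.ball t₀ ε,
        IsGreatest (Set.range fun y : Metric.closedBall z r =>
          logIntegral θ (Set.range (X t)) (Real.exp (t - t₀) • (y : EuclideanSpace ℝ (Fin n))))
          (omega n θ * entropy θ (Set.range (X t))) := by
  obtain ⟨r, hr, ε₁, hε₁, hsub⟩ := hf.exists_prod_subset_movingBase hθ hM ht₀ hz
  set I₁ := Set.Ici (0 : ℝ) ∩ Metric.ball t₀ ε₁
  have hcont := (hf.continuousOn_logIntegral_moving hθ hM).mono hsub
  have hzb : z ∈ Metric.closedBall z r := Metric.mem_closedBall_self hr.le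
  have hdiff : ContinuousOn (fun q : ℝ × EuclideanSpace ℝ (Fin n) =>
      logIntegral θ (Set.range (X q.1)) (Real.exp (q.1 - t₀) • z) -
        logIntegral θ (Set.range (X q.1)) (Real.exp (q.1 - t₀) • q.2))
      (I₁ ×ˢ Metric.sphere z r) := by
    refine ContinuousOn.sub ?_ (hcont.mono (Set.prod_mono_right Metric.sphere_subset_closedBall))
    exact hcont.comp (f := fun q : ℝ × EuclideanSpace ℝ (Fin n) => (q.1, z)) (by fun_prop)
      fun q hq => ⟨hq.1, hzb⟩
  have ht₀I : t₀ ∈ I₁ := ⟨ht₀, Metric.mem_ball_self hε₁⟩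
  -- Strict concavity makes the centre strictly better than the sphere at `t₀`; by compactness this
  -- persists for nearby times.
  have hstrict : ∀ y ∈ Metric.sphere z r, 0 <
      logIntegral θ (Set.range (X t₀)) (Real.exp (t₀ - t₀) • z) -
        logIntegral θ (Set.range (X t₀)) (Real.exp (t₀ - t₀) • y) := by
    intro y hy
    have hyΩ := (hf.mem_movingBase_iff hθ hM ht₀).mp
      (hsub ⟨ht₀I, Metric.sphere_subset_closedBall hy⟩)
    simp only [sub_self, Real.exp_zero, one_smul] at hyΩ ⊢
    refine sub_pos.mpr (lt_of_le_of_ne (hmax hyΩ) fun h => ?_)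
    have h1 := ((hf.capillary t₀ ht₀).strictConcaveOn_logIntegral hθ hM).eq_of_isMaxOn
      (fun w hw => (hmax hw).trans_eq h.symm) hmax hyΩ hz
    rw [h1, mem_sphere_iff_norm, sub_self, norm_zero] at hy
    exact hr.ne hy
  have hev := eventually_forall_pos_of_continuousOn (isCompact_sphere z r) hdiff ht₀I hstrict
  obtain ⟨ε₂, hε₂, hball⟩ := Metric.mem_nhdsWithin_iff.mp hev
  refine ⟨r, hr, min ε₁ ε₂, lt_min hε₁ hε₂, ?_, fun t ht => ?_⟩
  · exact (Set.prod_mono_left (Set.inter_subset_inter_right _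
      (Metric.ball_subset_ball (min_le_left _ _)))).trans hsub
  · have htI : t ∈ I₁ := ⟨ht.1, Metric.ball_subset_ball (min_le_left _ _) ht.2⟩
    have hc := hf.capillary t ht.1
    have hexp := Real.exp_pos (t - t₀)
    have hbase : ∀ y ∈ Metric.closedBall z r,
        Real.exp (t - t₀) • y ∈ interior (flatPart (body (Set.range (X t)))) := fun y hy =>
      (hf.mem_movingBase_iff hθ hM ht.1).mp (hsub ⟨htI, hy⟩)
    obtain ⟨p, hp, hpmax⟩ := hc.exists_isMaxOn_logIntegral hθ hM
    have hω := omega_pos (n := n) hθ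
    have hent : omega n θ * entropy θ (Set.range (X t)) = logIntegral θ (Set.range (X t)) p := by
      rw [IsStrictlyConvexCapillary.entropy_eq hθ hp hpmax]
      field_simp
    -- By concavity at time `t`, a maximizer outside the rescaled ball would force a value on its
    -- sphere at least as large as at the centre.
    have hpin : p ∈ Metric.closedBall (Real.exp (t - t₀) • z) (Real.exp (t - t₀) * r) := by
      refine mem_closedBall_of_sphere_lt
        (hc.strictConcaveOn_logIntegral hθ hM).concaveOn.quasiconcaveOn (hbase z hzb) hp
        (hpmax (hbase z hzb)) (by positivity) fun y hy => ?_
      have hy' : (Real.exp (t - t₀))⁻¹ • y ∈ Metric.sphere z r := by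
        rw [mem_sphere_iff_norm] at hy ⊢
        have e : (Real.exp (t - t₀))⁻¹ • y - z =
            (Real.exp (t - t₀))⁻¹ • (y - Real.exp (t - t₀) • z) := by
          rw [smul_sub, inv_smul_smul₀ hexp.ne']
        rw [e, norm_smul, hy, norm_inv, Real.norm_of_nonneg hexp.le,
          inv_mul_cancel_left₀ hexp.ne']
      have h1 := hball ⟨Metric.ball_subset_ball (min_le_right _ _) ht.2, htI⟩ _ hy'
      simp only [smul_inv_smul₀ hexp.ne'] at h1
      linarith
    rw [hent]
    refine ⟨⟨⟨(Real.exp (t - t₀))⁻¹ • p, ?_⟩, ?_⟩, ?_⟩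
    · rw [mem_closedBall_iff_norm] at hpin ⊢
      have e : (Real.exp (t - t₀))⁻¹ • p - z =
          (Real.exp (t - t₀))⁻¹ • (p - Real.exp (t - t₀) • z) := by
        rw [smul_sub, inv_smul_smul₀ hexp.ne']
      rw [e, norm_smul, norm_inv, Real.norm_of_nonneg hexp.le, inv_mul_le_iff₀ hexp]
      exact hpin
    · simp only [smul_inv_smul₀ hexp.ne']
    · rintro _ ⟨y, rfl⟩
      exact hpmax (hbase y y.2)

/-- The derivative of the entropy. -/
theorem hasDerivWithinAt_entropy (hf : IsNormalizedFlow θ X ν)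
    (hθ : θ ∈ Set.Ioo 0 (Real.pi / 2)) (hM : ((𝓡∂ n).boundary M).Nonempty)
    (hvol : volume (body (Set.range (X 0))) = volume (body (cap n θ))) (ht₀ : 0 ≤ t₀)
    {z : EuclideanSpace ℝ (Fin n)} (hz : z ∈ interior (flatPart (body (Set.range (X t₀)))))
    (hmax : IsMaxOn (logIntegral θ (Set.range (X t₀)))
      (interior (flatPart (body (Set.range (X t₀))))) z) :
    HasDerivWithinAt (fun t => entropy θ (Set.range (X t)))
      (-(1 / omega n θ) * dissipation θ (capSupportFn θ (Set.range (X t₀)) (incl z))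
        (capGaussCurvature θ (X t₀) (ν t₀))) (Set.Ici 0) t₀ := by
  obtain ⟨r, hr, ε, hε, hsub, hgr⟩ := hf.exists_forall_isGreatest hθ hM ht₀ hz hmax
  set I := Set.Ici (0 : ℝ) ∩ Metric.ball t₀ ε
  have hI : Convex ℝ I := (convex_Ici 0).inter (convex_ball t₀ ε)
  have ht₀I : t₀ ∈ I := ⟨ht₀, Metric.mem_ball_self hε⟩
  have hZ : CompactSpace (Metric.closedBall z r) :=
    isCompact_iff_compactSpace.mp (isCompact_closedBall z r)
  have hzb : z ∈ Metric.closedBall z r := Metric.mem_closedBall_self hr.le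
  have hemb : Continuous fun q : ℝ × Metric.closedBall z r =>
    (q.1, (q.2 : EuclideanSpace ℝ (Fin n))) := by fun_prop
  have hmap : Set.MapsTo (fun q : ℝ × Metric.closedBall z r =>
      (q.1, (q.2 : EuclideanSpace ℝ (Fin n)))) (I ×ˢ Set.univ) (movingBase θ X t₀) :=
    fun q hq => hsub ⟨hq.1, q.2.2⟩
  obtain ⟨φ, hφ⟩ : ∃ φ : ℝ → EuclideanSpace ℝ (Fin n) → ℝ,
    φ = fun t y => logIntegral θ (Set.range (X t)) (Real.exp (t - t₀) • y) := ⟨_, rfl⟩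
  obtain ⟨φ', hφ'⟩ : ∃ φ' : ℝ → EuclideanSpace ℝ (Fin n) → ℝ,
    φ' = fun t y => ∫ ξ, rate θ X ν t₀ ((t, y), ξ) ∂capMeasure n θ := ⟨_, rfl⟩
  have hcφ : ContinuousOn (fun q : ℝ × EuclideanSpace ℝ (Fin n) => φ q.1 q.2)
      (movingBase θ X t₀) := by
    rw [hφ]
    exact hf.continuousOn_logIntegral_moving hθ hM
  have hcφ' : ContinuousOn (fun q : ℝ × EuclideanSpace ℝ (Fin n) => φ' q.1 q.2)
      (movingBase θ X t₀) := by
    rw [hφ']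
    exact continuousOn_integral_cap (hf.continuousOn_rate hθ hM)
  have hder : ∀ t ∈ I, ∀ y ∈ Metric.closedBall z r,
      HasDerivWithinAt (fun t => φ t y) (φ' t y) I t := by
    intro t ht y hy
    rw [hφ, hφ']
    exact hf.hasDerivWithinAt_logIntegral_moving hθ hM hI (fun s hs => hsub ⟨hs, hy⟩) ht
  have huniq : ∀ y ∈ Metric.closedBall z r, y ≠ z → φ t₀ y < φ t₀ z := by
    intro y hy hne
    have hyΩ := (hf.mem_movingBase_iff hθ hM ht₀).mp (hsub ⟨ht₀I, hy⟩)
    rw [hφ]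
    simp only [sub_self, Real.exp_zero, one_smul] at hyΩ ⊢
    refine lt_of_le_of_ne (hmax hyΩ) fun h => hne ?_
    exact ((hf.capillary t₀ ht₀).strictConcaveOn_logIntegral hθ hM).eq_of_isMaxOn
      (fun w hw => (hmax hw).trans_eq h.symm) hmax hyΩ hz
  have hgr' : ∀ t ∈ I, IsGreatest (Set.range fun y : Metric.closedBall z r => φ t y)
      (omega n θ * entropy θ (Set.range (X t))) := by
    rw [hφ]
    exact hgr
  -- In the rescaled base points the supremum over the varying open flat parts is a maximum over one
  -- fixed compact ball, as the envelope theorem requires; only the rate at `z` itself survives.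
  have h1 := hasDerivWithinAt_max (Z := Metric.closedBall z r) hI
    (φ := fun t y => φ t y) (φ' := fun t y => φ' t y)
    (hcφ.comp hemb.continuousOn hmap) (hcφ'.comp hemb.continuousOn hmap)
    (fun t ht y => hder t ht y y.2) ht₀I (z₀ := ⟨z, hzb⟩)
    (fun y hy => huniq y y.2 fun h => hy (Subtype.ext h)) hgr'
  simp only [hφ'] at h1
  have h2 := (h1.mono_of_mem_nhdsWithin (inter_mem_nhdsWithin (Set.Ici 0)
    (Metric.ball_mem_nhds t₀ hε))).const_mul (1 / omega n θ)
  have hω := omega_pos (n := n) hθ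
  rw [hf.integral_rate_eq hθ hM hvol (hsub ⟨ht₀I, hzb⟩), sub_self,
    Real.exp_zero, one_smul, mul_neg, ← neg_mul] at h2
  refine h2.congr_of_eventuallyEq (Eventually.of_forall fun t => ?_) ?_
  · field_simp
  · field_simp

theorem antitoneOn_entropy (hf : IsNormalizedFlow θ X ν)
    (hθ : θ ∈ Set.Ioo 0 (Real.pi / 2)) (hM : ((𝓡∂ n).boundary M).Nonempty)
    (hvol : volume (body (Set.range (X 0))) = volume (body (cap n θ))) :
    AntitoneOn (fun t => entropy θ (Set.range (X t))) (Set.Ici 0) := by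
  have hder : ∀ t : ℝ, 0 ≤ t → ∃ d ≤ 0,
      HasDerivWithinAt (fun t => entropy θ (Set.range (X t))) d (Set.Ici 0) t := by
    intro t ht
    obtain ⟨z, hz, hmax⟩ := (hf.capillary t ht).exists_isMaxOn_logIntegral hθ hM
    refine ⟨_, ?_, hf.hasDerivWithinAt_entropy hθ hM hvol ht hz hmax⟩
    rw [neg_mul, neg_nonpos]
    refine mul_nonneg (one_div_nonneg.mpr (omega_pos hθ).le) ?_
    refine integral_nonneg_of_ae ?_
    filter_upwards [ae_mem_cap n θ] with ξ hξ
    exact mul_nonneg (sq_nonneg _) (ell_pos hθ hξ).le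
  refine antitoneOn_of_deriv_nonpos (convex_Ici 0) (fun t ht => ?_) (fun t ht => ?_) fun t ht => ?_
  · obtain ⟨d, -, hd⟩ := hder t ht
    exact hd.continuousWithinAt
  · rw [interior_Ici] at ht
    obtain ⟨d, -, hd⟩ := hder t (le_of_lt ht)
    exact (hd.hasDerivAt (Ici_mem_nhds ht)).differentiableAt.differentiableWithinAt
  · rw [interior_Ici] at ht
    obtain ⟨d, h0, hd⟩ := hder t (le_of_lt ht)
    rw [(hd.hasDerivAt (Ici_mem_nhds ht)).deriv]
    exact h0

end IsNormalizedFlow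

end CapillaryFlow

end

/-! ### The main theorem. -/

theorem proposition4 (n : ℕ) [NeZero n]
    {M : Type*} [TopologicalSpace M] [CompactSpace M] [ConnectedSpace M]
    [ChartedSpace (EuclideanHalfSpace n) M] [IsManifold (𝓡∂ n) ∞ M]
    (hM : ((𝓡∂ n).boundary M).Nonempty)
    (θ : ℝ) (hθ : θ ∈ Set.Ioo 0 (Real.pi / 2))
    (X ν : ℝ → M → CapillaryFlow.Amb n)
    (hflow : CapillaryFlow.IsNormalizedFlow θ X ν)
    (hvol : MeasureTheory.volume (CapillaryFlow.body (Set.range (X 0))) =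
      MeasureTheory.volume (CapillaryFlow.body (CapillaryFlow.cap n θ))) :
    AntitoneOn (fun t => CapillaryFlow.entropy θ (Set.range (X t))) (Set.Ici 0) ∧
    ∀ t₀ : ℝ, 0 ≤ t₀ →
      ∃ z : EuclideanSpace ℝ (Fin n),
        CapillaryFlow.IsEntropyPoint θ (Set.range (X t₀)) z ∧
        (∀ z', CapillaryFlow.IsEntropyPoint θ (Set.range (X t₀)) z' → z' = z) ∧
        HasDerivWithinAt (fun t => CapillaryFlow.entropy θ (Set.range (X t)))
          (-(1 / CapillaryFlow.omega n θ) *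
            CapillaryFlow.dissipation θ
              (CapillaryFlow.capSupportFn θ (Set.range (X t₀)) (CapillaryFlow.incl z))
              (CapillaryFlow.capGaussCurvature θ (X t₀) (ν t₀)))
          (Set.Ici 0) t₀ ∧
        (CapillaryFlow.dissipation θ
            (CapillaryFlow.capSupportFn θ (Set.range (X t₀)) (CapillaryFlow.incl z))
            (CapillaryFlow.capGaussCurvature θ (X t₀) (ν t₀)) = 0 ↔
          CapillaryFlow.IsSolitonAbout θ (X t₀) (ν t₀) (CapillaryFlow.incl z)) ∧
        ∃ ε > 0, ∀ t : ℝ, 0 ≤ t → |t - t₀| < ε →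
          (∀ ξ ∈ CapillaryFlow.cap n θ, 0 < CapillaryFlow.movingSupportFn θ
            (fun s => Set.range (X s)) t₀ z t ξ) ∧
          MeasureTheory.Integrable (fun ξ => Real.log (CapillaryFlow.movingSupportFn θ
              (fun s => Set.range (X s)) t₀ z t ξ) * CapillaryFlow.ell n θ ξ)
            (CapillaryFlow.capMeasure n θ) ∧
          MeasureTheory.Integrable (fun ξ =>
              (Real.sqrt (CapillaryFlow.movingSupportFn θ (fun s => Set.range (X s)) t₀ z t ξ /
                  CapillaryFlow.capGaussCurvature θ (X t) (ν t) ξ) -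
                Real.sqrt (CapillaryFlow.capGaussCurvature θ (X t) (ν t) ξ /
                  CapillaryFlow.movingSupportFn θ (fun s => Set.range (X s)) t₀ z t ξ)) ^ 2 *
                CapillaryFlow.ell n θ ξ)
            (CapillaryFlow.capMeasure n θ) ∧
          HasDerivWithinAt
            (fun s => ∫ ξ, Real.log (CapillaryFlow.movingSupportFn θ
                (fun s => Set.range (X s)) t₀ z s ξ) * CapillaryFlow.ell n θ ξ
              ∂(CapillaryFlow.capMeasure n θ))
            (-CapillaryFlow.dissipation θ
              (CapillaryFlow.movingSupportFn θ (fun s => Set.range (X s)) t₀ z t)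
              (CapillaryFlow.capGaussCurvature θ (X t) (ν t)))
            (Set.Ici 0) t := by
  open CapillaryFlow MeasureTheory in
  refine ⟨hflow.antitoneOn_entropy hθ hM hvol, fun t₀ ht₀ => ?_⟩
  have hc := hflow.capillary t₀ ht₀
  obtain ⟨z, hz, hmax⟩ := hc.exists_isMaxOn_logIntegral hθ hM
  have hgr := IsStrictlyConvexCapillary.isGreatest_entropyAt hθ hz hmax
  refine ⟨z, ⟨hz, hgr, hgr.csSup_eq.symm⟩, fun z' hz' => ?_,
    hflow.hasDerivWithinAt_entropy hθ hM hvol ht₀ hz hmax,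
    hc.dissipation_eq_zero_iff hθ hM (hflow.continuous_gaussCurvature hθ hM ht₀) hz, ?_⟩
  · refine (hc.strictConcaveOn_logIntegral hθ hM).eq_of_isMaxOn (fun w hw => ?_) hmax hz'.1 hz
    have h1 := hz'.2.1.2 ⟨w, hw, rfl⟩
    rw [entropyAt_eq, entropyAt_eq] at h1
    exact le_of_mul_le_mul_left h1 (one_div_pos.mpr (omega_pos hθ))
  · obtain ⟨r, hr, ε, hε, hsub⟩ := hflow.exists_prod_subset_movingBase hθ hM ht₀ hz
    refine ⟨ε, hε, fun t ht htε => ?_⟩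
    have hball : t ∈ Metric.ball t₀ ε := by rwa [Metric.mem_ball, Real.dist_eq]
    have hzr : z ∈ Metric.closedBall z r := Metric.mem_closedBall_self hr.le
    have hmem : (t, z) ∈ IsNormalizedFlow.movingBase θ X t₀ := hsub ⟨⟨ht, hball⟩, hzr⟩
    have hct := hflow.capillary t ht
    have hzt := (hflow.mem_movingBase_iff hθ hM ht).mp hmem
    have hU : ∀ s, 0 ≤ s → ∀ ξ ∈ cap n θ,
        movingSupportFn θ (fun s => Set.range (X s)) t₀ z s ξ =
          capSupportFn θ (Set.range (X s)) (incl (Real.exp (s - t₀) • z)) ξ :=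
      fun s hs ξ hξ => hflow.movingSupportFn_eq hθ hM hs z hξ
    have hlog : ∀ s, 0 ≤ s → ∫ ξ, Real.log (movingSupportFn θ (fun s => Set.range (X s)) t₀ z s ξ) *
        ell n θ ξ ∂capMeasure n θ =
          logIntegral θ (Set.range (X s)) (Real.exp (s - t₀) • z) := fun s hs =>
      integral_congr_cap fun ξ hξ => by rw [hU s hs ξ hξ]
    refine ⟨fun ξ hξ => ?_, ?_, ?_, ?_⟩
    · rw [hU t ht ξ hξ]
      exact hct.capSupportFn_pos hθ hM hzt hξ
    · refine (hct.integrable_log_mul_ell hθ hM hzt).congr ?_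
      filter_upwards [ae_mem_cap n θ] with ξ hξ
      rw [hU t ht ξ hξ]
    · refine (integrable_of_continuousOn (hct.continuousOn_dissipation hθ hM
        (hflow.continuous_gaussCurvature hθ hM ht) hzt)).congr ?_
      filter_upwards [ae_mem_cap n θ] with ξ hξ
      rw [hU t ht ξ hξ]
    -- The derivative is taken within the times near `t₀` at which the moving point is admissible.
    -- These form a neighbourhood of `t` in `[0, ∞)`, so the derivative within `[0, ∞)` is the same.
    · have h1 := (hflow.hasDerivWithinAt_logIntegral_moving hθ hM
        ((convex_Ici 0).inter (convex_ball t₀ ε)) (fun s hs => hsub ⟨hs, hzr⟩)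
        ⟨ht, hball⟩).mono_of_mem_nhdsWithin (inter_mem_nhdsWithin (Set.Ici 0)
          (Metric.isOpen_ball.mem_nhds hball))
      rw [hflow.integral_rate_eq hθ hM hvol hmem] at h1
      have hd : dissipation θ (movingSupportFn θ (fun s => Set.range (X s)) t₀ z t)
          (capGaussCurvature θ (X t) (ν t)) =
          dissipation θ (capSupportFn θ (Set.range (X t)) (incl (Real.exp (t - t₀) • z)))
            (capGaussCurvature θ (X t) (ν t)) :=
        integral_congr_cap fun ξ hξ => by rw [hU t ht ξ hξ]
      rw [hd]
      exact h1.congr (fun s hs => hlog s hs) (hlog t ht)
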